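/- **Setting.** Kinds are $*$ and $\kappa_1\Rightarrow\kappa_2$. Interpretation type constructors are those of System $\mathtt F_\omega$ over the single type constant $\mathtt{nat}:*$ (variables $\alpha$, infinitely many of each kind; applications $\varphi\psi$; abstractions $\lambda\alpha:\kappa.\varphi$; and, at kind $*$, the types $\sigma\to\tau$ and $\forall\alpha:\kappa.\tau$), considered up to $\alpha$-conversion; $=_\beta$ is $\beta$-equality and $\mathrm{nf}_\beta$ the $\beta$-normal form. Put $\chi_*=\mathtt{nat}$ and $\chi_{\kappa_1\Rightarrow\kappa_2}=\lambda\alpha:\kappa_1.\chi_{\kappa_2}$. Interpretation terms are the Church-style typed terms of System $\mathtt F_\omega$, built from term variables (each with a fixed declared type, infinitely many for each type), the function symbols $n:\mathtt{nat}$ ($n\in\mathbb N$), $\oplus,\otimes:\forall\alpha.\alpha\to\alpha\to\alpha$, $\mathtt{flatten}:\forall\alpha.\alpha\to\mathtt{nat}$, $\mathtt{lift}:\forall\alpha.\mathtt{nat}\to\alpha$, and $\lambda x:\sigma.s$, $\Lambda\alpha:\kappa.s$ (where $\alpha$ is not free in the type of a free variable of $s$), $s\,t$, $s\,\tau$, with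 the rule that $s:\tau$ if $s:\tau'$ and $\tau=_\beta\tau'$. Terms are identified modulo $\beta$-conversion in types. We write $\oplus_\sigma$ for $\oplus\,\sigma$ etc., use $\oplus,\otimes$ infix, and omit type indices. The relation $\leadsto$ is the closure, under all term constructors, of ($\circ\in\{\oplus,\otimes\}$): $(\lambda x.s)t\leadsto s[x:=t]$; $(\Lambda\alpha.s)\sigma\leadsto s[\alpha:=\sigma]$; $n\oplus_{\mathtt{nat}}m\leadsto n+m$; $n\otimes_{\mathtt{nat}}m\leadsto n\cdot m$; $s\circ_{\sigma\to\tau}t\leadsto\lambda x:\sigma.(s\,x\circ_\tau t\,x)$; $s\circ_{\forall\alpha.\sigma}t\leadsto\Lambda\alpha.(s\,\alpha\circ_\sigma t\,\alpha)$; $\mathtt{flatten}_{\mathtt{nat}}s\leadsto s$; $\mathtt{flatten}_{\sigma\to\tau}s\leadsto\mathtt{flatten}_\tau(s(\mathtt{lift}_\sigma 0))$; $\mathtt{flatten}_{\forall\alpha:\kappa.\sigma}s\leadsto\mathtt{flatten}_{\sigma[\alpha:=\chi_\kappa]}(s\,\chi_\kappa)$; $\mathtt{lift}_{\mathtt{nat}}s\leadsto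 s$; $\mathtt{lift}_{\sigma\to\tau}s\leadsto\lambda x:\sigma.\mathtt{lift}_\tau s$; $\mathtt{lift}_{\forall\alpha.\sigma}s\leadsto\Lambda\alpha.\mathtt{lift}_\sigma s$. Write $s{\downarrow}$ for the $\leadsto$-normal form of $s$. A term is closed if it has no free term variables and no free type constructor variables, and final if it is closed and in normal form. For closed terms of a closed $\beta$-normal type, $\succ^0$ is the largest relation such that $s\succ^0_\sigma t$ implies one of: $\sigma=\mathtt{nat}$ and $s{\downarrow}>t{\downarrow}$ in $\mathbb N$; or $\sigma=\tau_1\to\tau_2$ and $s\,q\succ^0_{\tau_2}t\,q$ for all final $q$ of type $\tau_1$; or $\sigma=\forall\alpha:\kappa.\rho$ and $s\,\tau\succ^0_{\mathrm{nf}_\beta(\rho[\alpha:=\tau])}t\,\tau$ for all closed $\tau$ of kind $\kappa$. The relation $\succeq^0$ is defined likewise with $\geq$ in place of $>$. A closure $\mathcal C=\gamma\circ\omega$ is a substitution $\omega$ of closed type constructors for all type constructor variables (respecting kinds) followed by a substitution $\gamma$ of a closed term of type $\omega(\tau)$ for each term variable of type $\tau$. For arbitrary terms $s,t$ of type $\sigma$,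 $s\succ_\sigma t$ means $\mathcal C(s)\succ^0_{\mathrm{nf}_\beta(\mathcal C(\sigma))}\mathcal C(t)$ for every closure $\mathcal C$; similarly for $\succeq$. An interpretation term $t$ is *safe for* a variable $x$ if, for all terms $s_1,s_2$ of the type of $x$, $s_1\succ s_2$ implies $t[x:=s_1]\succ t[x:=s_2]$. **Lemma (safety criteria).** Let $x$ be a term variable. All compound expressions below are assumed to be (well-typed) interpretation terms. 1. $x\,u_1\ldots u_m$ ($m\ge 0$, each $u_i$ a term or a type constructor, in which $x$ may occur) is safe for $x$. 2. If $t$ is safe for $x$, then so are $\mathtt{lift}_\sigma(t)$ (for $t:\mathtt{nat}$ and every type $\sigma$) and $\mathtt{flatten}_\sigma(t)$ (for $t:\sigma$). 3. If $s_1$ is safe for $x$ or $s_2$ is safe for $x$, then $s_1\oplus s_2$ is safe for $x$. 4. If either (a) $s_1$ is safe for $x$ and $s_2\succeq\mathtt{lift}(1)$, or (b) $s_2$ is safe for $x$ and $s_1\succeq\mathtt{lift}(1)$, then $s_1\otimes s_2$ is safe for $x$. 5. If $t$ is safe for $x$, then so are $\Lambda\alpha.t$ (for a type constructor variable $\alpha$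 of any kind that is not free in the type of a free variable of $t$) and $\lambda y.t$ (for a term variable $y\ne x$). -/

import Mathlib

namespace PolyInterp

/-! ### Kinds and interpretation type constructors -/

/-- Kinds: `*` and `κ₁ ⇒ κ₂`. -/
inductive Kind : Type
  | star : Kind
  | arr : Kind → Kind → Kind
  deriving DecidableEq

/-- `Ty κ` is the set of type constructors of kind `κ` over the single type symbol `nat : *`, up to
renaming of bound variables. For every kind `κ` there are infinitely many variables `var κ 0`,
`var κ 1`, .... Binding uses de Bruijn indices, separately for each kind: `all κ τ` and `lam κ τ`
bind the variable of kind `κ` with index `0` in `τ`, and the free variable `var κ a` is written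
`var κ (a + 1)` inside such a binder; variables of the other kinds keep their index. -/
inductive Ty : Kind → Type
  | var (κ : Kind) (n : ℕ) : Ty κ
  | nat : Ty Kind.star
  | app {κ₁ κ₂ : Kind} (φ : Ty (Kind.arr κ₁ κ₂)) (ψ : Ty κ₁) : Ty κ₂
  | arr (σ τ : Ty Kind.star) : Ty Kind.star
  | all (κ : Kind) (τ : Ty Kind.star) : Ty Kind.star
  | lam (κ₁ : Kind) {κ₂ : Kind} (φ : Ty κ₂) : Ty (Kind.arr κ₁ κ₂)

/-- Types are type constructors of kind `*`. -/
abbrev Typ : Type := Ty Kind.star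

/-- Renamings of type constructor variables (they respect kinds). -/
abbrev TyRen : Type := Kind → ℕ → ℕ

/-- Substitutions of type constructors for type constructor variables (they respect kinds). -/
abbrev TySub : Type := (κ : Kind) → ℕ → Ty κ

/-- A renaming below a binder of kind `κ`. -/
def TyRen.up (κ : Kind) (r : TyRen) : TyRen := fun κ' n =>
  if κ' = κ then
    match n with
    | 0 => 0
    | m + 1 => r κ' m + 1
  else r κ' n

/-- The renaming that makes room for a new bound variable of kind `κ`. -/
def TyRen.shift (κ : Kind) : TyRen := fun κ' n => if κ' = κ then n + 1 else n

/-- The renaming that turns the free variable `var κ a` into the bound variable with index `0` of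
a new binder of kind `κ`. -/
def TyRen.close (κ : Kind) (a : ℕ) : TyRen := fun κ' n =>
  if κ' = κ then (if n = a then 0 else n + 1) else n

namespace Ty

def ren : TyRen → {κ : Kind} → Ty κ → Ty κ
  | r, _, var κ n => var κ (r κ n)
  | _, _, nat => nat
  | r, _, app φ ψ => app (φ.ren r) (ψ.ren r)
  | r, _, arr σ τ => arr (σ.ren r) (τ.ren r)
  | r, _, all κ τ => all κ (τ.ren (r.up κ))
  | r, _, lam κ φ => lam κ (φ.ren (r.up κ))

end Ty

/-- A substitution below a binder of kind `κ`. -/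
def TySub.up (κ : Kind) (s : TySub) : TySub := fun κ' n =>
  if κ' = κ then
    match n with
    | 0 => Ty.var κ' 0
    | m + 1 => (s κ' m).ren (TyRen.shift κ)
  else (s κ' n).ren (TyRen.shift κ)

/-- The substitution of `ψ` for the variable of a removed binder. -/
def TySub.inst {κ : Kind} (ψ : Ty κ) : TySub := fun κ' n =>
  if h : κ = κ' then
    match n with
    | 0 => h ▸ ψ
    | m + 1 => Ty.var κ' m
  else Ty.var κ' n

namespace Ty

/-- Simultaneous capture-avoiding substitution. -/
def sub : TySub → {κ : Kind} → Ty κ → Ty κ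
  | s, _, var κ n => s κ n
  | _, _, nat => nat
  | s, _, app φ ψ => app (φ.sub s) (ψ.sub s)
  | s, _, arr σ τ => arr (σ.sub s) (τ.sub s)
  | s, _, all κ τ => all κ (τ.sub (s.up κ))
  | s, _, lam κ φ => lam κ (φ.sub (s.up κ))

/-- `φ[α := ψ]`, where `φ` is the body of a binder for `α`. -/
def inst {κ κ' : Kind} (φ : Ty κ') (ψ : Ty κ) : Ty κ' := φ.sub (TySub.inst ψ)

/-- `τ.Free κ a` : the variable `var κ a` occurs free in `τ`. -/
def Free (κ : Kind) : ℕ → {κ' : Kind} → Ty κ' → Prop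
  | a, _, var κ' n => κ' = κ ∧ n = a
  | _, _, nat => False
  | a, _, app φ ψ => φ.Free κ a ∨ ψ.Free κ a
  | a, _, arr σ τ => σ.Free κ a ∨ τ.Free κ a
  | a, _, all κ' τ => τ.Free κ (if κ' = κ then a + 1 else a)
  | a, _, lam κ' φ => φ.Free κ (if κ' = κ then a + 1 else a)

def Closed {κ : Kind} (τ : Ty κ) : Prop := ∀ (κ' : Kind) (a : ℕ), ¬ τ.Free κ' a

/-- One-step β-reduction of type constructors. -/
inductive Step : {κ : Kind} → Ty κ → Ty κ → Prop
  | beta {κ₁ κ₂ : Kind} (φ : Ty κ₂) (ψ : Ty κ₁) : Step (app (lam κ₁ φ) ψ) (φ.inst ψ)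
  | appL {κ₁ κ₂ : Kind} {φ φ' : Ty (Kind.arr κ₁ κ₂)} (ψ : Ty κ₁) :
      Step φ φ' → Step (app φ ψ) (app φ' ψ)
  | appR {κ₁ κ₂ : Kind} (φ : Ty (Kind.arr κ₁ κ₂)) {ψ ψ' : Ty κ₁} :
      Step ψ ψ' → Step (app φ ψ) (app φ ψ')
  | arrL {σ σ' : Typ} (τ : Typ) : Step σ σ' → Step (arr σ τ) (arr σ' τ)
  | arrR (σ : Typ) {τ τ' : Typ} : Step τ τ' → Step (arr σ τ) (arr σ τ')
  | all (κ : Kind) {τ τ' : Typ} : Step τ τ' → Step (all κ τ) (all κ τ')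
  | lam (κ₁ : Kind) {κ₂ : Kind} {φ φ' : Ty κ₂} : Step φ φ' → Step (lam κ₁ φ) (lam κ₁ φ')

/-- β-equality `=_β` of type constructors. -/
def BetaEq {κ : Kind} (σ τ : Ty κ) : Prop := Relation.EqvGen Step σ τ

/-- `τ.HasNF ν` : `ν` is the β-normal form of `τ`. -/
def HasNF {κ : Kind} (τ ν : Ty κ) : Prop :=
  Relation.ReflTransGen Step τ ν ∧ ∀ τ', ¬ Step ν τ'

end Ty

/-- The closed type constructor `χ_κ`: `χ_* = nat` and `χ_{κ₁ ⇒ κ₂} = λ α : κ₁. χ_{κ₂}`. -/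
def chi : (κ : Kind) → Ty κ
  | Kind.star => Ty.nat
  | Kind.arr κ₁ κ₂ => Ty.lam κ₁ (chi κ₂)

/-! ### Interpretation terms -/

/-- The function symbols: the natural numbers, `⊕`, `⊗`, `flatten` and `lift`. -/
inductive Sym : Type
  | num (n : ℕ) : Sym
  | add : Sym
  | mul : Sym
  | flatten : Sym
  | lift : Sym

/-- The declared types of the function symbols: `n : nat`, `⊕, ⊗ : ∀ α. α → α → α`,
`flatten : ∀ α. α → nat`, `lift : ∀ α. nat → α`. -/
def Sym.type : Sym → Typ
  | num _ => Ty.nat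
  | add => Ty.all Kind.star
      (Ty.arr (Ty.var Kind.star 0) (Ty.arr (Ty.var Kind.star 0) (Ty.var Kind.star 0)))
  | mul => Ty.all Kind.star
      (Ty.arr (Ty.var Kind.star 0) (Ty.arr (Ty.var Kind.star 0) (Ty.var Kind.star 0)))
  | flatten => Ty.all Kind.star (Ty.arr (Ty.var Kind.star 0) Ty.nat)
  | lift => Ty.all Kind.star (Ty.arr Ty.nat (Ty.var Kind.star 0))

/-- Raw preterms up to renaming of bound variables. The term variables are `var 0`, `var 1`, ...;
`lam σ t` binds index `0` in `t`, and `tlam κ t` binds the type constructor variable of kind `κ`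
with index `0` in `t`. -/
inductive Tm : Type
  | var (x : ℕ) : Tm
  | sym (f : Sym) : Tm
  | lam (σ : Typ) (t : Tm) : Tm
  | tlam (κ : Kind) (t : Tm) : Tm
  | app (s t : Tm) : Tm
  | tapp {κ : Kind} (t : Tm) (ψ : Ty κ) : Tm

/-- A renaming of term variables below a binder. -/
def upRen (r : ℕ → ℕ) : ℕ → ℕ
  | 0 => 0
  | n + 1 => r n + 1

namespace Tm

/-- Renaming of term variables. -/
def ren : (ℕ → ℕ) → Tm → Tm
  | r, var x => var (r x)
  | _, sym f => sym f
  | r, lam σ t => lam σ (t.ren (upRen r))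
  | r, tlam κ t => tlam κ (t.ren r)
  | r, app s t => app (s.ren r) (t.ren r)
  | r, tapp t ψ => tapp (t.ren r) ψ

/-- Renaming of type constructor variables. -/
def tren : TyRen → Tm → Tm
  | _, var x => var x
  | _, sym f => sym f
  | r, lam σ t => lam (σ.ren r) (t.tren r)
  | r, tlam κ t => tlam κ (t.tren (r.up κ))
  | r, app s t => app (s.tren r) (t.tren r)
  | r, tapp t ψ => tapp (t.tren r) (ψ.ren r)

/-- Substitution for type constructor variables. -/
def tsub : TySub → Tm → Tm
  | _, var x => var x
  | _, sym f => sym f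
  | s, lam σ t => lam (σ.sub s) (t.tsub s)
  | s, tlam κ t => tlam κ (t.tsub (s.up κ))
  | s, app u t => app (u.tsub s) (t.tsub s)
  | s, tapp t ψ => tapp (t.tsub s) (ψ.sub s)

end Tm

/-- A term substitution below a binder for a term variable. -/
def upSub (g : ℕ → Tm) : ℕ → Tm
  | 0 => Tm.var 0
  | n + 1 => (g n).ren Nat.succ

/-- The substitution of `u` for the variable of a removed binder. -/
def instSub (u : Tm) : ℕ → Tm
  | 0 => u
  | n + 1 => Tm.var n

namespace Tm

/-- Simultaneous capture-avoiding substitution for term variables. -/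
def sub : (ℕ → Tm) → Tm → Tm
  | g, var x => g x
  | _, sym f => sym f
  | g, lam σ t => lam σ (t.sub (upSub g))
  | g, tlam κ t => tlam κ (t.sub (fun x => (g x).tren (TyRen.shift κ)))
  | g, app s t => app (s.sub g) (t.sub g)
  | g, tapp t ψ => tapp (t.sub g) ψ

/-- `t[x := s]` for a free variable `x`. -/
def subst (t : Tm) (x : ℕ) (s : Tm) : Tm := t.sub (Function.update Tm.var x s)

/-- `x ∈ FV(t)`. -/
def Free : ℕ → Tm → Prop
  | x, var y => x = y
  | _, sym _ => False
  | x, lam _ t => t.Free (x + 1)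
  | x, tlam _ t => t.Free x
  | x, app s t => s.Free x ∨ t.Free x
  | x, tapp t _ => t.Free x

/-- `t.TFree κ a` : the type constructor variable `var κ a` occurs free in `t`. -/
def TFree (κ : Kind) : ℕ → Tm → Prop
  | _, var _ => False
  | _, sym _ => False
  | a, lam σ t => σ.Free κ a ∨ t.TFree κ a
  | a, tlam κ' t => t.TFree κ (if κ' = κ then a + 1 else a)
  | a, app s t => s.TFree κ a ∨ t.TFree κ a
  | a, tapp t ψ => t.TFree κ a ∨ ψ.Free κ a

/-- The relation `≡`: identity modulo β-conversion of the types that occur in the preterms.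
Interpretation terms are equivalence classes of typable preterms under `≡`; every notion below is
defined on representatives and invariant under `≡`. -/
inductive Equiv : Tm → Tm → Prop
  | var (x : ℕ) : Equiv (var x) (var x)
  | sym (f : Sym) : Equiv (sym f) (sym f)
  | lam {σ σ' : Typ} {t t' : Tm} : σ.BetaEq σ' → Equiv t t' → Equiv (lam σ t) (lam σ' t')
  | tlam (κ : Kind) {t t' : Tm} : Equiv t t' → Equiv (tlam κ t) (tlam κ t')
  | app {s s' t t' : Tm} : Equiv s s' → Equiv t t' → Equiv (app s t) (app s' t')
  | tapp {κ : Kind} {t t' : Tm} {ψ ψ' : Ty κ} :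
      Equiv t t' → ψ.BetaEq ψ' → Equiv (tapp t ψ) (tapp t' ψ')

/-- The term represented by `t` is closed: some representative (equivalently, the one whose types
are all β-normal) has no free term variables and no free type constructor variables. -/
def Closed (t : Tm) : Prop :=
  ∃ t', Equiv t t' ∧ (∀ x, ¬ t'.Free x) ∧ ∀ κ a, ¬ t'.TFree κ a

/-- The natural number `n` as a term. -/
def num (n : ℕ) : Tm := sym (Sym.num n)

/-- `s ⊕_σ t`. -/
def oplus (σ : Typ) (s t : Tm) : Tm := app (app (tapp (sym Sym.add) σ) s) t

/-- `s ⊗_σ t`. -/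
def otimes (σ : Typ) (s t : Tm) : Tm := app (app (tapp (sym Sym.mul) σ) s) t

/-- `flatten_σ t`. -/
def flatten (σ : Typ) (t : Tm) : Tm := app (tapp (sym Sym.flatten) σ) t

/-- `lift_σ t`. -/
def lift (σ : Typ) (t : Tm) : Tm := app (tapp (sym Sym.lift) σ) t

/-- The reduction steps, on preterms. -/
inductive Step : Tm → Tm → Prop
  | lam (σ : Typ) {s t : Tm} : Step s t → Step (lam σ s) (lam σ t)
  | tlam (κ : Kind) {s t : Tm} : Step s t → Step (tlam κ s) (tlam κ t)
  | appR (u : Tm) {s t : Tm} : Step s t → Step (app u s) (app u t)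
  | appL (u : Tm) {s t : Tm} : Step s t → Step (app s u) (app t u)
  | tapp {κ : Kind} (ψ : Ty κ) {s t : Tm} : Step s t → Step (tapp s ψ) (tapp t ψ)
  | beta (σ : Typ) (s t : Tm) : Step (app (lam σ s) t) (s.sub (instSub t))
  | tbeta {κ : Kind} (s : Tm) (ψ : Ty κ) : Step (tapp (tlam κ s) ψ) (s.tsub (TySub.inst ψ))
  | add_nat (n m : ℕ) : Step (oplus Ty.nat (num n) (num m)) (num (n + m))
  | mul_nat (n m : ℕ) : Step (otimes Ty.nat (num n) (num m)) (num (n * m))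
  | add_arr (σ τ : Typ) (s t : Tm) : Step (oplus (Ty.arr σ τ) s t)
      (lam σ (oplus τ (app (s.ren Nat.succ) (var 0)) (app (t.ren Nat.succ) (var 0))))
  | mul_arr (σ τ : Typ) (s t : Tm) : Step (otimes (Ty.arr σ τ) s t)
      (lam σ (otimes τ (app (s.ren Nat.succ) (var 0)) (app (t.ren Nat.succ) (var 0))))
  | add_all (κ : Kind) (σ : Typ) (s t : Tm) : Step (oplus (Ty.all κ σ) s t)
      (tlam κ (oplus σ (tapp (s.tren (TyRen.shift κ)) (Ty.var κ 0))
        (tapp (t.tren (TyRen.shift κ)) (Ty.var κ 0))))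
  | mul_all (κ : Kind) (σ : Typ) (s t : Tm) : Step (otimes (Ty.all κ σ) s t)
      (tlam κ (otimes σ (tapp (s.tren (TyRen.shift κ)) (Ty.var κ 0))
        (tapp (t.tren (TyRen.shift κ)) (Ty.var κ 0))))
  | flatten_nat (s : Tm) : Step (flatten Ty.nat s) s
  | flatten_arr (σ τ : Typ) (s : Tm) :
      Step (flatten (Ty.arr σ τ) s) (flatten τ (app s (lift σ (num 0))))
  | flatten_all (κ : Kind) (σ : Typ) (s : Tm) :
      Step (flatten (Ty.all κ σ) s) (flatten (σ.inst (chi κ)) (tapp s (chi κ)))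
  | lift_nat (s : Tm) : Step (lift Ty.nat s) s
  | lift_arr (σ τ : Typ) (s : Tm) :
      Step (lift (Ty.arr σ τ) s) (lam σ (lift τ (s.ren Nat.succ)))
  | lift_all (κ : Kind) (σ : Typ) (s : Tm) :
      Step (lift (Ty.all κ σ) s) (tlam κ (lift σ (s.tren (TyRen.shift κ))))

/-- The reduction relation `⇝` on terms, that is, on preterms modulo `≡`. -/
def Red (s t : Tm) : Prop := ∃ s' t', Equiv s s' ∧ Step s' t' ∧ Equiv t' t

/-- `t` is in normal form with respect to `⇝`. -/
def Normal (t : Tm) : Prop := ∀ t', ¬ Red t t'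

/-- `s.HasNF v` : `v` is the normal form `s↓` of `s`. -/
def HasNF (s v : Tm) : Prop := Relation.ReflTransGen Red s v ∧ v.Normal

end Tm

/-- An assignment of types to the term variables. Below a binder `λ : σ` or `Λ : κ` it is extended
or shifted. -/
abbrev Ctx : Type := ℕ → Typ

def Ctx.cons (σ : Typ) (Γ : Ctx) : Ctx
  | 0 => σ
  | n + 1 => Γ n

/-- `HasType Γ t τ` : `t : τ`, where each variable `var x` is declared with the type `Γ x`. In the
rule for `Λ` the bound type constructor variable does not occur in the (shifted) types of the term
variables. -/
inductive HasType : Ctx → Tm → Typ → Prop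
  | var (Γ : Ctx) (x : ℕ) : HasType Γ (Tm.var x) (Γ x)
  | sym (Γ : Ctx) (f : Sym) : HasType Γ (Tm.sym f) f.type
  | lam {Γ : Ctx} {σ τ : Typ} {t : Tm} :
      HasType (Γ.cons σ) t τ → HasType Γ (Tm.lam σ t) (Ty.arr σ τ)
  | tlam {Γ : Ctx} {κ : Kind} {τ : Typ} {t : Tm} :
      HasType (fun x => (Γ x).ren (TyRen.shift κ)) t τ → HasType Γ (Tm.tlam κ t) (Ty.all κ τ)
  | app {Γ : Ctx} {σ τ : Typ} {s t : Tm} :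
      HasType Γ s (Ty.arr σ τ) → HasType Γ t σ → HasType Γ (Tm.app s t) τ
  | tapp {Γ : Ctx} {κ : Kind} {τ : Typ} {t : Tm} (ψ : Ty κ) :
      HasType Γ t (Ty.all κ τ) → HasType Γ (Tm.tapp t ψ) (τ.inst ψ)
  | conv {Γ : Ctx} {σ τ : Typ} {t : Tm} : HasType Γ t σ → σ.BetaEq τ → HasType Γ t τ

/-- `λ y. t` for a free variable `y` (of the type that `Γ` declares). -/
def lamVar (Γ : Ctx) (y : ℕ) (t : Tm) : Tm :=
  Tm.lam (Γ y) (t.ren (fun z => if z = y then 0 else z + 1))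

/-- `Λ α. t` for a free type constructor variable `α = var κ a`. -/
def tlamVar (κ : Kind) (a : ℕ) (t : Tm) : Tm := Tm.tlam κ (t.tren (TyRen.close κ a))

/-- `∀ α. τ` for a free type constructor variable `α = var κ a`. -/
def allVar (κ : Kind) (a : ℕ) (τ : Typ) : Typ := Ty.all κ (τ.ren (TyRen.close κ a))

/-- `h u₁ … u_m`, where each `u_i` is a term or a type constructor. -/
def spine : Tm → List (Tm ⊕ (Σ κ : Kind, Ty κ)) → Tm
  | h, [] => h
  | h, Sum.inl u :: us => spine (Tm.app h u) us
  | h, Sum.inr ⟨_, ψ⟩ :: us => spine (Tm.tapp h ψ) us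

/-! ### The ordering pair -/

/-- The final interpretation terms of type `τ`: closed and in normal form. Since they are closed,
the assignment of types to the free variables does not matter. -/
def Final (τ : Typ) (q : Tm) : Prop :=
  HasType (fun _ => Ty.nat) q τ ∧ q.Closed ∧ q.Normal

/-- `R` is closed backwards under the three rules that define `≻⁰` (for `P` the relation `>` on `ℕ`)
and `⪰⁰` (for `P` the relation `≥`). -/
def IsOrderCand (P : ℕ → ℕ → Prop) (R : Typ → Tm → Tm → Prop) : Prop :=
  ∀ (σ : Typ) (s t : Tm), R σ s t →
    (σ = Ty.nat ∧ ∃ n m : ℕ, s.HasNF (Tm.num n) ∧ t.HasNF (Tm.num m) ∧ P n m) ∨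
    (∃ τ₁ τ₂ : Typ, σ = Ty.arr τ₁ τ₂ ∧
      ∀ q, Final τ₁ q → R τ₂ (Tm.app s q) (Tm.app t q)) ∨
    (∃ (κ : Kind) (ρ : Typ), σ = Ty.all κ ρ ∧
      ∀ ψ : Ty κ, ψ.Closed →
        ∃ ν : Typ, (ρ.inst ψ).HasNF ν ∧ R ν (Tm.tapp s ψ) (Tm.tapp t ψ))

/-- The largest such relation: the coinductively defined order on closed terms of a closed
β-normal type. -/
def ClosedOrder (P : ℕ → ℕ → Prop) (σ : Typ) (s t : Tm) : Prop :=
  ∃ R, IsOrderCand P R ∧ R σ s t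

/-- `γ ∘ ω` is a closure: `ω` maps type constructor variables to closed type constructors, and `γ`
maps every variable `x : τ` to a closed term of type `ω(τ)`. -/
def IsClosure (Γ : Ctx) (ω : TySub) (γ : ℕ → Tm) : Prop :=
  (∀ κ a, (ω κ a).Closed) ∧
    ∀ x, (γ x).Closed ∧ HasType (fun y => (Γ y).sub ω) (γ x) ((Γ x).sub ω)

/-- The order on arbitrary terms of type `σ`, by closing with all closures. -/
def Order (P : ℕ → ℕ → Prop) (Γ : Ctx) (σ : Typ) (s t : Tm) : Prop :=
  ∀ (ω : TySub) (γ : ℕ → Tm), IsClosure Γ ω γ →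
    ∃ ν : Typ, (σ.sub ω).HasNF ν ∧ ClosedOrder P ν ((s.tsub ω).sub γ) ((t.tsub ω).sub γ)

/-- `s ≻_σ t`. -/
def Succ (Γ : Ctx) (σ : Typ) (s t : Tm) : Prop := Order (fun n m => n > m) Γ σ s t

/-- `s ⪰_σ t`. -/
def SuccEq (Γ : Ctx) (σ : Typ) (s t : Tm) : Prop := Order (fun n m => n ≥ m) Γ σ s t

/-- The interpretation term `t` of type `σ` is safe for the variable `x`. -/
def Safe (Γ : Ctx) (σ : Typ) (t : Tm) (x : ℕ) : Prop :=
  HasType Γ t σ ∧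
    ∀ s₁ s₂ : Tm, HasType Γ s₁ (Γ x) → HasType Γ s₂ (Γ x) →
      Succ Γ (Γ x) s₁ s₂ → Succ Γ σ (t.subst x s₁) (t.subst x s₂)

end PolyInterp

open PolyInterp

/-!
For a closure `γ ∘ ω`, the closure of `t[x := s]` is the closure of `t` under `γ` with the value of
`x` replaced by the closure of `s` (`Tm.subst_tsub_sub`). Safety of `t` for `x` is therefore strict
monotonicity of the closed instances of `t` in the value of `x` (`safe_iff`).

The order is coinductive, so it is compared along all closed arguments until type `nat` is reached.
The coinduction principle `OrdAt.coinduction` allows reduction and conversion of the compared terms,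
and with it `lift`, `⊕`, `⊗` and `flatten` are monotone: an instance of one of these symbols, applied
to closed arguments, reduces to an instance of the same symbol at a simpler type, down to `nat`
(`OrdAt.lift`, `OrdAt.bin`, `OrdAt.flatten`). For `⊗` strictness needs a factor that is positive
everywhere, which is what `s ⪰ lift 1` provides (`OrdAt.and_of_lift`).

All arguments that do not contain the strictly decreasing occurrence of `x` are handled by weak
monotonicity: if `g y ⪰ g' y` for all `y`, then `t g ⪰ t g'` (`OrdAt.sub_ge`). At type `nat` the weak
head evaluation of `t g'` is followed. If the head of `t` is a variable `y`, it is first replaced by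
`g' y`, which makes `t g` smaller, because the order is preserved by application to equal arguments;
if the head is not a variable, the next evaluation step is a step of `t` itself and is performed on
both sides (`Ev.sub_ge`). For a head variable `x`, the strict step on the head comes before the weak
step on each argument (`HeadVar.safe`).

Two facts about reduction are used. The normal form of a term is unique when it is a number
(`Tm.HasNF.num_unique`); this follows from confluence, shown by complete developments. Typed terms
have normal forms (`HasType.norm`), so that an argument which is not final may be replaced by its
normal form and closed terms of type `nat` have a value. This is shown with reducibility candidates
of untyped terms, in the style of Girard; a candidate is moreover closed under the function symbols
at all types convertible to its own, as these symbols compute by recursion on a type index. A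
normalizing strategy is described by the inductive predicate `Tm.Norm`, and it creates no free
variables, so normal forms of closed terms are closed.

For abstractions the closure of the body of `t` differs from the closure `γ ∘ ω` of the substituted
terms `s₁`, `s₂` at the bound variable, while `s₁` and `s₂` may contain a free variable of this name.
Hence the free variables of `s₁` and `s₂`, type constructor variables included, are first renamed
away from those of `t`; there are enough term variables of every type. Afterwards a single closure
acts as required on both (`Safe.ordAt_of_closures`).
-/

namespace PolyInterp

/-! ### Substitution calculus for type constructors -/

/-- The substitution that maps the variable with index `0` of kind `κ` to `ψ` and the other
variables, shifted down, as `s` does. -/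
def TySub.cons {κ : Kind} (ψ : Ty κ) (s : TySub) : TySub := fun κ' n =>
  if h : κ = κ' then
    match n with
    | 0 => h ▸ ψ
    | m + 1 => s κ' m
  else s κ' n

@[simp] theorem TyRen.up_zero (κ : Kind) (r : TyRen) : r.up κ κ 0 = 0 := by simp [up]

@[simp] theorem TyRen.up_succ (κ : Kind) (r : TyRen) (n : ℕ) : r.up κ κ (n + 1) = r κ n + 1 := by
  simp [up]

@[simp] theorem TyRen.up_of_ne {κ κ' : Kind} (h : ¬κ' = κ) (r : TyRen) (n : ℕ) :
    r.up κ κ' n = r κ' n := by simp [up, h]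

@[simp] theorem TyRen.shift_self (κ : Kind) (n : ℕ) : TyRen.shift κ κ n = n + 1 := by simp [shift]

@[simp] theorem TyRen.shift_of_ne {κ κ' : Kind} (h : ¬κ' = κ) (n : ℕ) :
    TyRen.shift κ κ' n = n := by simp [shift, h]

@[simp] theorem TySub.up_zero (κ : Kind) (s : TySub) : s.up κ κ 0 = Ty.var κ 0 := by simp [up]

@[simp] theorem TySub.up_succ (κ : Kind) (s : TySub) (n : ℕ) :
    s.up κ κ (n + 1) = (s κ n).ren (TyRen.shift κ) := by simp [up]

@[simp] theorem TySub.up_of_ne {κ κ' : Kind} (h : ¬κ' = κ) (s : TySub) (n : ℕ) :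
    s.up κ κ' n = (s κ' n).ren (TyRen.shift κ) := by simp [up, h]

@[simp] theorem TySub.cons_zero {κ : Kind} (ψ : Ty κ) (s : TySub) : TySub.cons ψ s κ 0 = ψ := by
  simp [cons]

@[simp] theorem TySub.cons_succ {κ : Kind} (ψ : Ty κ) (s : TySub) (n : ℕ) :
    TySub.cons ψ s κ (n + 1) = s κ n := by simp [cons]

@[simp] theorem TySub.cons_of_ne {κ κ' : Kind} (h : ¬κ' = κ) (ψ : Ty κ) (s : TySub) (n : ℕ) :
    TySub.cons ψ s κ' n = s κ' n := by simp [cons, Ne.symm h]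

theorem TyRen.up_comp (κ : Kind) (r r' : TyRen) :
    (fun κ' n => r'.up κ κ' (r.up κ κ' n)) = TyRen.up κ (fun κ' n => r' κ' (r κ' n)) := by
  funext κ' n
  by_cases h : κ' = κ
  · subst h; cases n <;> simp
  · simp [h]

theorem TySub.up_comp_ren (κ : Kind) (r : TyRen) (s : TySub) :
    (fun κ' n => s.up κ κ' (r.up κ κ' n)) = TySub.up κ (fun κ' n => s κ' (r κ' n)) := by
  funext κ' n
  by_cases h : κ' = κ
  · subst h; cases n <;> simp
  · simp [h]

theorem TySub.cons_comp_shift {κ : Kind} (ψ : Ty κ) (s : TySub) :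
    (fun κ' n => TySub.cons ψ s κ' (TyRen.shift κ κ' n)) = s := by
  funext κ' n
  by_cases h : κ' = κ
  · subst h; simp
  · simp [h]

theorem TySub.inst_eq_cons {κ : Kind} (ψ : Ty κ) : TySub.inst ψ = TySub.cons ψ Ty.var := rfl

namespace Ty

theorem ren_ren (r r' : TyRen) {κ : Kind} (τ : Ty κ) :
    (τ.ren r).ren r' = τ.ren (fun κ' n => r' κ' (r κ' n)) := by
  induction τ generalizing r r' with
  | var | nat => rfl
  | app _ _ ih₁ ih₂ | arr _ _ ih₁ ih₂ => simp [ren, ih₁, ih₂]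
  | all κ _ ih | lam κ _ ih => simp [ren, ih, TyRen.up_comp]

theorem sub_of_ren (r : TyRen) (s : TySub) {κ : Kind} (τ : Ty κ) :
    (τ.ren r).sub s = τ.sub (fun κ' n => s κ' (r κ' n)) := by
  induction τ generalizing r s with
  | var | nat => rfl
  | app _ _ ih₁ ih₂ | arr _ _ ih₁ ih₂ => simp [ren, sub, ih₁, ih₂]
  | all κ _ ih | lam κ _ ih => simp [ren, sub, ih, TySub.up_comp_ren]

end Ty

theorem TySub.ren_up (κ : Kind) (r : TyRen) (s : TySub) :
    (fun κ' n => (s.up κ κ' n).ren (r.up κ)) = TySub.up κ (fun κ' n => (s κ' n).ren r) := by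
  have e : (fun κ' n => r.up κ κ' (TyRen.shift κ κ' n)) =
      fun κ' n => TyRen.shift κ κ' (r κ' n) := by
    funext κ' n
    by_cases h : κ' = κ
    · subst h; simp
    · simp [h]
  funext κ' n
  by_cases h : κ' = κ
  · subst h; cases n <;> simp [Ty.ren, Ty.ren_ren, e]
  · simp [h, Ty.ren_ren, e]

namespace Ty

theorem ren_of_sub (r : TyRen) (s : TySub) {κ : Kind} (τ : Ty κ) :
    (τ.sub s).ren r = τ.sub (fun κ' n => (s κ' n).ren r) := by
  induction τ generalizing r s with
  | var | nat => rfl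
  | app _ _ ih₁ ih₂ | arr _ _ ih₁ ih₂ => simp [ren, sub, ih₁, ih₂]
  | all κ _ ih | lam κ _ ih => simp [ren, sub, ih, TySub.ren_up]

end Ty

theorem TySub.sub_up (κ : Kind) (s s' : TySub) :
    (fun κ' n => (s.up κ κ' n).sub (s'.up κ)) = TySub.up κ (fun κ' n => (s κ' n).sub s') := by
  have e : (fun κ' n => s'.up κ κ' (TyRen.shift κ κ' n)) =
      fun κ' n => (s' κ' n).ren (TyRen.shift κ) := by
    funext κ' n
    by_cases h : κ' = κ
    · subst h; simp
    · simp [h]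
  funext κ' n
  by_cases h : κ' = κ
  · subst h; cases n <;> simp [Ty.sub, Ty.sub_of_ren, Ty.ren_of_sub, e]
  · simp [h, Ty.sub_of_ren, Ty.ren_of_sub, e]

theorem TySub.up_var (κ : Kind) (r : TyRen) :
    TySub.up κ (fun κ' n => Ty.var κ' (r κ' n)) = fun κ' n => Ty.var κ' (r.up κ κ' n) := by
  funext κ' n
  by_cases h : κ' = κ
  · subst h; cases n <;> simp [Ty.ren]
  · simp [h, Ty.ren]

namespace Ty

theorem sub_sub (s s' : TySub) {κ : Kind} (τ : Ty κ) :
    (τ.sub s).sub s' = τ.sub (fun κ' n => (s κ' n).sub s') := by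
  induction τ generalizing s s' with
  | var | nat => rfl
  | app _ _ ih₁ ih₂ | arr _ _ ih₁ ih₂ => simp [sub, ih₁, ih₂]
  | all κ _ ih | lam κ _ ih => simp [sub, ih, TySub.sub_up]

theorem ren_eq_sub (r : TyRen) {κ : Kind} (τ : Ty κ) :
    τ.ren r = τ.sub (fun κ' n => var κ' (r κ' n)) := by
  induction τ generalizing r with
  | var | nat => rfl
  | app _ _ ih₁ ih₂ | arr _ _ ih₁ ih₂ => simp [ren, sub, ih₁, ih₂]
  | all κ _ ih | lam κ _ ih => simp [ren, sub, ih, TySub.up_var]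

theorem sub_congr {s s' : TySub} {κ : Kind} (τ : Ty κ)
    (h : ∀ κ' a, τ.Free κ' a → s κ' a = s' κ' a) : τ.sub s = τ.sub s' := by
  have up : ∀ {s s' : TySub} {κ₀ κ : Kind} (τ : Ty κ)
      (_ : ∀ κ' a, τ.Free κ' (if κ₀ = κ' then a + 1 else a) → s κ' a = s' κ' a),
      ∀ κ' a, τ.Free κ' a → s.up κ₀ κ' a = s'.up κ₀ κ' a := by
    intro s s' κ₀ κ τ h κ' a ha
    by_cases e : κ' = κ₀
    · subst e
      cases a with
      | zero => simp
      | succ a => simp [h κ' a (by simpa using ha)]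
    · simp [e, h κ' a (by simpa [Ne.symm e] using ha)]
  induction τ generalizing s s' with
  | var κ n => exact h _ _ ⟨rfl, rfl⟩
  | nat => rfl
  | app _ _ ih₁ ih₂ | arr _ _ ih₁ ih₂ =>
    simp [sub, ih₁ fun κ a ha => h κ a (Or.inl ha), ih₂ fun κ a ha => h κ a (Or.inr ha)]
  | all κ _ ih | lam κ _ ih => simp [sub, ih (up _ h)]

theorem sub_var {κ : Kind} (τ : Ty κ) : τ.sub var = τ := by
  induction τ with
  | var | nat => rfl
  | app _ _ ih₁ ih₂ | arr _ _ ih₁ ih₂ => simp [sub, ih₁, ih₂]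
  | all κ _ ih | lam κ _ ih =>
    have := TySub.up_var κ (fun _ n => n)
    have e : (fun κ' n => Ty.var κ' (TyRen.up κ (fun _ n => n) κ' n)) = var := by
      funext κ' n
      by_cases h : κ' = κ
      · subst h; cases n <;> simp
      · simp [h]
    rw [e] at this
    simp only [sub]
    rw [show TySub.up κ var = var from this, ih]

theorem ren_congr {r r' : TyRen} {κ : Kind} (τ : Ty κ)
    (h : ∀ κ' a, τ.Free κ' a → r κ' a = r' κ' a) : τ.ren r = τ.ren r' := by
  rw [ren_eq_sub, ren_eq_sub]
  exact sub_congr τ fun κ' a ha => by rw [h κ' a ha]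

theorem sub_up_inst (s : TySub) {κ κ' : Kind} (φ : Ty κ') (ψ : Ty κ) :
    (φ.sub (s.up κ)).inst ψ = φ.sub (TySub.cons ψ s) := by
  rw [inst, sub_sub]
  congr 1
  funext κ' n
  have e := TySub.cons_comp_shift ψ var
  by_cases h : κ' = κ
  · subst h
    cases n
    · simp [sub, TySub.inst_eq_cons]
    · simp [TySub.inst_eq_cons, sub_of_ren, e, sub_var]
  · simp [TySub.inst_eq_cons, sub_of_ren, e, h, sub_var]

theorem inst_sub (s : TySub) {κ κ' : Kind} (φ : Ty κ') (ψ : Ty κ) :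
    (φ.inst ψ).sub s = φ.sub (TySub.cons (ψ.sub s) s) := by
  rw [inst, sub_sub]
  congr 1
  funext κ' n
  by_cases h : κ = κ'
  · subst h
    cases n <;> simp [TySub.inst, sub]
  · simp [TySub.inst, sub, h, Ne.symm h]

theorem inst_sub' (s : TySub) {κ κ' : Kind} (φ : Ty κ') (ψ : Ty κ) :
    (φ.inst ψ).sub s = (φ.sub (s.up κ)).inst (ψ.sub s) := by
  rw [inst_sub, sub_up_inst]

theorem inst_ren (r : TyRen) {κ κ' : Kind} (φ : Ty κ') (ψ : Ty κ) :
    (φ.inst ψ).ren r = (φ.ren (r.up κ)).inst (ψ.ren r) := by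
  rw [ren_eq_sub, inst_sub', TySub.up_var, ← ren_eq_sub, ← ren_eq_sub]

theorem ren_shift_sub_cons {κ κ' : Kind} (ψ : Ty κ) (s : TySub) (τ : Ty κ') :
    (τ.ren (TyRen.shift κ)).sub (TySub.cons ψ s) = τ.sub s := by
  rw [sub_of_ren, TySub.cons_comp_shift]

theorem ren_shift_inst {κ κ' : Kind} (ψ : Ty κ) (τ : Ty κ') :
    (τ.ren (TyRen.shift κ)).inst ψ = τ := by
  rw [inst, TySub.inst_eq_cons, ren_shift_sub_cons, sub_var]

/-! ### Free type constructor variables -/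

theorem Free.of_ren {r : TyRen} {κ κ₀ : Kind} {a : ℕ} {τ : Ty κ₀} (h : (τ.ren r).Free κ a) :
    ∃ b, τ.Free κ b ∧ r κ b = a := by
  induction τ generalizing r a with
  | var κ n => obtain ⟨rfl, rfl⟩ := h; exact ⟨n, ⟨rfl, rfl⟩, rfl⟩
  | nat => exact h.elim
  | app _ _ ih₁ ih₂ | arr _ _ ih₁ ih₂ =>
    rcases h with h | h
    · obtain ⟨b, hb, e⟩ := ih₁ h; exact ⟨b, Or.inl hb, e⟩
    · obtain ⟨b, hb, e⟩ := ih₂ h; exact ⟨b, Or.inr hb, e⟩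
  | all κ' _ ih | lam κ' _ ih =>
    obtain ⟨b, hb, e⟩ := ih h
    by_cases hk : κ' = κ
    · subst hk
      cases b with
      | zero => simp [TyRen.up] at e
      | succ b => exact ⟨b, by simpa [Free] using hb, by simpa [TyRen.up] using e⟩
    · exact ⟨b, by simpa [Free, hk] using hb, by simpa [TyRen.up, hk, Ne.symm hk] using e⟩

theorem Free.of_sub {s : TySub} {κ κ₀ : Kind} {a : ℕ} {τ : Ty κ₀} (h : (τ.sub s).Free κ a) :
    ∃ κ' b, τ.Free κ' b ∧ (s κ' b).Free κ a := by
  induction τ generalizing s a with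
  | var κ n => exact ⟨κ, n, ⟨rfl, rfl⟩, h⟩
  | nat => exact h.elim
  | app _ _ ih₁ ih₂ | arr _ _ ih₁ ih₂ =>
    rcases h with h | h
    · obtain ⟨κ, b, hb, e⟩ := ih₁ h; exact ⟨κ, b, Or.inl hb, e⟩
    · obtain ⟨κ, b, hb, e⟩ := ih₂ h; exact ⟨κ, b, Or.inr hb, e⟩
  | all κ₁ _ ih | lam κ₁ _ ih =>
    obtain ⟨κ', b, hb, e⟩ := ih h
    by_cases hk : κ' = κ₁
    · subst hk
      cases b with
      | zero =>
        exfalso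
        simp only [TySub.up, if_true] at e
        obtain ⟨rfl, e⟩ := e
        simp at e
      | succ b =>
        refine ⟨κ', b, by simpa [Free] using hb, ?_⟩
        simp only [TySub.up, if_true] at e
        obtain ⟨c, hc, e⟩ := e.of_ren
        by_cases hk : κ' = κ
        · subst hk; simp [TyRen.shift] at e; exact e ▸ hc
        · simp [TyRen.shift, hk, Ne.symm hk] at e; exact e ▸ hc
    · refine ⟨κ', b, by simpa [Free, Ne.symm hk] using hb, ?_⟩
      simp only [TySub.up, if_neg hk] at e
      obtain ⟨c, hc, e⟩ := e.of_ren
      by_cases hk : κ₁ = κ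
      · subst hk; simp [TyRen.shift] at e; exact e ▸ hc
      · simp [TyRen.shift, hk, Ne.symm hk] at e; exact e ▸ hc

theorem exists_free_bound {κ : Kind} (τ : Ty κ) : ∃ B, ∀ κ' a, τ.Free κ' a → a < B := by
  induction τ with
  | var κ n => exact ⟨n + 1, fun _ _ h => by have := h.2; omega⟩
  | nat => exact ⟨0, fun _ _ h => h.elim⟩
  | app _ _ ih₁ ih₂ | arr _ _ ih₁ ih₂ =>
    obtain ⟨B₁, h₁⟩ := ih₁
    obtain ⟨B₂, h₂⟩ := ih₂
    exact ⟨max B₁ B₂, fun κ a h => lt_max_iff.2 (h.imp (h₁ κ a) (h₂ κ a))⟩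
  | all κ₁ _ ih | lam κ₁ _ ih =>
    obtain ⟨B, h⟩ := ih
    refine ⟨B, fun κ a ha => ?_⟩
    have := h _ _ ha
    split at this <;> omega

theorem Closed.sub_eq {κ : Kind} {τ : Ty κ} (h : τ.Closed) (s : TySub) : τ.sub s = τ := by
  rw [sub_congr (s' := var) τ fun κ a ha => (h κ a ha).elim, sub_var]

theorem Closed.ren_eq {κ : Kind} {τ : Ty κ} (h : τ.Closed) (r : TyRen) : τ.ren r = τ := by
  rw [ren_eq_sub, h.sub_eq]

theorem closed_sub {κ : Kind} (τ : Ty κ) {s : TySub} (h : ∀ κ' a, (s κ' a).Closed) :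
    (τ.sub s).Closed := fun κ a ha => by
  obtain ⟨κ', b, _, hb⟩ := ha.of_sub
  exact h κ' b κ a hb

theorem Free.of_inst {κ κ₀ κ₁ : Kind} {a : ℕ} {φ : Ty κ₀} {ψ : Ty κ₁}
    (h : (φ.inst ψ).Free κ a) : φ.Free κ (if κ₁ = κ then a + 1 else a) ∨ ψ.Free κ a := by
  obtain ⟨κ', b, hb, h⟩ := h.of_sub
  by_cases e : κ₁ = κ'
  · subst e
    cases b with
    | zero => right; simpa [TySub.inst] using h
    | succ b =>
      simp [TySub.inst] at h
      obtain ⟨rfl, rfl⟩ := h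
      left; simpa using hb
  · simp only [TySub.inst, e, dite_false] at h
    obtain ⟨rfl, rfl⟩ := h
    left; simpa [e] using hb

/-! ### Reduction of type constructors -/

/-- Reduction in any number of steps. -/
abbrev Reds {κ : Kind} : Ty κ → Ty κ → Prop := Relation.ReflTransGen Step

theorem Step.free {κ κ₀ : Kind} {a : ℕ} {φ φ' : Ty κ₀} (h : Step φ φ') (ha : φ'.Free κ a) :
    φ.Free κ a := by
  induction h generalizing a with
  | beta φ ψ => exact ha.of_inst
  | appL _ _ ih | arrL _ _ ih => exact ha.imp ih id
  | appR _ _ ih | arrR _ _ ih => exact ha.imp id ih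
  | all _ _ ih | lam _ _ ih => exact ih ha

theorem Reds.free {κ κ₀ : Kind} {a : ℕ} {φ φ' : Ty κ₀} (h : Reds φ φ') (ha : φ'.Free κ a) :
    φ.Free κ a := by
  induction h with
  | refl => exact ha
  | tail _ h ih => exact ih (h.free ha)

theorem Reds.closed {κ : Kind} {φ φ' : Ty κ} (h : Reds φ φ') (hφ : φ.Closed) : φ'.Closed :=
  fun κ a ha => hφ κ a (h.free ha)

theorem Step.sub {κ : Kind} {φ φ' : Ty κ} (h : Step φ φ') (s : TySub) :
    Step (φ.sub s) (φ'.sub s) := by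
  induction h generalizing s with
  | beta φ ψ => rw [inst_sub']; exact .beta _ _
  | appL _ _ ih => exact .appL _ (ih s)
  | arrL _ _ ih => exact .arrL _ (ih s)
  | appR _ _ ih => exact .appR _ (ih s)
  | arrR _ _ ih => exact .arrR _ (ih s)
  | all _ _ ih => exact .all _ (ih _)
  | lam _ _ ih => exact .lam _ (ih _)

theorem Reds.sub {κ : Kind} {φ φ' : Ty κ} (h : Reds φ φ') (s : TySub) :
    Reds (φ.sub s) (φ'.sub s) := Relation.ReflTransGen.lift (fun φ => φ.sub s) (fun _ _ h => h.sub s) _ _ h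

theorem Reds.app {κ₁ κ₂ : Kind} {φ φ' : Ty (.arr κ₁ κ₂)} {ψ ψ' : Ty κ₁} (h₁ : Reds φ φ')
    (h₂ : Reds ψ ψ') : Reds (app φ ψ) (app φ' ψ') :=
  (Relation.ReflTransGen.lift (fun φ => Ty.app φ ψ) (fun _ _ h => Step.appL _ h) _ _ h₁).trans
    (Relation.ReflTransGen.lift (Ty.app φ') (fun _ _ h => Step.appR _ h) _ _ h₂)

theorem Reds.arr {σ σ' τ τ' : Typ} (h₁ : Reds σ σ') (h₂ : Reds τ τ') :
    Reds (arr σ τ) (arr σ' τ') :=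
  (Relation.ReflTransGen.lift (fun σ => Ty.arr σ τ) (fun _ _ h => Step.arrL _ h) _ _ h₁).trans
    (Relation.ReflTransGen.lift (Ty.arr σ') (fun _ _ h => Step.arrR _ h) _ _ h₂)

theorem Reds.all (κ : Kind) {τ τ' : Typ} (h : Reds τ τ') : Reds (all κ τ) (all κ τ') :=
  Relation.ReflTransGen.lift (Ty.all κ) (fun _ _ h => Step.all _ h) _ _ h

theorem Reds.lam (κ : Kind) {κ₂ : Kind} {τ τ' : Ty κ₂} (h : Reds τ τ') :
    Reds (lam κ τ) (lam κ τ') :=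
  Relation.ReflTransGen.lift (Ty.lam κ) (fun _ _ h => Step.lam _ h) _ _ h

theorem Reds.betaEq {κ : Kind} {φ φ' : Ty κ} (h : Reds φ φ') : φ.BetaEq φ' := by
  induction h with
  | refl => exact .refl _
  | tail _ h ih => exact .trans _ _ _ ih (.rel _ _ h)

theorem BetaEq.rfl {κ : Kind} {φ : Ty κ} : φ.BetaEq φ := Relation.EqvGen.refl _

theorem BetaEq.symm {κ : Kind} {φ φ' : Ty κ} (h : φ.BetaEq φ') : φ'.BetaEq φ :=
  Relation.EqvGen.symm _ _ h

theorem BetaEq.trans {κ : Kind} {φ φ' φ'' : Ty κ} (h : φ.BetaEq φ') (h' : φ'.BetaEq φ'') :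
    φ.BetaEq φ'' := Relation.EqvGen.trans _ _ _ h h'

/-! ### Confluence of the reduction of type constructors -/

/-- Parallel reduction. -/
inductive Par : {κ : Kind} → Ty κ → Ty κ → Prop
  | var (κ : Kind) (n : ℕ) : Par (var κ n) (var κ n)
  | nat : Par nat nat
  | app {κ₁ κ₂ : Kind} {φ φ' : Ty (.arr κ₁ κ₂)} {ψ ψ' : Ty κ₁} :
      Par φ φ' → Par ψ ψ' → Par (app φ ψ) (app φ' ψ')
  | arr {σ σ' τ τ' : Typ} : Par σ σ' → Par τ τ' → Par (arr σ τ) (arr σ' τ')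
  | all (κ : Kind) {τ τ' : Typ} : Par τ τ' → Par (all κ τ) (all κ τ')
  | lam (κ : Kind) {κ₂ : Kind} {τ τ' : Ty κ₂} : Par τ τ' → Par (lam κ τ) (lam κ τ')
  | beta {κ₁ κ₂ : Kind} {φ φ' : Ty κ₂} {ψ ψ' : Ty κ₁} :
      Par φ φ' → Par ψ ψ' → Par (app (lam κ₁ φ) ψ) (φ'.inst ψ')

theorem Par.refl {κ : Kind} (φ : Ty κ) : Par φ φ := by
  induction φ with
  | var => exact .var _ _
  | nat => exact .nat
  | app _ _ ih₁ ih₂ => exact .app ih₁ ih₂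
  | arr _ _ ih₁ ih₂ => exact .arr ih₁ ih₂
  | all _ _ ih => exact .all _ ih
  | lam _ _ ih => exact .lam _ ih

theorem Step.par {κ : Kind} {φ φ' : Ty κ} (h : Step φ φ') : Par φ φ' := by
  induction h with
  | beta φ ψ => exact .beta (.refl _) (.refl _)
  | appL _ _ ih => exact .app ih (.refl _)
  | arrL _ _ ih => exact .arr ih (.refl _)
  | appR _ _ ih => exact .app (.refl _) ih
  | arrR _ _ ih => exact .arr (.refl _) ih
  | all _ _ ih => exact .all _ ih
  | lam _ _ ih => exact .lam _ ih

theorem Par.reds {κ : Kind} {φ φ' : Ty κ} (h : Par φ φ') : Reds φ φ' := by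
  induction h with
  | var | nat => exact .refl
  | app _ _ ih₁ ih₂ => exact .app ih₁ ih₂
  | arr _ _ ih₁ ih₂ => exact .arr ih₁ ih₂
  | all _ _ ih => exact .all _ ih
  | lam _ _ ih => exact .lam _ ih
  | beta _ _ ih₁ ih₂ => exact ((Reds.lam _ ih₁).app ih₂).tail (.beta _ _)

theorem Par.ren {κ : Kind} {φ φ' : Ty κ} (h : Par φ φ') (r : TyRen) :
    Par (φ.ren r) (φ'.ren r) := by
  induction h generalizing r with
  | var => exact .var _ _
  | nat => exact .nat
  | app _ _ ih₁ ih₂ => exact .app (ih₁ r) (ih₂ r)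
  | arr _ _ ih₁ ih₂ => exact .arr (ih₁ r) (ih₂ r)
  | all _ _ ih => exact .all _ (ih _)
  | lam _ _ ih => exact .lam _ (ih _)
  | beta _ _ ih₁ ih₂ => rw [inst_ren]; exact .beta (ih₁ _) (ih₂ _)

theorem Par.sub {κ : Kind} {φ φ' : Ty κ} (h : Par φ φ') {s s' : TySub}
    (hs : ∀ κ n, Par (s κ n) (s' κ n)) : Par (φ.sub s) (φ'.sub s') := by
  have up : ∀ {s s' : TySub} (κ₀ : Kind), (∀ κ n, Par (s κ n) (s' κ n)) →
      ∀ κ n, Par (s.up κ₀ κ n) (s'.up κ₀ κ n) := by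
    intro s s' κ₀ h κ n
    by_cases e : κ = κ₀
    · cases n with
      | zero => simp [TySub.up, e, Par.refl]
      | succ n => simpa [TySub.up, e] using (h _ _).ren _
    · simpa [TySub.up, e] using (h _ _).ren _
  induction h generalizing s s' with
  | var => exact hs _ _
  | nat => exact .nat
  | app _ _ ih₁ ih₂ => exact .app (ih₁ hs) (ih₂ hs)
  | arr _ _ ih₁ ih₂ => exact .arr (ih₁ hs) (ih₂ hs)
  | all _ _ ih => exact .all _ (ih (up _ hs))
  | lam _ _ ih => exact .lam _ (ih (up _ hs))
  | beta _ _ ih₁ ih₂ => rw [inst_sub']; exact .beta (ih₁ (up _ hs)) (ih₂ hs)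

theorem Par.inst {κ₁ κ₂ : Kind} {φ φ' : Ty κ₂} {ψ ψ' : Ty κ₁} (h₁ : Par φ φ') (h₂ : Par ψ ψ') :
    Par (φ.inst ψ) (φ'.inst ψ') := by
  refine h₁.sub fun κ n => ?_
  by_cases e : κ₁ = κ
  · subst e
    cases n with
    | zero => simpa [TySub.inst] using h₂
    | succ n => simpa [TySub.inst] using .var _ _
  · simpa [TySub.inst, e] using .var _ _

/-- Every type constructor has a complete development: a parallel reduct to which all its parallel
reducts reduce. -/
theorem Par.exists_development {κ : Kind} (φ : Ty κ) : ∃ ψ, ∀ φ', Par φ φ' → Par φ' ψ := by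
  induction φ with
  | var κ n => exact ⟨_, fun _ h => by cases h; exact .refl _⟩
  | nat => exact ⟨_, fun _ h => by cases h; exact .refl _⟩
  | arr σ τ ih₁ ih₂ =>
    obtain ⟨c₁, h₁⟩ := ih₁
    obtain ⟨c₂, h₂⟩ := ih₂
    exact ⟨_, fun _ h => by cases h with | arr a b => exact .arr (h₁ _ a) (h₂ _ b)⟩
  | all κ τ ih =>
    obtain ⟨c, h⟩ := ih
    exact ⟨_, fun _ h' => by cases h' with | all _ a => exact .all _ (h _ a)⟩
  | lam κ τ ih =>
    obtain ⟨c, h⟩ := ih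
    exact ⟨_, fun _ h' => by cases h' with | lam _ a => exact .lam _ (h _ a)⟩
  | app φ ψ ih₁ ih₂ =>
    obtain ⟨c₁, h₁⟩ := ih₁
    obtain ⟨c₂, h₂⟩ := ih₂
    cases φ with
    | lam _ φ =>
      cases h₁ _ (.refl _) with
      | @lam _ _ _ c _ =>
        refine ⟨c.inst c₂, fun _ h => ?_⟩
        cases h with
        | app a b =>
          cases a with
          | lam _ a =>
            cases h₁ _ (.lam _ a) with
            | lam _ a => exact .beta a (h₂ _ b)
        | beta a b =>
          cases h₁ _ (.lam _ a) with
          | lam _ a => exact .inst a (h₂ _ b)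
    | _ => exact ⟨_, fun _ h => by cases h with | app a b => exact .app (h₁ _ a) (h₂ _ b)⟩

theorem Reds.join {κ : Kind} {φ φ₁ φ₂ : Ty κ} (h₁ : Reds φ φ₁) (h₂ : Reds φ φ₂) :
    ∃ ψ, Reds φ₁ ψ ∧ Reds φ₂ ψ := by
  have toPar : ∀ {a b : Ty κ}, Reds a b → Relation.ReflTransGen Par a b :=
    fun h => Relation.ReflTransGen.mono (fun _ _ h => Step.par h) _ _ h
  have ofPar : ∀ {a b : Ty κ}, Relation.ReflTransGen Par a b → Reds a b := fun h => by
    induction h with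
    | refl => exact .refl
    | tail _ h ih => exact ih.trans h.reds
  obtain ⟨ψ, a, b⟩ := Relation.church_rosser (r := @Par κ) (fun a b c hb hc => by
    obtain ⟨d, hd⟩ := Par.exists_development a
    exact ⟨d, .single (hd _ hb), .single (hd _ hc)⟩) (toPar h₁) (toPar h₂)
  exact ⟨ψ, ofPar a, ofPar b⟩

theorem BetaEq.join {κ : Kind} {φ φ' : Ty κ} (h : φ.BetaEq φ') : ∃ ψ, Reds φ ψ ∧ Reds φ' ψ := by
  induction h with
  | rel _ _ h => exact ⟨_, .single h, .refl⟩
  | refl => exact ⟨_, .refl, .refl⟩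
  | symm _ _ _ ih => obtain ⟨ψ, a, b⟩ := ih; exact ⟨ψ, b, a⟩
  | trans _ _ _ _ _ ih₁ ih₂ =>
    obtain ⟨ψ₁, a, b⟩ := ih₁
    obtain ⟨ψ₂, c, d⟩ := ih₂
    obtain ⟨ψ, e, f⟩ := b.join c
    exact ⟨ψ, a.trans e, d.trans f⟩

/-! ### Shapes of type constructors -/

/-- The type constructor is a variable applied to arguments. -/
inductive Neutral : {κ : Kind} → Ty κ → Prop
  | var (κ : Kind) (n : ℕ) : Neutral (var κ n)
  | app {κ₁ κ₂ : Kind} {φ : Ty (.arr κ₁ κ₂)} (ψ : Ty κ₁) : Neutral φ → Neutral (app φ ψ)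

theorem Neutral.not_closed {κ : Kind} {φ : Ty κ} (h : Neutral φ) : ¬ φ.Closed := by
  induction h with
  | var κ n => exact fun hc => hc κ n ⟨rfl, rfl⟩
  | app _ _ ih => exact fun hc => ih fun κ a ha => hc κ a (Or.inl ha)

theorem Neutral.of_ren {r : TyRen} {κ : Kind} {φ : Ty κ} (h : Neutral (φ.ren r)) :
    Neutral φ := by
  induction φ with
  | var => exact .var _ _
  | app _ _ ih _ => cases h with | app _ h => exact .app _ (ih h)
  | _ => cases h

theorem Step.neutral {κ : Kind} {φ φ' : Ty κ} (h : Step φ φ') (hn : Neutral φ) :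
    Neutral φ' := by
  induction h with
  | beta => cases hn with | app _ h => cases h
  | appL _ _ ih => cases hn with | app _ h => exact .app _ (ih h)
  | appR _ _ ih => cases hn with | app _ h => exact .app _ h
  | _ => cases hn

theorem Reds.neutral {κ : Kind} {φ φ' : Ty κ} (h : Reds φ φ') (hn : Neutral φ) :
    Neutral φ' := by
  induction h with
  | refl => exact hn
  | tail _ h ih => exact h.neutral ih

theorem Reds.of_nat {τ : Typ} (h : Reds nat τ) : τ = nat := by
  induction h with
  | refl => rfl
  | tail _ h ih => subst ih; cases h

theorem Reds.of_arr {σ τ ρ : Typ} (h : Reds (Ty.arr σ τ) ρ) :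
    ∃ σ' τ', ρ = Ty.arr σ' τ' ∧ Reds σ σ' ∧ Reds τ τ' := by
  induction h with
  | refl => exact ⟨_, _, rfl, .refl, .refl⟩
  | tail _ h ih =>
    obtain ⟨σ', τ', rfl, h₁, h₂⟩ := ih
    cases h with
    | arrL _ h => exact ⟨_, _, rfl, h₁.tail h, h₂⟩
    | arrR _ h => exact ⟨_, _, rfl, h₁, h₂.tail h⟩

theorem Reds.of_all {κ : Kind} {τ ρ : Typ} (h : Reds (Ty.all κ τ) ρ) :
    ∃ τ', ρ = Ty.all κ τ' ∧ Reds τ τ' := by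
  induction h with
  | refl => exact ⟨_, rfl, .refl⟩
  | tail _ h ih =>
    obtain ⟨τ', rfl, h₁⟩ := ih
    cases h with | all _ h => exact ⟨_, rfl, h₁.tail h⟩

theorem BetaEq.arr_inj {σ τ σ' τ' : Typ} (h : (arr σ τ).BetaEq (arr σ' τ')) :
    σ.BetaEq σ' ∧ τ.BetaEq τ' := by
  obtain ⟨ρ, h₁, h₂⟩ := h.join
  obtain ⟨_, _, rfl, a, b⟩ := h₁.of_arr
  obtain ⟨_, _, e, c, d⟩ := h₂.of_arr
  cases e
  exact ⟨a.betaEq.trans c.betaEq.symm, b.betaEq.trans d.betaEq.symm⟩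

theorem BetaEq.all_inj {κ κ' : Kind} {τ τ' : Typ} (h : (all κ τ).BetaEq (all κ' τ')) :
    κ = κ' ∧ τ.BetaEq τ' := by
  obtain ⟨ρ, h₁, h₂⟩ := h.join
  obtain ⟨_, rfl, a⟩ := h₁.of_all
  obtain ⟨_, e, b⟩ := h₂.of_all
  cases e
  exact ⟨Eq.refl _, a.betaEq.trans b.betaEq.symm⟩

theorem BetaEq.reds_nat {τ : Typ} (h : τ.BetaEq nat) : Reds τ nat := by
  obtain ⟨ρ, h₁, h₂⟩ := h.join
  exact h₂.of_nat ▸ h₁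

theorem BetaEq.reds_arr {ρ σ τ : Typ} (h : ρ.BetaEq (arr σ τ)) :
    ∃ σ' τ', Reds ρ (arr σ' τ') ∧ Reds σ σ' ∧ Reds τ τ' := by
  obtain ⟨_, h₁, h₂⟩ := h.join
  obtain ⟨_, _, rfl, a, b⟩ := h₂.of_arr
  exact ⟨_, _, h₁, a, b⟩

theorem BetaEq.reds_all {ρ τ : Typ} {κ : Kind} (h : ρ.BetaEq (all κ τ)) :
    ∃ τ', Reds ρ (all κ τ') ∧ Reds τ τ' := by
  obtain ⟨_, h₁, h₂⟩ := h.join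
  obtain ⟨_, rfl, a⟩ := h₂.of_all
  exact ⟨_, h₁, a⟩

theorem not_nat_betaEq_arr {σ τ : Typ} : ¬ nat.BetaEq (arr σ τ) := fun h => by
  obtain ⟨_, _, h, _, _⟩ := h.reds_arr
  exact nomatch h.of_nat

theorem not_nat_betaEq_all {κ : Kind} {τ : Typ} : ¬ nat.BetaEq (all κ τ) := fun h => by
  obtain ⟨_, h, _⟩ := h.reds_all
  exact nomatch h.of_nat

theorem not_arr_betaEq_all {κ : Kind} {σ τ ρ : Typ} : ¬ (arr σ ρ).BetaEq (all κ τ) := fun h => by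
  obtain ⟨_, h, _⟩ := h.reds_all
  obtain ⟨_, _, e, _⟩ := h.of_arr
  exact nomatch e

theorem Neutral.not_betaEq {τ ρ : Typ} (hn : Neutral τ) (hρ : ∀ ρ', Reds ρ ρ' → ¬ Neutral ρ') :
    ¬ τ.BetaEq ρ := fun h => by
  obtain ⟨_, h₁, h₂⟩ := h.join
  exact hρ _ h₂ (h₁.neutral hn)

theorem Neutral.not_betaEq_nat {τ : Typ} (hn : Neutral τ) : ¬ τ.BetaEq nat :=
  hn.not_betaEq fun _ h hn => by cases h.of_nat; cases hn

theorem Neutral.not_betaEq_arr {τ σ ρ : Typ} (hn : Neutral τ) : ¬ τ.BetaEq (arr σ ρ) :=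
  hn.not_betaEq fun _ h hn => by obtain ⟨_, _, rfl, _⟩ := h.of_arr; cases hn

theorem Neutral.not_betaEq_all {κ : Kind} {τ ρ : Typ} (hn : Neutral τ) : ¬ τ.BetaEq (all κ ρ) :=
  hn.not_betaEq fun _ h hn => by obtain ⟨_, rfl, _⟩ := h.of_all; cases hn

theorem BetaEq.arr {σ σ' τ τ' : Typ} (h₁ : σ.BetaEq σ') (h₂ : τ.BetaEq τ') :
    (arr σ τ).BetaEq (arr σ' τ') := by
  obtain ⟨_, a, b⟩ := h₁.join
  obtain ⟨_, c, d⟩ := h₂.join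
  exact (a.arr c).betaEq.trans (b.arr d).betaEq.symm

theorem BetaEq.all (κ : Kind) {τ τ' : Typ} (h : τ.BetaEq τ') : (all κ τ).BetaEq (all κ τ') := by
  obtain ⟨_, a, b⟩ := h.join
  exact (a.all κ).betaEq.trans (b.all κ).betaEq.symm

theorem BetaEq.lam (κ : Kind) {κ' : Kind} {τ τ' : Ty κ'} (h : τ.BetaEq τ') :
    (lam κ τ).BetaEq (lam κ τ') := by
  obtain ⟨_, a, b⟩ := h.join
  exact (a.lam κ).betaEq.trans (b.lam κ).betaEq.symm

theorem BetaEq.app {κ₁ κ₂ : Kind} {φ φ' : Ty (.arr κ₁ κ₂)} {ψ ψ' : Ty κ₁} (h₁ : φ.BetaEq φ')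
    (h₂ : ψ.BetaEq ψ') : (app φ ψ).BetaEq (app φ' ψ') := by
  obtain ⟨_, a, b⟩ := h₁.join
  obtain ⟨_, c, d⟩ := h₂.join
  exact (a.app c).betaEq.trans (b.app d).betaEq.symm

theorem BetaEq.sub_left {κ : Kind} {τ τ' : Ty κ} (h : τ.BetaEq τ') (s : TySub) :
    (τ.sub s).BetaEq (τ'.sub s) := by
  obtain ⟨_, a, b⟩ := h.join
  exact (a.sub s).betaEq.trans (b.sub s).betaEq.symm

theorem BetaEq.ren {κ : Kind} {τ τ' : Ty κ} (h : τ.BetaEq τ') (r : TyRen) :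
    (τ.ren r).BetaEq (τ'.ren r) := by
  simpa only [ren_eq_sub] using h.sub_left _

theorem BetaEq.sub_right {κ : Kind} (τ : Ty κ) {s s' : TySub}
    (h : ∀ κ n, (s κ n).BetaEq (s' κ n)) : (τ.sub s).BetaEq (τ.sub s') := by
  have up : ∀ {s s' : TySub} (κ₀ : Kind), (∀ κ n, (s κ n).BetaEq (s' κ n)) →
      ∀ κ n, (s.up κ₀ κ n).BetaEq (s'.up κ₀ κ n) := by
    intro s s' κ₀ h κ n
    by_cases e : κ = κ₀
    · subst e
      cases n with
      | zero => simpa using .rfl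
      | succ n => simpa using (h _ _).ren _
    · simpa [e] using (h _ _).ren _
  induction τ generalizing s s' with
  | var => exact h _ _
  | nat => exact .rfl
  | app _ _ ih₁ ih₂ => exact (ih₁ h).app (ih₂ h)
  | arr _ _ ih₁ ih₂ => exact (ih₁ h).arr (ih₂ h)
  | all _ _ ih => exact (ih (up _ h)).all _
  | lam _ _ ih => exact (ih (up _ h)).lam _

theorem BetaEq.inst {κ₁ κ₂ : Kind} {φ φ' : Ty κ₂} {ψ ψ' : Ty κ₁} (h₁ : φ.BetaEq φ')
    (h₂ : ψ.BetaEq ψ') : (φ.inst ψ).BetaEq (φ'.inst ψ') := by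
  refine (h₁.sub_left _).trans (sub_right _ fun κ n => ?_)
  by_cases e : κ = κ₁
  · subst e
    cases n with
    | zero => simpa [TySub.inst_eq_cons] using h₂
    | succ n => simpa [TySub.inst_eq_cons] using .rfl
  · simpa [TySub.inst_eq_cons, e] using .rfl

/-! ### Normalization of type constructors -/

/-- Weak head reduction. -/
inductive WStep : {κ : Kind} → Ty κ → Ty κ → Prop
  | beta {κ₁ κ₂ : Kind} (φ : Ty κ₂) (ψ : Ty κ₁) : WStep (app (lam κ₁ φ) ψ) (φ.inst ψ)
  | appL {κ₁ κ₂ : Kind} {φ φ' : Ty (.arr κ₁ κ₂)} (ψ : Ty κ₁) :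
      WStep φ φ' → WStep (app φ ψ) (app φ' ψ)

theorem WStep.step {κ : Kind} {φ φ' : Ty κ} (h : WStep φ φ') : Step φ φ' := by
  induction h with
  | beta => exact .beta _ _
  | appL _ _ ih => exact .appL _ ih

theorem WStep.of_ren {r : TyRen} {κ : Kind} {φ φ' : Ty κ} (h : WStep (φ.ren r) φ') :
    ∃ φ'', WStep φ φ'' ∧ φ''.ren r = φ' := by
  induction φ generalizing r with
  | app φ ψ ih _ =>
    simp only [ren] at h
    generalize e : φ.ren r = φ₁ at h
    cases h with
    | beta φ₂ ψ₂ =>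
      cases φ with
      | lam κ φ => cases e; exact ⟨_, .beta _ _, by rw [inst_ren]⟩
      | _ => cases e
    | appL _ h =>
      subst e
      obtain ⟨φ'', h', rfl⟩ := ih h
      exact ⟨_, .appL _ h', rfl⟩
  | _ => cases h

/-- The type constructors that a normalizing strategy, which contracts weak head redexes first,
brings to a normal form; with `b = true`, those for which the result is moreover neutral. -/
inductive Norm : Bool → {κ : Kind} → Ty κ → Prop
  | var (b : Bool) (κ : Kind) (n : ℕ) : Norm b (var κ n)
  | app (b : Bool) {κ₁ κ₂ : Kind} {φ : Ty (.arr κ₁ κ₂)} {ψ : Ty κ₁} :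
      Norm true φ → Norm false ψ → Norm b (app φ ψ)
  | nat : Norm false nat
  | arr {σ τ : Typ} : Norm false σ → Norm false τ → Norm false (arr σ τ)
  | all (κ : Kind) {τ : Typ} : Norm false τ → Norm false (all κ τ)
  | lam (κ : Kind) {κ₂ : Kind} {τ : Ty κ₂} : Norm false τ → Norm false (lam κ τ)
  | exp {κ : Kind} {φ φ' : Ty κ} : WStep φ φ' → Norm false φ' → Norm false φ

theorem Norm.of_ren {b : Bool} {r : TyRen} {κ : Kind} {φ : Ty κ} (h : Norm b (φ.ren r)) :
    Norm b φ := by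
  generalize e : φ.ren r = φ₁ at h
  induction h generalizing r with
  | var => cases φ <;> cases e; exact .var _ _ _
  | nat => cases φ <;> cases e; exact .nat
  | app b _ _ ih₁ ih₂ => cases φ <;> cases e; exact .app _ (ih₁ rfl) (ih₂ rfl)
  | arr _ _ ih₁ ih₂ => cases φ <;> cases e; exact .arr (ih₁ rfl) (ih₂ rfl)
  | all _ _ ih => cases φ <;> cases e; exact .all _ (ih rfl)
  | lam _ _ ih => cases φ <;> cases e; exact .lam _ (ih rfl)
  | exp h _ ih =>
    subst e
    obtain ⟨φ'', h', rfl⟩ := h.of_ren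
    exact .exp h' (ih rfl)

theorem Norm.exists_nf {b : Bool} {κ : Kind} {φ : Ty κ} (h : Norm b φ) :
    ∃ ν, φ.HasNF ν ∧ (b = true → Neutral ν) := by
  induction h with
  | var b κ n => exact ⟨_, ⟨.refl, fun _ h => by cases h⟩, fun _ => .var _ _⟩
  | nat => exact ⟨_, ⟨.refl, fun _ h => by cases h⟩, by simp⟩
  | app b _ _ ih₁ ih₂ =>
    obtain ⟨ν₁, ⟨h₁, n₁⟩, hn⟩ := ih₁
    obtain ⟨ν₂, ⟨h₂, n₂⟩, _⟩ := ih₂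
    refine ⟨_, ⟨Reds.app h₁ h₂, fun _ h => ?_⟩, fun _ => .app _ (hn rfl)⟩
    cases h with
    | beta => cases hn rfl
    | appL _ h => exact n₁ _ h
    | appR _ h => exact n₂ _ h
  | arr _ _ ih₁ ih₂ =>
    obtain ⟨ν₁, ⟨h₁, n₁⟩, _⟩ := ih₁
    obtain ⟨ν₂, ⟨h₂, n₂⟩, _⟩ := ih₂
    refine ⟨_, ⟨Reds.arr h₁ h₂, fun _ h => ?_⟩, by simp⟩
    cases h with
    | arrL _ h => exact n₁ _ h
    | arrR _ h => exact n₂ _ h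
  | all _ _ ih =>
    obtain ⟨ν₁, ⟨h₁, n₁⟩, _⟩ := ih
    refine ⟨_, ⟨Reds.all _ h₁, fun _ h => ?_⟩, by simp⟩
    cases h with | all _ h => exact n₁ _ h
  | lam _ _ ih =>
    obtain ⟨ν₁, ⟨h₁, n₁⟩, _⟩ := ih
    refine ⟨_, ⟨Reds.lam _ h₁, fun _ h => ?_⟩, by simp⟩
    cases h with | lam _ h => exact n₁ _ h
  | exp h _ ih =>
    obtain ⟨ν₁, ⟨h₁, n₁⟩, _⟩ := ih
    exact ⟨ν₁, ⟨.head h.step h₁, n₁⟩, by simp⟩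

theorem Norm.weaken {b : Bool} {κ : Kind} {φ : Ty κ} (h : Norm b φ) : Norm false φ := by
  cases h with
  | var => exact .var _ _ _
  | nat => exact .nat
  | app _ h₁ h₂ => exact .app _ h₁ h₂
  | arr h₁ h₂ => exact .arr h₁ h₂
  | all _ h => exact .all _ h
  | lam _ h => exact .lam _ h
  | exp h h' => exact .exp h h'

/-- Tait's reducibility predicate. Normalizability is part of it at every kind, so it does not have
to be derived from that of an application to a variable. -/
def Reducible : (κ : Kind) → Ty κ → Prop
  | .star, φ => Norm false φ
  | .arr κ₁ κ₂, φ => Norm false φ ∧ ∀ ψ, Reducible κ₁ ψ → Reducible κ₂ (app φ ψ)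

theorem Reducible.norm {κ : Kind} {φ : Ty κ} (h : Reducible κ φ) : Norm false φ := by
  cases κ with
  | star => exact h
  | arr => exact h.1

theorem Norm.reducible {κ : Kind} {φ : Ty κ} (h : Norm true φ) : Reducible κ φ := by
  induction κ with
  | star => exact h.weaken
  | arr _ _ _ ih => exact ⟨h.weaken, fun ψ hψ => ih (.app _ h hψ.norm)⟩

theorem Reducible.exp {κ : Kind} {φ φ' : Ty κ} (h : WStep φ φ') (h' : Reducible κ φ') :
    Reducible κ φ := by
  induction κ with
  | star => exact Norm.exp h h'
  | arr _ _ _ ih => exact ⟨.exp h h'.1, fun ψ hψ => ih (.appL _ h) (h'.2 ψ hψ)⟩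

end Ty

/-- The renaming that puts the variable with index `a` for the variable of a removed binder. -/
def TyRen.inst (κ : Kind) (a : ℕ) : TyRen := fun κ' n =>
  if κ' = κ then
    match n with
    | 0 => a
    | m + 1 => m
  else n

namespace Ty

theorem _root_.PolyInterp.TySub.inst_var (κ : Kind) (a : ℕ) :
    TySub.inst (var κ a) = fun κ' n => var κ' (TyRen.inst κ a κ' n) := by
  funext κ' n
  by_cases e : κ' = κ
  · subst e; cases n <;> simp [TySub.inst, TyRen.inst]
  · simp [TySub.inst, TyRen.inst, e, Ne.symm e]

theorem inst_var {κ κ' : Kind} (φ : Ty κ') (a : ℕ) :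
    φ.inst (var κ a) = φ.ren (TyRen.inst κ a) := by
  rw [inst, TySub.inst_var, ren_eq_sub]

theorem reducible_sub {κ : Kind} (φ : Ty κ) {s : TySub} (hs : ∀ κ n, Reducible κ (s κ n)) :
    Reducible κ (φ.sub s) := by
  induction φ generalizing s with
  | var => exact hs _ _
  | nat => exact .nat
  | app _ _ ih₁ ih₂ => exact (ih₁ hs).2 _ (ih₂ hs)
  | arr _ _ ih₁ ih₂ => exact .arr (ih₁ hs) (ih₂ hs)
  | all κ φ ih =>
    have key := ih (s := TySub.cons (var κ 0) s) fun κ' n => by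
      by_cases e : κ' = κ
      · subst e
        cases n with
        | zero => simpa using (Norm.var _ _ _).reducible
        | succ n => simpa using hs _ _
      · simpa [e] using hs _ _
    rw [← sub_up_inst, inst_var] at key
    exact .all _ (Norm.of_ren key.norm)
  | lam κ φ ih =>
    have key : ∀ ψ, Reducible κ ψ → Reducible _ ((φ.sub (s.up κ)).inst ψ) := fun ψ hψ => by
      rw [sub_up_inst]
      refine ih fun κ' n => ?_
      by_cases e : κ' = κ
      · subst e
        cases n with
        | zero => simpa using hψ
        | succ n => simpa using hs _ _
      · simpa [e] using hs _ _
    have h := key (var κ 0) (Norm.var _ _ _).reducible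
    rw [inst_var] at h
    exact ⟨.lam _ (Norm.of_ren h.norm), fun ψ hψ => .exp (.beta _ _) (key ψ hψ)⟩

theorem exists_hasNF {κ : Kind} (φ : Ty κ) : ∃ ν, φ.HasNF ν := by
  have := (reducible_sub φ (s := var) fun κ n => (Norm.var _ _ _).reducible).norm.exists_nf
  rw [sub_var] at this
  exact ⟨_, this.choose_spec.1⟩

theorem HasNF.betaEq {κ : Kind} {φ ν : Ty κ} (h : φ.HasNF ν) : φ.BetaEq ν := Reds.betaEq h.1

theorem HasNF.closed {κ : Kind} {φ ν : Ty κ} (h : φ.HasNF ν) (hc : φ.Closed) : ν.Closed :=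
  Reds.closed h.1 hc

theorem eq_of_reds_of_normal {κ : Kind} {φ ν : Ty κ} (h : Reds ν φ) (hν : ∀ φ, ¬ Step ν φ) :
    ν = φ := by
  rcases Relation.ReflTransGen.cases_head h with h | ⟨_, h, _⟩
  · exact h
  · exact (hν _ h).elim

theorem HasNF.of_betaEq {κ : Kind} {φ φ' ν : Ty κ} (h : φ.HasNF ν) (e : φ.BetaEq φ') :
    φ'.HasNF ν := by
  obtain ⟨_, h₁, h₂⟩ := (e.symm.trans h.betaEq).join
  cases eq_of_reds_of_normal h₂ h.2
  exact ⟨h₁, h.2⟩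

theorem normal_cases {κ : Kind} (ν : Ty κ) (h : ∀ φ, ¬ Step ν φ) :
    Neutral ν ∨ (∃ h : κ = .star, h ▸ ν = nat) ∨ (∃ σ τ, ∃ h : κ = .star, h ▸ ν = arr σ τ) ∨
      (∃ κ' τ, ∃ h : κ = .star, h ▸ ν = all κ' τ) ∨
      ∃ κ₁ κ₂ φ, ∃ h : κ = .arr κ₁ κ₂, h ▸ ν = lam κ₁ φ := by
  induction ν with
  | var => exact .inl (.var _ _)
  | nat => exact .inr (.inl ⟨rfl, rfl⟩)
  | arr σ τ => exact .inr (.inr (.inl ⟨σ, τ, rfl, rfl⟩))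
  | all κ τ => exact .inr (.inr (.inr (.inl ⟨κ, τ, rfl, rfl⟩)))
  | lam κ φ => exact .inr (.inr (.inr (.inr ⟨κ, _, φ, rfl, rfl⟩)))
  | app φ ψ ih _ =>
    rcases ih fun _ h' => h _ (.appL _ h') with h' | ⟨e, _⟩ | ⟨_, _, e, _⟩ | ⟨_, _, e, _⟩ |
      ⟨κ₁, κ₂, φ', e, e'⟩
    · exact .inl (.app _ h')
    · cases e
    · cases e
    · cases e
    · cases e
      cases e'
      exact (h _ (.beta _ _)).elim

theorem exists_shape (τ : Typ) : Reds τ nat ∨ (∃ σ ρ, Reds τ (arr σ ρ)) ∨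
    (∃ κ ρ, Reds τ (all κ ρ)) ∨ ∃ ν, Reds τ ν ∧ Neutral ν := by
  obtain ⟨ν, hν, n⟩ := exists_hasNF τ
  rcases normal_cases ν n with h' | ⟨e, h⟩ | ⟨_, _, e, h⟩ | ⟨_, _, e, h⟩ | ⟨_, _, _, e, _⟩
  · exact .inr (.inr (.inr ⟨_, hν, h'⟩))
  · cases h; exact .inl hν
  · cases h; exact .inr (.inl ⟨_, _, hν⟩)
  · cases h; exact .inr (.inr (.inl ⟨_, _, hν⟩))
  · cases e

theorem Closed.exists_shape {τ : Typ} (hc : τ.Closed) : Reds τ nat ∨ (∃ σ ρ, Reds τ (arr σ ρ)) ∨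
    ∃ κ ρ, Reds τ (all κ ρ) := by
  rcases Ty.exists_shape τ with h | h | h | ⟨ν, h, hn⟩
  · exact .inl h
  · exact .inr (.inl h)
  · exact .inr (.inr h)
  · exact (hn.not_closed (h.closed hc)).elim

theorem Step.of_ren {r : TyRen} {κ : Kind} {φ φ' : Ty κ} (h : Step (φ.ren r) φ') :
    ∃ φ'', Step φ φ'' ∧ φ''.ren r = φ' := by
  induction φ generalizing r with
  | app φ ψ ih₁ ih₂ =>
    simp only [ren] at h
    generalize e : φ.ren r = φ₁ at h
    cases h with
    | beta φ₂ ψ₂ =>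
      cases φ with
      | lam κ φ => cases e; exact ⟨_, .beta _ _, by rw [inst_ren]⟩
      | _ => cases e
    | appL _ h =>
      subst e
      obtain ⟨φ'', h', rfl⟩ := ih₁ h
      exact ⟨_, .appL _ h', rfl⟩
    | appR _ h =>
      subst e
      obtain ⟨φ'', h', rfl⟩ := ih₂ h
      exact ⟨_, .appR _ h', rfl⟩
  | arr σ τ ih₁ ih₂ =>
    cases h with
    | arrL _ h => obtain ⟨_, h', rfl⟩ := ih₁ h; exact ⟨_, .arrL _ h', rfl⟩
    | arrR _ h => obtain ⟨_, h', rfl⟩ := ih₂ h; exact ⟨_, .arrR _ h', rfl⟩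
  | all κ τ ih => cases h with | all _ h => obtain ⟨_, h', rfl⟩ := ih h; exact ⟨_, .all _ h', rfl⟩
  | lam κ τ ih => cases h with | lam _ h => obtain ⟨_, h', rfl⟩ := ih h; exact ⟨_, .lam _ h', rfl⟩
  | _ => cases h

theorem Reds.of_ren {r : TyRen} {κ : Kind} {φ φ' : Ty κ} (h : Reds (φ.ren r) φ') :
    ∃ φ'', Reds φ φ'' ∧ φ''.ren r = φ' := by
  induction h with
  | refl => exact ⟨_, .refl, rfl⟩
  | tail _ h ih =>
    obtain ⟨_, h₁, rfl⟩ := ih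
    obtain ⟨_, h₂, rfl⟩ := h.of_ren
    exact ⟨_, h₁.tail h₂, rfl⟩

end Ty

theorem chi_closed (κ : Kind) : (chi κ).Closed := by
  induction κ with
  | star => exact fun _ _ h => h
  | arr _ _ _ ih => exact fun _ _ h => ih _ _ h

/-! ### Substitution calculus for terms -/

namespace Tm

theorem upRen_comp (r r' : ℕ → ℕ) : (fun x => upRen r' (upRen r x)) = upRen fun x => r' (r x) := by
  funext x; cases x <;> rfl

theorem ren_ren (r r' : ℕ → ℕ) (t : Tm) : (t.ren r).ren r' = t.ren fun x => r' (r x) := by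
  induction t generalizing r r' with
  | var | sym => rfl
  | lam _ _ ih => simp [ren, ih, upRen_comp]
  | tlam _ _ ih => simp [ren, ih]
  | app _ _ ih₁ ih₂ => simp [ren, ih₁, ih₂]
  | tapp _ _ ih => simp [ren, ih]

theorem tsub_of_ren (r : ℕ → ℕ) (s : TySub) (t : Tm) : (t.ren r).tsub s = (t.tsub s).ren r := by
  induction t generalizing r s with
  | var | sym => rfl
  | lam _ _ ih => simp [ren, tsub, ih]
  | tlam _ _ ih => simp [ren, tsub, ih]
  | app _ _ ih₁ ih₂ => simp [ren, tsub, ih₁, ih₂]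
  | tapp _ _ ih => simp [ren, tsub, ih]

theorem tren_eq_tsub (r : TyRen) (t : Tm) : t.tren r = t.tsub fun κ n => .var κ (r κ n) := by
  induction t generalizing r with
  | var | sym => rfl
  | lam _ _ ih => simp [tren, tsub, ih, Ty.ren_eq_sub]
  | tlam _ _ ih => simp [tren, tsub, ih, TySub.up_var]
  | app _ _ ih₁ ih₂ => simp [tren, tsub, ih₁, ih₂]
  | tapp _ _ ih => simp [tren, tsub, ih, Ty.ren_eq_sub]

theorem tren_of_ren (r : ℕ → ℕ) (q : TyRen) (t : Tm) : (t.ren r).tren q = (t.tren q).ren r := by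
  simp only [tren_eq_tsub, tsub_of_ren]

theorem tsub_tsub (s s' : TySub) (t : Tm) :
    (t.tsub s).tsub s' = t.tsub fun κ n => (s κ n).sub s' := by
  induction t generalizing s s' with
  | var | sym => rfl
  | lam _ _ ih => simp [tsub, ih, Ty.sub_sub]
  | tlam _ _ ih => simp [tsub, ih, TySub.sub_up]
  | app _ _ ih₁ ih₂ => simp [tsub, ih₁, ih₂]
  | tapp _ _ ih => simp [tsub, ih, Ty.sub_sub]

theorem tsub_of_tren (r : TyRen) (s : TySub) (t : Tm) :
    (t.tren r).tsub s = t.tsub fun κ n => s κ (r κ n) := by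
  rw [tren_eq_tsub, tsub_tsub]; rfl

theorem tren_of_tsub (r : TyRen) (s : TySub) (t : Tm) :
    (t.tsub s).tren r = t.tsub fun κ n => (s κ n).ren r := by
  rw [tren_eq_tsub, tsub_tsub]; simp only [Ty.ren_eq_sub]

theorem upSub_comp_upRen (r : ℕ → ℕ) (g : ℕ → Tm) :
    (fun x => upSub g (upRen r x)) = upSub fun x => g (r x) := by
  funext x; cases x <;> rfl

theorem sub_of_ren (r : ℕ → ℕ) (g : ℕ → Tm) (t : Tm) : (t.ren r).sub g = t.sub fun x => g (r x) := by
  induction t generalizing r g with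
  | var | sym => rfl
  | lam _ _ ih => simp [ren, sub, ih, upSub_comp_upRen]
  | tlam _ _ ih => simp [ren, sub, ih]
  | app _ _ ih₁ ih₂ => simp [ren, sub, ih₁, ih₂]
  | tapp _ _ ih => simp [ren, sub, ih]

theorem ren_upSub (r : ℕ → ℕ) (g : ℕ → Tm) :
    (fun x => (upSub g x).ren (upRen r)) = upSub fun x => (g x).ren r := by
  funext x
  cases x
  · rfl
  · simp [upSub, ren_ren, upRen]

theorem ren_of_sub (r : ℕ → ℕ) (g : ℕ → Tm) (t : Tm) :
    (t.sub g).ren r = t.sub fun x => (g x).ren r := by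
  induction t generalizing r g with
  | var | sym => rfl
  | lam _ _ ih => simp [ren, sub, ih, ren_upSub]
  | tlam _ _ ih => simp [ren, sub, ih, tren_of_ren]
  | app _ _ ih₁ ih₂ => simp [ren, sub, ih₁, ih₂]
  | tapp _ _ ih => simp [ren, sub, ih]

theorem tren_shift_tsub_up (κ : Kind) (s : TySub) (t : Tm) :
    (t.tren (TyRen.shift κ)).tsub (s.up κ) = (t.tsub s).tren (TyRen.shift κ) := by
  rw [tsub_of_tren, tren_of_tsub]
  congr 1
  funext κ' n
  by_cases h : κ' = κ
  · subst h; simp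
  · simp [h]

theorem tsub_upSub (s : TySub) (g : ℕ → Tm) :
    (fun x => (upSub g x).tsub s) = upSub fun x => (g x).tsub s := by
  funext x
  cases x
  · rfl
  · simp [upSub, tsub_of_ren]

theorem tsub_of_sub (s : TySub) (g : ℕ → Tm) (t : Tm) :
    (t.sub g).tsub s = (t.tsub s).sub fun x => (g x).tsub s := by
  induction t generalizing s g with
  | var | sym => rfl
  | lam _ _ ih => simp [tsub, sub, ih, tsub_upSub]
  | tlam _ _ ih => simp [tsub, sub, ih, tren_shift_tsub_up]
  | app _ _ ih₁ ih₂ => simp [tsub, sub, ih₁, ih₂]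
  | tapp _ _ ih => simp [tsub, sub, ih]

theorem tren_of_sub (r : TyRen) (g : ℕ → Tm) (t : Tm) :
    (t.sub g).tren r = (t.tren r).sub fun x => (g x).tren r := by
  simp only [tren_eq_tsub, tsub_of_sub]

theorem sub_upSub (g g' : ℕ → Tm) :
    (fun x => (upSub g x).sub (upSub g')) = upSub fun x => (g x).sub g' := by
  funext x
  cases x
  · rfl
  · simp [upSub, sub_of_ren, ren_of_sub]

theorem sub_sub (g g' : ℕ → Tm) (t : Tm) : (t.sub g).sub g' = t.sub fun x => (g x).sub g' := by
  induction t generalizing g g' with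
  | var | sym => rfl
  | lam _ _ ih => simp [sub, ih, sub_upSub]
  | tlam _ _ ih => simp [sub, ih, tren_of_sub]
  | app _ _ ih₁ ih₂ => simp [sub, ih₁, ih₂]
  | tapp _ _ ih => simp [sub, ih]

theorem upSub_var (r : ℕ → ℕ) : upSub (fun x => var (r x)) = fun x => var (upRen r x) := by
  funext x; cases x <;> rfl

theorem ren_eq_sub (r : ℕ → ℕ) (t : Tm) : t.ren r = t.sub fun x => var (r x) := by
  induction t generalizing r with
  | var | sym => rfl
  | lam _ _ ih => simp [ren, sub, ih, upSub_var]
  | tlam _ _ ih => simp [ren, sub, ih, tren]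
  | app _ _ ih₁ ih₂ => simp [ren, sub, ih₁, ih₂]
  | tapp _ _ ih => simp [ren, sub, ih]

theorem sub_congr {g g' : ℕ → Tm} (t : Tm) (h : ∀ x, t.Free x → g x = g' x) :
    t.sub g = t.sub g' := by
  induction t generalizing g g' with
  | var x => exact h x rfl
  | sym => rfl
  | lam _ _ ih =>
    simp only [sub]
    rw [ih fun x hx => ?_]
    cases x with
    | zero => rfl
    | succ x => simp [upSub, h x hx]
  | tlam _ _ ih => simp only [sub]; rw [ih fun x hx => by rw [h x hx]]
  | app _ _ ih₁ ih₂ =>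
    simp [sub, ih₁ fun x hx => h x (Or.inl hx), ih₂ fun x hx => h x (Or.inr hx)]
  | tapp _ _ ih => simp only [sub]; rw [ih h]

theorem sub_var (t : Tm) : t.sub var = t := by
  have h : upSub var = var := by funext x; cases x <;> rfl
  induction t with
  | var | sym => rfl
  | lam _ _ ih => simp [sub, ih, h]
  | tlam _ _ ih => simp only [sub, tren]; rw [show (fun x => var x) = var from rfl, ih]
  | app _ _ ih₁ ih₂ => simp [sub, ih₁, ih₂]
  | tapp _ _ ih => simp [sub, ih]

theorem ren_id (t : Tm) : t.ren (fun x => x) = t := by rw [ren_eq_sub]; exact sub_var t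

theorem tsub_congr {s s' : TySub} (t : Tm) (h : ∀ κ a, t.TFree κ a → s κ a = s' κ a) :
    t.tsub s = t.tsub s' := by
  induction t generalizing s s' with
  | var | sym => rfl
  | lam _ _ ih =>
    simp only [tsub]
    rw [ih fun κ a ha => h κ a (Or.inr ha), Ty.sub_congr _ fun κ a ha => h κ a (Or.inl ha)]
  | tlam κ₀ _ ih =>
    simp only [tsub]
    rw [ih fun κ a ha => ?_]
    by_cases e : κ = κ₀
    · subst e
      cases a with
      | zero => simp
      | succ a => simp [h κ a (by simpa [TFree] using ha)]
    · simp [e, h κ a (by simpa [TFree, Ne.symm e] using ha)]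
  | app _ _ ih₁ ih₂ =>
    simp [tsub, ih₁ fun κ a ha => h κ a (Or.inl ha), ih₂ fun κ a ha => h κ a (Or.inr ha)]
  | tapp _ _ ih =>
    simp only [tsub]
    rw [ih fun κ a ha => h κ a (Or.inl ha), Ty.sub_congr _ fun κ a ha => h κ a (Or.inr ha)]

theorem tsub_var (t : Tm) : t.tsub Ty.var = t := by
  have h : ∀ κ, TySub.up κ Ty.var = Ty.var := fun κ => by
    funext κ' n
    by_cases e : κ' = κ
    · subst e; cases n <;> simp [Ty.ren]
    · simp [e, Ty.ren]
  induction t with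
  | var | sym => rfl
  | lam _ _ ih => simp [tsub, ih, Ty.sub_var]
  | tlam _ _ ih => simp [tsub, ih, h]
  | app _ _ ih₁ ih₂ => simp [tsub, ih₁, ih₂]
  | tapp _ _ ih => simp [tsub, ih, Ty.sub_var]

/-- The substitution that maps the variable `0` to `a` and the other variables, shifted down, as
`g` does. -/
def cons (a : Tm) (g : ℕ → Tm) : ℕ → Tm
  | 0 => a
  | n + 1 => g n

theorem sub_upSub_inst (g : ℕ → Tm) (t a : Tm) :
    (t.sub (upSub g)).sub (instSub a) = t.sub (cons a g) := by
  rw [sub_sub]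
  congr 1
  funext x
  cases x
  · rfl
  · simp only [upSub, cons, sub_of_ren]; exact sub_var _

theorem inst_sub (g : ℕ → Tm) (t a : Tm) :
    (t.sub (instSub a)).sub g = (t.sub (upSub g)).sub (instSub (a.sub g)) := by
  rw [sub_upSub_inst, sub_sub]
  congr 1
  funext x
  cases x <;> rfl

theorem inst_tsub (s : TySub) (t a : Tm) :
    (t.sub (instSub a)).tsub s = (t.tsub s).sub (instSub (a.tsub s)) := by
  rw [tsub_of_sub]
  congr 1
  funext x
  cases x <;> rfl

theorem inst_tren (r : TyRen) (t a : Tm) :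
    (t.sub (instSub a)).tren r = (t.tren r).sub (instSub (a.tren r)) := by
  simp only [tren_eq_tsub, inst_tsub]

theorem tsub_up_inst {κ : Kind} (s : TySub) (ψ : Ty κ) (t : Tm) :
    (t.tsub (s.up κ)).tsub (TySub.inst ψ) = t.tsub (TySub.cons ψ s) := by
  rw [tsub_tsub]
  congr 1
  funext κ' n
  by_cases h : κ' = κ
  · subst h
    cases n with
    | zero => simp [Ty.sub, TySub.inst_eq_cons]
    | succ n => rw [TySub.up_succ, TySub.cons_succ]; exact Ty.ren_shift_inst ψ _
  · rw [TySub.up_of_ne h, TySub.cons_of_ne h]; exact Ty.ren_shift_inst ψ _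

theorem tinst_tsub {κ : Kind} (s : TySub) (ψ : Ty κ) (t : Tm) :
    (t.tsub (TySub.inst ψ)).tsub s = (t.tsub (s.up κ)).tsub (TySub.inst (ψ.sub s)) := by
  rw [tsub_up_inst, tsub_tsub]
  congr 1
  funext κ' n
  by_cases h : κ' = κ
  · subst h; cases n <;> simp [TySub.inst_eq_cons, Ty.sub]
  · simp [TySub.inst_eq_cons, Ty.sub, h]

theorem tinst_tren {κ : Kind} (r : TyRen) (ψ : Ty κ) (t : Tm) :
    (t.tsub (TySub.inst ψ)).tren r = (t.tren (r.up κ)).tsub (TySub.inst (ψ.ren r)) := by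
  rw [tren_eq_tsub, tinst_tsub, TySub.up_var, ← tren_eq_tsub, ← Ty.ren_eq_sub]

theorem tren_shift_tsub_cons {κ : Kind} (ψ : Ty κ) (s : TySub) (t : Tm) :
    (t.tren (TyRen.shift κ)).tsub (TySub.cons ψ s) = t.tsub s := by
  rw [tsub_of_tren, TySub.cons_comp_shift]

theorem tren_shift_inst {κ : Kind} (ψ : Ty κ) (t : Tm) :
    (t.tren (TyRen.shift κ)).tsub (TySub.inst ψ) = t := by
  rw [TySub.inst_eq_cons, tren_shift_tsub_cons, tsub_var]

theorem tinst_sub {κ : Kind} (g : ℕ → Tm) (ψ : Ty κ) (t : Tm) :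
    (t.tsub (TySub.inst ψ)).sub g =
      (t.sub fun x => (g x).tren (TyRen.shift κ)).tsub (TySub.inst ψ) := by
  simp only [tsub_of_sub, tren_shift_inst]

theorem ren_succ_upSub (g : ℕ → Tm) (t : Tm) :
    (t.ren Nat.succ).sub (upSub g) = (t.sub g).ren Nat.succ := by
  rw [sub_of_ren, ren_of_sub]; rfl

theorem ren_succ_inst (t a : Tm) : (t.ren Nat.succ).sub (instSub a) = t := by
  rw [sub_of_ren]; exact sub_var t

theorem tren_shift_up (κ : Kind) (r : TyRen) (t : Tm) :
    (t.tren (TyRen.shift κ)).tren (r.up κ) = (t.tren r).tren (TyRen.shift κ) := by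
  simp only [tren_eq_tsub, ← TySub.up_var]
  simp only [← tren_eq_tsub (TyRen.shift κ), tren_shift_tsub_up]

theorem inst_var (t : Tm) (a : ℕ) :
    t.sub (instSub (var a)) = t.ren fun x => Nat.casesOn x a fun n => n := by
  rw [ren_eq_sub]
  congr 1
  funext x
  cases x <;> rfl

theorem tinst_var (t : Tm) (κ : Kind) (a : ℕ) :
    t.tsub (TySub.inst (Ty.var κ a)) = t.tren (TyRen.inst κ a) := by
  rw [tren_eq_tsub, TySub.inst_var]

/-! ### Free variables of terms -/

theorem Free.of_ren {r : ℕ → ℕ} {x : ℕ} {t : Tm} (h : (t.ren r).Free x) :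
    ∃ y, t.Free y ∧ r y = x := by
  induction t generalizing r x with
  | var y => exact ⟨y, rfl, h.symm⟩
  | sym => exact h.elim
  | lam _ _ ih =>
    obtain ⟨y, hy, e⟩ := ih h
    cases y with
    | zero => cases e
    | succ y => exact ⟨y, hy, Nat.succ.inj e⟩
  | tlam _ _ ih | tapp _ _ ih => exact ih h
  | app _ _ ih₁ ih₂ =>
    rcases h with h | h
    · obtain ⟨y, hy, e⟩ := ih₁ h; exact ⟨y, Or.inl hy, e⟩
    · obtain ⟨y, hy, e⟩ := ih₂ h; exact ⟨y, Or.inr hy, e⟩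

theorem free_tsub {s : TySub} {x : ℕ} {t : Tm} : (t.tsub s).Free x ↔ t.Free x := by
  induction t generalizing s x with
  | var | sym => rfl
  | lam _ _ ih | tlam _ _ ih | tapp _ _ ih => exact ih
  | app _ _ ih₁ ih₂ => exact or_congr ih₁ ih₂

theorem free_tren {r : TyRen} {x : ℕ} {t : Tm} : (t.tren r).Free x ↔ t.Free x := by
  rw [tren_eq_tsub, free_tsub]

theorem Free.of_sub {g : ℕ → Tm} {x : ℕ} {t : Tm} (h : (t.sub g).Free x) :
    ∃ y, t.Free y ∧ (g y).Free x := by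
  induction t generalizing g x with
  | var y => exact ⟨y, rfl, h⟩
  | sym => exact h.elim
  | lam _ _ ih =>
    obtain ⟨y, hy, e⟩ := ih h
    cases y with
    | zero => cases e
    | succ y =>
      obtain ⟨z, hz, e⟩ := Free.of_ren e
      cases e
      exact ⟨y, hy, hz⟩
  | tlam _ _ ih =>
    obtain ⟨y, hy, e⟩ := ih h
    exact ⟨y, hy, free_tren.1 e⟩
  | tapp _ _ ih => exact ih h
  | app _ _ ih₁ ih₂ =>
    rcases h with h | h
    · obtain ⟨y, hy, e⟩ := ih₁ h; exact ⟨y, Or.inl hy, e⟩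
    · obtain ⟨y, hy, e⟩ := ih₂ h; exact ⟨y, Or.inr hy, e⟩

theorem exists_free_bound (t : Tm) : ∃ B, ∀ x, t.Free x → x < B := by
  induction t with
  | var x => exact ⟨x + 1, fun y h => by cases h; omega⟩
  | sym => exact ⟨0, fun _ h => h.elim⟩
  | lam _ _ ih =>
    obtain ⟨B, h⟩ := ih
    exact ⟨B, fun x hx => by have := h _ hx; omega⟩
  | tlam _ _ ih | tapp _ _ ih => exact ih
  | app _ _ ih₁ ih₂ =>
    obtain ⟨B₁, h₁⟩ := ih₁
    obtain ⟨B₂, h₂⟩ := ih₂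
    exact ⟨max B₁ B₂, fun x h => lt_max_iff.2 (h.imp (h₁ x) (h₂ x))⟩

theorem tFree_ren {r : ℕ → ℕ} {κ : Kind} {a : ℕ} {t : Tm} :
    (t.ren r).TFree κ a ↔ t.TFree κ a := by
  induction t generalizing r a with
  | var | sym => rfl
  | lam _ _ ih => exact or_congr Iff.rfl ih
  | tlam _ _ ih => exact ih
  | tapp _ _ ih => exact or_congr ih Iff.rfl
  | app _ _ ih₁ ih₂ => exact or_congr ih₁ ih₂

theorem TFree.of_tren {r : TyRen} {κ : Kind} {a : ℕ} {t : Tm} (h : (t.tren r).TFree κ a) :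
    ∃ b, t.TFree κ b ∧ r κ b = a := by
  induction t generalizing r a with
  | var | sym => exact h.elim
  | lam _ _ ih =>
    rcases h with h | h
    · obtain ⟨b, hb, e⟩ := h.of_ren; exact ⟨b, Or.inl hb, e⟩
    · obtain ⟨b, hb, e⟩ := ih h; exact ⟨b, Or.inr hb, e⟩
  | tlam κ' _ ih =>
    obtain ⟨b, hb, e⟩ := ih h
    by_cases hk : κ = κ'
    · subst hk
      cases b with
      | zero => simp at e
      | succ b => exact ⟨b, by simpa [TFree] using hb, by simpa using e⟩
    · exact ⟨b, by simpa [TFree, Ne.symm hk] using hb, by simpa [hk, Ne.symm hk] using e⟩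
  | tapp _ _ ih =>
    rcases h with h | h
    · obtain ⟨b, hb, e⟩ := ih h; exact ⟨b, Or.inl hb, e⟩
    · obtain ⟨b, hb, e⟩ := h.of_ren; exact ⟨b, Or.inr hb, e⟩
  | app _ _ ih₁ ih₂ =>
    rcases h with h | h
    · obtain ⟨b, hb, e⟩ := ih₁ h; exact ⟨b, Or.inl hb, e⟩
    · obtain ⟨b, hb, e⟩ := ih₂ h; exact ⟨b, Or.inr hb, e⟩

theorem TFree.of_tsub {s : TySub} {κ : Kind} {a : ℕ} {t : Tm} (h : (t.tsub s).TFree κ a) :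
    ∃ κ' b, t.TFree κ' b ∧ (s κ' b).Free κ a := by
  induction t generalizing s a with
  | var | sym => exact h.elim
  | lam _ _ ih =>
    rcases h with h | h
    · obtain ⟨κ, b, hb, e⟩ := h.of_sub; exact ⟨κ, b, Or.inl hb, e⟩
    · obtain ⟨κ, b, hb, e⟩ := ih h; exact ⟨κ, b, Or.inr hb, e⟩
  | tlam κ₁ _ ih =>
    obtain ⟨κ', b, hb, e⟩ := ih h
    have key : ∀ {n}, ((s κ' n).ren (TyRen.shift κ₁)).Free κ (if κ₁ = κ then a + 1 else a) →
        (s κ' n).Free κ a := fun e => by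
      obtain ⟨c, hc, e⟩ := e.of_ren
      by_cases hk : κ = κ₁
      · subst hk; simp at e; exact e ▸ hc
      · simp [hk, Ne.symm hk] at e; exact e ▸ hc
    by_cases hk : κ' = κ₁
    · subst hk
      cases b with
      | zero =>
        exfalso
        simp only [TySub.up_zero] at e
        obtain ⟨rfl, e⟩ := e
        simp at e
      | succ b => exact ⟨κ', b, by simpa [TFree] using hb, key (by simpa using e)⟩
    · exact ⟨κ', b, by simpa [TFree, Ne.symm hk] using hb, key (by simpa [hk] using e)⟩
  | tapp _ _ ih =>
    rcases h with h | h
    · obtain ⟨κ, b, hb, e⟩ := ih h; exact ⟨κ, b, Or.inl hb, e⟩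
    · obtain ⟨κ, b, hb, e⟩ := h.of_sub; exact ⟨κ, b, Or.inr hb, e⟩
  | app _ _ ih₁ ih₂ =>
    rcases h with h | h
    · obtain ⟨κ, b, hb, e⟩ := ih₁ h; exact ⟨κ, b, Or.inl hb, e⟩
    · obtain ⟨κ, b, hb, e⟩ := ih₂ h; exact ⟨κ, b, Or.inr hb, e⟩

theorem TFree.of_tinst {κ κ₁ : Kind} {a : ℕ} {t : Tm} {ψ : Ty κ₁}
    (h : (t.tsub (TySub.inst ψ)).TFree κ a) :
    t.TFree κ (if κ₁ = κ then a + 1 else a) ∨ ψ.Free κ a := by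
  obtain ⟨κ', b, hb, h⟩ := h.of_tsub
  by_cases e : κ' = κ₁
  · subst e
    cases b with
    | zero => right; simpa [TySub.inst_eq_cons] using h
    | succ b =>
      simp [TySub.inst_eq_cons] at h
      obtain ⟨rfl, rfl⟩ := h
      left; simpa using hb
  · simp only [TySub.inst_eq_cons, TySub.cons_of_ne e] at h
    obtain ⟨rfl, rfl⟩ := h
    left; simpa [Ne.symm e] using hb

theorem TFree.of_sub {g : ℕ → Tm} {κ : Kind} {a : ℕ} {t : Tm} (h : (t.sub g).TFree κ a) :
    t.TFree κ a ∨ ∃ y, t.Free y ∧ (g y).TFree κ a := by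
  induction t generalizing g a with
  | var y => exact .inr ⟨y, rfl, h⟩
  | sym => exact h.elim
  | lam _ _ ih =>
    rcases h with h | h
    · exact .inl (.inl h)
    · rcases ih h with h | ⟨y, hy, h⟩
      · exact .inl (.inr h)
      · cases y with
        | zero => exact h.elim
        | succ y => exact .inr ⟨y, hy, tFree_ren.1 h⟩
  | tlam κ' _ ih =>
    rcases ih h with h | ⟨y, hy, h⟩
    · exact .inl h
    · obtain ⟨b, hb, e⟩ := h.of_tren
      right
      refine ⟨y, hy, ?_⟩
      by_cases hk : κ = κ'
      · subst hk; simp at e; exact e ▸ hb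
      · simp [hk, Ne.symm hk] at e; exact e ▸ hb
  | tapp _ _ ih =>
    rcases h with h | h
    · exact (ih h).imp Or.inl id
    · exact .inl (.inr h)
  | app _ _ ih₁ ih₂ =>
    rcases h with h | h
    · exact (ih₁ h).imp Or.inl fun ⟨y, hy, h⟩ => ⟨y, Or.inl hy, h⟩
    · exact (ih₂ h).imp Or.inr fun ⟨y, hy, h⟩ => ⟨y, Or.inr hy, h⟩

theorem exists_tFree_bound (t : Tm) : ∃ B, ∀ κ a, t.TFree κ a → a < B := by
  induction t with
  | var | sym => exact ⟨0, fun _ _ h => h.elim⟩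
  | lam σ _ ih =>
    obtain ⟨B₁, h₁⟩ := σ.exists_free_bound
    obtain ⟨B₂, h₂⟩ := ih
    exact ⟨max B₁ B₂, fun κ a h => lt_max_iff.2 (h.imp (h₁ κ a) (h₂ κ a))⟩
  | tlam κ₁ _ ih =>
    obtain ⟨B, h⟩ := ih
    refine ⟨B, fun κ a ha => ?_⟩
    have := h _ _ ha
    split at this <;> omega
  | tapp _ ψ ih =>
    obtain ⟨B₁, h₁⟩ := ih
    obtain ⟨B₂, h₂⟩ := ψ.exists_free_bound
    exact ⟨max B₁ B₂, fun κ a h => lt_max_iff.2 (h.imp (h₁ κ a) (h₂ κ a))⟩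
  | app _ _ ih₁ ih₂ =>
    obtain ⟨B₁, h₁⟩ := ih₁
    obtain ⟨B₂, h₂⟩ := ih₂
    exact ⟨max B₁ B₂, fun κ a h => lt_max_iff.2 (h.imp (h₁ κ a) (h₂ κ a))⟩

/-! ### Terms modulo conversion of types -/

namespace Equiv

theorem refl (t : Tm) : Equiv t t := by
  induction t with
  | var => exact .var _
  | sym => exact .sym _
  | lam _ _ ih => exact .lam .rfl ih
  | tlam _ _ ih => exact .tlam _ ih
  | app _ _ ih₁ ih₂ => exact .app ih₁ ih₂
  | tapp _ _ ih => exact .tapp ih .rfl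

theorem symm {s t : Tm} (h : Equiv s t) : Equiv t s := by
  induction h with
  | var => exact .var _
  | sym => exact .sym _
  | lam e _ ih => exact .lam e.symm ih
  | tlam _ _ ih => exact .tlam _ ih
  | app _ _ ih₁ ih₂ => exact .app ih₁ ih₂
  | tapp _ e ih => exact .tapp ih e.symm

theorem trans {s t u : Tm} (h : Equiv s t) (h' : Equiv t u) : Equiv s u := by
  induction h generalizing u with
  | var | sym => exact h'
  | lam e _ ih => cases h' with | lam e' h => exact .lam (e.trans e') (ih h)
  | tlam _ _ ih => cases h' with | tlam _ h => exact .tlam _ (ih h)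
  | app _ _ ih₁ ih₂ => cases h' with | app a b => exact .app (ih₁ a) (ih₂ b)
  | tapp _ e ih => cases h' with | tapp h e' => exact .tapp (ih h) (e.trans e')

theorem ren {s t : Tm} (h : Equiv s t) (r : ℕ → ℕ) : Equiv (s.ren r) (t.ren r) := by
  induction h generalizing r with
  | var => exact .var _
  | sym => exact .sym _
  | lam e _ ih => exact .lam e (ih _)
  | tlam _ _ ih => exact .tlam _ (ih _)
  | app _ _ ih₁ ih₂ => exact .app (ih₁ _) (ih₂ _)
  | tapp _ e ih => exact .tapp (ih _) e

theorem tsub {s t : Tm} (h : Equiv s t) (q : TySub) : Equiv (s.tsub q) (t.tsub q) := by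
  induction h generalizing q with
  | var => exact .var _
  | sym => exact .sym _
  | lam e _ ih => exact .lam (e.sub_left q) (ih _)
  | tlam _ _ ih => exact .tlam _ (ih _)
  | app _ _ ih₁ ih₂ => exact .app (ih₁ _) (ih₂ _)
  | tapp _ e ih => exact .tapp (ih _) (e.sub_left q)

theorem tren {s t : Tm} (h : Equiv s t) (q : TyRen) : Equiv (s.tren q) (t.tren q) := by
  simpa only [tren_eq_tsub] using h.tsub _

theorem sub {s t : Tm} (h : Equiv s t) {g g' : ℕ → Tm} (hg : ∀ x, Equiv (g x) (g' x)) :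
    Equiv (s.sub g) (t.sub g') := by
  induction h generalizing g g' with
  | var => exact hg _
  | sym => exact .sym _
  | lam e _ ih =>
    refine .lam e (ih fun x => ?_)
    cases x with
    | zero => exact .var _
    | succ x => exact (hg x).ren _
  | tlam _ _ ih => exact .tlam _ (ih fun x => (hg x).tren _)
  | app _ _ ih₁ ih₂ => exact .app (ih₁ hg) (ih₂ hg)
  | tapp _ e ih => exact .tapp (ih hg) e

end Equiv
end Tm

/-! ### Typing -/

/-- `f.Op op` : the symbol `f` is `⊕` or `⊗`, and `op` is its meaning on `ℕ`. -/
inductive Sym.Op : Sym → (ℕ → ℕ → ℕ) → Prop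
  | add : Sym.Op .add (· + ·)
  | mul : Sym.Op .mul (· * ·)

/-- `s ∘_ψ t` for a binary symbol `∘`. -/
abbrev Tm.bin (f : Sym) (ψ : Typ) (s t : Tm) : Tm := .app (.app (.tapp (.sym f) ψ) s) t

theorem Sym.Op.type {f : Sym} {op : ℕ → ℕ → ℕ} (h : f.Op op) :
    f.type = .all .star (.arr (.var .star 0) (.arr (.var .star 0) (.var .star 0))) := by
  cases h <;> rfl

namespace HasType

theorem of_var {Γ : Ctx} {x : ℕ} {τ : Typ} (h : HasType Γ (.var x) τ) : (Γ x).BetaEq τ := by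
  generalize e : Tm.var x = t at h
  induction h with
  | var => cases e; exact .rfl
  | conv _ e' ih => exact (ih e).trans e'
  | _ => cases e

theorem of_sym {Γ : Ctx} {f : Sym} {τ : Typ} (h : HasType Γ (.sym f) τ) : f.type.BetaEq τ := by
  generalize e : Tm.sym f = t at h
  induction h with
  | sym => cases e; exact .rfl
  | conv _ e' ih => exact (ih e).trans e'
  | _ => cases e

theorem of_lam {Γ : Ctx} {σ τ : Typ} {t : Tm} (h : HasType Γ (.lam σ t) τ) :
    ∃ τ', HasType (Γ.cons σ) t τ' ∧ (Ty.arr σ τ').BetaEq τ := by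
  generalize e : Tm.lam σ t = u at h
  induction h with
  | lam h => cases e; exact ⟨_, h, .rfl⟩
  | conv _ e' ih => obtain ⟨τ', h, h'⟩ := ih e; exact ⟨τ', h, h'.trans e'⟩
  | _ => cases e

theorem of_tlam {Γ : Ctx} {κ : Kind} {τ : Typ} {t : Tm} (h : HasType Γ (.tlam κ t) τ) :
    ∃ τ', HasType (fun x => (Γ x).ren (TyRen.shift κ)) t τ' ∧ (Ty.all κ τ').BetaEq τ := by
  generalize e : Tm.tlam κ t = u at h
  induction h with
  | tlam h => cases e; exact ⟨_, h, .rfl⟩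
  | conv _ e' ih => obtain ⟨τ', h, h'⟩ := ih e; exact ⟨τ', h, h'.trans e'⟩
  | _ => cases e

theorem of_app {Γ : Ctx} {τ : Typ} {s t : Tm} (h : HasType Γ (.app s t) τ) :
    ∃ σ, HasType Γ s (.arr σ τ) ∧ HasType Γ t σ := by
  generalize e : Tm.app s t = u at h
  induction h with
  | app h h' => cases e; exact ⟨_, h, h'⟩
  | conv _ e' ih => obtain ⟨σ, h, h'⟩ := ih e; exact ⟨σ, h.conv (Ty.BetaEq.rfl.arr e'), h'⟩
  | _ => cases e

theorem of_tapp {Γ : Ctx} {κ : Kind} {τ : Typ} {t : Tm} {ψ : Ty κ}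
    (h : HasType Γ (.tapp t ψ) τ) : ∃ τ', HasType Γ t (.all κ τ') ∧ (τ'.inst ψ).BetaEq τ := by
  generalize e : Tm.tapp t ψ = u at h
  induction h with
  | tapp _ h => cases e; exact ⟨_, h, .rfl⟩
  | conv _ e' ih => obtain ⟨τ', h, h'⟩ := ih e; exact ⟨τ', h, h'.trans e'⟩
  | _ => cases e

theorem of_tapp_sym {Γ : Ctx} {κ : Kind} {τ ρ : Typ} {f : Sym} {ψ : Ty κ}
    (h : HasType Γ (.tapp (.sym f) ψ) τ) (hf : f.type = .all κ ρ) : (ρ.inst ψ).BetaEq τ := by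
  obtain ⟨τ', h, h'⟩ := h.of_tapp
  have e := h.of_sym
  rw [hf] at e
  exact (e.all_inj.2.inst .rfl).trans h'

theorem of_bin {Γ : Ctx} {f : Sym} {op : ℕ → ℕ → ℕ} (hf : f.Op op) {ψ τ : Typ} {s t : Tm}
    (h : HasType Γ (.bin f ψ s t) τ) : HasType Γ s ψ ∧ HasType Γ t ψ ∧ ψ.BetaEq τ := by
  obtain ⟨σ₁, h, h₁⟩ := h.of_app
  obtain ⟨σ₂, h, h₂⟩ := h.of_app
  have e : (Ty.arr ψ (Ty.arr ψ ψ)).BetaEq _ := h.of_tapp_sym hf.type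
  obtain ⟨e₂, e⟩ := e.arr_inj
  obtain ⟨e₁, e⟩ := e.arr_inj
  exact ⟨h₂.conv e₂.symm, h₁.conv e₁.symm, e⟩

theorem bin {Γ : Ctx} {f : Sym} {op : ℕ → ℕ → ℕ} (hf : f.Op op) {ψ : Typ} {s t : Tm}
    (hs : HasType Γ s ψ) (ht : HasType Γ t ψ) : HasType Γ (.bin f ψ s t) ψ := by
  have h := HasType.sym Γ f
  rw [hf.type] at h
  have h' : HasType Γ (.tapp (.sym f) ψ) (.arr ψ (.arr ψ ψ)) := h.tapp ψ
  exact (h'.app hs).app ht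

theorem of_flatten {Γ : Ctx} {ψ τ : Typ} {t : Tm} (h : HasType Γ (.flatten ψ t) τ) :
    HasType Γ t ψ ∧ Ty.nat.BetaEq τ := by
  obtain ⟨σ₁, h, h₁⟩ := h.of_app
  have e : (Ty.arr ψ Ty.nat).BetaEq _ := h.of_tapp_sym rfl
  obtain ⟨e₁, e⟩ := e.arr_inj
  exact ⟨h₁.conv e₁.symm, e⟩

theorem flatten {Γ : Ctx} {ψ : Typ} {t : Tm} (h : HasType Γ t ψ) :
    HasType Γ (.flatten ψ t) .nat := by
  have h' : HasType Γ (.tapp (.sym .flatten) ψ) (.arr ψ .nat) := (HasType.sym Γ .flatten).tapp ψ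
  exact h'.app h

theorem of_lift {Γ : Ctx} {ψ τ : Typ} {t : Tm} (h : HasType Γ (.lift ψ t) τ) :
    HasType Γ t .nat ∧ ψ.BetaEq τ := by
  obtain ⟨σ₁, h, h₁⟩ := h.of_app
  have e : (Ty.arr Ty.nat ψ).BetaEq _ := h.of_tapp_sym rfl
  obtain ⟨e₁, e⟩ := e.arr_inj
  exact ⟨h₁.conv e₁.symm, e⟩

theorem lift {Γ : Ctx} (ψ : Typ) {t : Tm} (h : HasType Γ t .nat) :
    HasType Γ (.lift ψ t) ψ := by
  have h' : HasType Γ (.tapp (.sym .lift) ψ) (.arr .nat ψ) := (HasType.sym Γ .lift).tapp ψ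
  exact h'.app h

theorem num (Γ : Ctx) (n : ℕ) : HasType Γ (.num n) .nat := .sym Γ (.num n)

theorem ren {Γ Δ : Ctx} {t : Tm} {τ : Typ} (h : HasType Γ t τ) {r : ℕ → ℕ}
    (hr : ∀ z, t.Free z → (Γ z).BetaEq (Δ (r z))) : HasType Δ (t.ren r) τ := by
  induction h generalizing Δ r with
  | var Γ x => exact (HasType.var Δ (r x)).conv (hr x rfl).symm
  | sym => exact .sym _ _
  | lam _ ih =>
    refine .lam (ih fun z hz => ?_)
    cases z with
    | zero => exact .rfl
    | succ z => exact hr z hz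
  | tlam _ ih => exact .tlam (ih fun z hz => (hr z hz).ren _)
  | app _ _ ih₁ ih₂ =>
    exact (ih₁ fun z hz => hr z (Or.inl hz)).app (ih₂ fun z hz => hr z (Or.inr hz))
  | tapp ψ _ ih => exact (ih hr).tapp ψ
  | conv _ e ih => exact (ih hr).conv e

theorem ctx {Γ Δ : Ctx} {t : Tm} {τ : Typ} (h : HasType Γ t τ)
    (hr : ∀ z, t.Free z → (Γ z).BetaEq (Δ z)) : HasType Δ t τ := by
  simpa only [Tm.ren_id] using h.ren (r := fun x => x) hr

theorem tsub {Γ : Ctx} {t : Tm} {τ : Typ} (h : HasType Γ t τ) (s : TySub) :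
    HasType (fun x => (Γ x).sub s) (t.tsub s) (τ.sub s) := by
  induction h generalizing s with
  | var Γ x => exact .var (fun x => (Γ x).sub s) x
  | sym Γ f => cases f <;> exact .sym _ _
  | @lam Γ σ τ t _ ih =>
    refine .lam ?_
    have e : Ctx.cons (σ.sub s) (fun x => (Γ x).sub s) = fun x => (Γ.cons σ x).sub s := by
      funext x; cases x <;> rfl
    exact e ▸ ih s
  | @tlam Γ κ τ t _ ih =>
    refine .tlam ?_
    have e : (fun x => ((Γ x).sub s).ren (TyRen.shift κ)) =
        fun x => ((Γ x).ren (TyRen.shift κ)).sub (s.up κ) := by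
      funext x
      rw [Ty.ren_of_sub, Ty.sub_of_ren]
      congr 1
      funext κ' n
      by_cases h : κ' = κ
      · subst h; simp
      · simp [h]
    exact e ▸ ih _
  | app _ _ ih₁ ih₂ => exact (ih₁ s).app (ih₂ s)
  | tapp ψ _ ih => rw [Ty.inst_sub']; exact (ih s).tapp (ψ.sub s)
  | conv _ e ih => exact (ih s).conv (e.sub_left s)

theorem tren {Γ : Ctx} {t : Tm} {τ : Typ} (h : HasType Γ t τ) (r : TyRen) :
    HasType (fun x => (Γ x).ren r) (t.tren r) (τ.ren r) := by
  simp only [Ty.ren_eq_sub, Tm.tren_eq_tsub]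
  exact h.tsub _

theorem sub {Γ Δ : Ctx} {t : Tm} {τ : Typ} (h : HasType Γ t τ) {g : ℕ → Tm}
    (hg : ∀ z, t.Free z → HasType Δ (g z) (Γ z)) : HasType Δ (t.sub g) τ := by
  induction h generalizing Δ g with
  | var Γ x => exact hg x rfl
  | sym => exact .sym _ _
  | @lam Γ σ _ _ _ ih =>
    refine .lam (ih fun z hz => ?_)
    cases z with
    | zero => exact .var (Δ.cons σ) 0
    | succ z => exact (hg z hz).ren fun _ _ => .rfl
  | tlam _ ih => exact .tlam (ih fun z hz => (hg z hz).tren _)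
  | app _ _ ih₁ ih₂ =>
    exact (ih₁ fun z hz => hg z (Or.inl hz)).app (ih₂ fun z hz => hg z (Or.inr hz))
  | tapp ψ _ ih => exact (ih hg).tapp ψ
  | conv _ e ih => exact (ih hg).conv e

theorem inst {Γ : Ctx} {t a : Tm} {σ τ : Typ} (h : HasType (Γ.cons σ) t τ) (ha : HasType Γ a σ) :
    HasType Γ (t.sub (instSub a)) τ :=
  h.sub fun z _ => by
    cases z with
    | zero => exact ha
    | succ z => exact .var Γ z

theorem tinst {Γ : Ctx} {t : Tm} {κ : Kind} {τ : Typ}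
    (h : HasType (fun x => (Γ x).ren (TyRen.shift κ)) t τ) (ψ : Ty κ) :
    HasType Γ (t.tsub (TySub.inst ψ)) (τ.inst ψ) := by
  have := h.tsub (TySub.inst ψ)
  rwa [show (fun x => ((Γ x).ren (TyRen.shift κ)).sub (TySub.inst ψ)) = Γ from
    funext fun x => Ty.ren_shift_inst ψ (Γ x)] at this

theorem equiv {Γ : Ctx} {t t' : Tm} {τ : Typ} (h : HasType Γ t τ) (e : t.Equiv t') :
    HasType Γ t' τ := by
  induction h generalizing t' with
  | var Γ x => cases e; exact .var _ _
  | sym => cases e; exact .sym _ _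
  | lam _ ih =>
    cases e with
    | lam e h =>
      refine (HasType.lam ((ih h).ctx fun z _ => ?_)).conv (e.symm.arr .rfl)
      cases z with
      | zero => exact e
      | succ z => exact .rfl
  | tlam _ ih => cases e with | tlam _ h => exact .tlam (ih h)
  | app _ _ ih₁ ih₂ => cases e with | app a b => exact (ih₁ a).app (ih₂ b)
  | tapp ψ _ ih =>
    cases e with | tapp h e => exact ((ih h).tapp _).conv (Ty.BetaEq.rfl.inst e.symm)
  | conv _ e' ih => exact (ih e).conv e'

end HasType

/-! ### Closed terms -/

/-- The preterm has no free variables of either sort. -/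
def Tm.IsClosed (t : Tm) : Prop := (∀ x, ¬ t.Free x) ∧ ∀ κ a, ¬ t.TFree κ a

namespace Tm.IsClosed

theorem closed {t : Tm} (h : t.IsClosed) : t.Closed := ⟨t, .refl t, h⟩

theorem sub_eq {t : Tm} (h : t.IsClosed) (g : ℕ → Tm) : t.sub g = t := by
  rw [sub_congr (g' := Tm.var) t fun x hx => (h.1 x hx).elim, sub_var]

theorem hasType {t : Tm} (h : t.IsClosed) {Γ : Ctx} {τ : Typ} (ht : HasType Γ t τ) (Δ : Ctx) :
    HasType Δ t τ := ht.ctx fun x hx => (h.1 x hx).elim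

theorem app {s t : Tm} (hs : s.IsClosed) (ht : t.IsClosed) : (Tm.app s t).IsClosed :=
  ⟨fun x h => h.elim (hs.1 x) (ht.1 x), fun κ a h => h.elim (hs.2 κ a) (ht.2 κ a)⟩

theorem tapp {s : Tm} (hs : s.IsClosed) {κ : Kind} {ψ : Ty κ} (hψ : ψ.Closed) :
    (Tm.tapp s ψ).IsClosed :=
  ⟨fun x h => hs.1 x h, fun κ a h => h.elim (hs.2 κ a) (hψ κ a)⟩

theorem sym (f : Sym) : (Tm.sym f).IsClosed := ⟨fun _ h => h, fun _ _ h => h⟩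

theorem lift {σ : Typ} (hσ : σ.Closed) {t : Tm} (ht : t.IsClosed) : (Tm.lift σ t).IsClosed :=
  ((IsClosed.sym _).tapp hσ).app ht

theorem sub_of {t : Tm} (ht : ∀ κ a, ¬ t.TFree κ a) {g : ℕ → Tm} (hg : ∀ x, (g x).IsClosed) :
    (t.sub g).IsClosed :=
  ⟨fun x h => by obtain ⟨y, _, h⟩ := h.of_sub; exact (hg y).1 x h,
    fun κ a h => by
      rcases h.of_sub with h | ⟨y, _, h⟩
      · exact ht κ a h
      · exact (hg y).2 κ a h⟩

end Tm.IsClosed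
namespace Tm

/-! ### Contraction at the root -/

/-- The reduction rules at the root of a term, except the computation of `⊕` and `⊗` on numbers. A
rule that depends on the shape of a type index applies as soon as the index reduces to a type of
this shape; reduction is used here, not conversion, so that no free variables arise. -/
inductive Root : Tm → Tm → Prop
  | beta (σ : Typ) (s t : Tm) : Root (app (lam σ s) t) (s.sub (instSub t))
  | tbeta {κ : Kind} (s : Tm) (ψ : Ty κ) : Root (tapp (tlam κ s) ψ) (s.tsub (TySub.inst ψ))
  | op_arr {f : Sym} {op : ℕ → ℕ → ℕ} (hf : f.Op op) {ψ σ τ : Typ} (h : ψ.Reds (.arr σ τ))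
      (s t : Tm) : Root (bin f ψ s t)
        (lam σ (bin f τ (app (s.ren Nat.succ) (var 0)) (app (t.ren Nat.succ) (var 0))))
  | op_all {f : Sym} {op : ℕ → ℕ → ℕ} (hf : f.Op op) {ψ τ : Typ} {κ : Kind}
      (h : ψ.Reds (.all κ τ)) (s t : Tm) : Root (bin f ψ s t)
        (tlam κ (bin f τ (tapp (s.tren (TyRen.shift κ)) (Ty.var κ 0))
          (tapp (t.tren (TyRen.shift κ)) (Ty.var κ 0))))
  | flatten_nat {ψ : Typ} (h : ψ.Reds .nat) (s : Tm) : Root (flatten ψ s) s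
  | flatten_arr {ψ σ τ : Typ} (h : ψ.Reds (.arr σ τ)) (s : Tm) :
      Root (flatten ψ s) (flatten τ (app s (lift σ (num 0))))
  | flatten_all {ψ τ : Typ} {κ : Kind} (h : ψ.Reds (.all κ τ)) (s : Tm) :
      Root (flatten ψ s) (flatten (τ.inst (chi κ)) (tapp s (chi κ)))
  | lift_nat {ψ : Typ} (h : ψ.Reds .nat) (s : Tm) : Root (lift ψ s) s
  | lift_arr {ψ σ τ : Typ} (h : ψ.Reds (.arr σ τ)) (s : Tm) :
      Root (lift ψ s) (lam σ (lift τ (s.ren Nat.succ)))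
  | lift_all {ψ τ : Typ} {κ : Kind} (h : ψ.Reds (.all κ τ)) (s : Tm) :
      Root (lift ψ s) (tlam κ (lift τ (s.tren (TyRen.shift κ))))

namespace Root

theorem sub {s t : Tm} (h : Root s t) (g : ℕ → Tm) : Root (s.sub g) (t.sub g) := by
  cases h with
  | beta => rw [inst_sub]; exact .beta _ _ _
  | tbeta => rw [tinst_sub]; exact .tbeta _ _
  | op_arr hf h s t =>
    simpa only [Tm.sub, ren_succ_upSub] using .op_arr hf h (s.sub g) (t.sub g)
  | op_all hf h s t =>
    simpa only [Tm.sub, ← tren_of_sub] using .op_all hf h (s.sub g) (t.sub g)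
  | flatten_nat h => exact .flatten_nat h _
  | flatten_arr h => exact .flatten_arr h _
  | flatten_all h => exact .flatten_all h _
  | lift_nat h => exact .lift_nat h _
  | lift_arr h s => simpa only [Tm.lift, Tm.sub, ren_succ_upSub] using .lift_arr h (s.sub g)
  | lift_all h s => simpa only [Tm.lift, Tm.sub, ← tren_of_sub] using .lift_all h (s.sub g)

theorem tsub {s t : Tm} (h : Root s t) (q : TySub) : Root (s.tsub q) (t.tsub q) := by
  cases h with
  | beta => rw [inst_tsub]; exact .beta _ _ _
  | tbeta => rw [tinst_tsub]; exact .tbeta _ _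
  | op_arr hf h s t =>
    simpa only [Tm.tsub, tsub_of_ren] using .op_arr hf (h.sub q) (s.tsub q) (t.tsub q)
  | op_all hf h s t =>
    simpa only [Tm.tsub, tren_shift_tsub_up, Ty.sub, TySub.up_zero] using
      .op_all hf (h.sub q) (s.tsub q) (t.tsub q)
  | flatten_nat h => exact .flatten_nat (h.sub q) _
  | flatten_arr h => exact .flatten_arr (h.sub q) _
  | @flatten_all ψ τ κ h s =>
    have := Root.flatten_all (h.sub q) (s.tsub q)
    rw [show (Ty.sub (q.up κ) τ).inst (chi κ) = (τ.inst (chi κ)).sub q by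
      rw [Ty.inst_sub', (chi_closed κ).sub_eq]] at this
    simpa only [Tm.flatten, Tm.tsub, (chi_closed κ).sub_eq] using this
  | lift_nat h => exact .lift_nat (h.sub q) _
  | lift_arr h s => simpa only [Tm.lift, Tm.tsub, tsub_of_ren] using .lift_arr (h.sub q) (s.tsub q)
  | lift_all h s =>
    simpa only [Tm.lift, Tm.tsub, tren_shift_tsub_up] using .lift_all (h.sub q) (s.tsub q)

/-- Two contractions at the root differ only in the chosen reducts of the type index. -/
theorem unique {s t t' : Tm} (h : Root s t) (h' : Root s t') : Equiv t t' := by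
  cases h with
  | beta => cases h'; exact .refl _
  | tbeta => cases h'; exact .refl _
  | op_arr hf h s t =>
    cases h' with
    | op_arr _ h' =>
      obtain ⟨a, b⟩ := (h.betaEq.symm.trans h'.betaEq).arr_inj
      exact .lam a (.app (.app (.tapp (.refl _) b) (.refl _)) (.refl _))
    | op_all _ h' => exact (Ty.not_arr_betaEq_all (h.betaEq.symm.trans h'.betaEq)).elim
  | op_all hf h s t =>
    cases h' with
    | op_arr _ h' => exact (Ty.not_arr_betaEq_all (h'.betaEq.symm.trans h.betaEq)).elim
    | op_all _ h' =>
      obtain ⟨rfl, b⟩ := (h.betaEq.symm.trans h'.betaEq).all_inj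
      exact .tlam _ (.app (.app (.tapp (.refl _) b) (.refl _)) (.refl _))
  | flatten_nat h =>
    cases h' with
    | flatten_nat => exact .refl _
    | flatten_arr h' => exact (Ty.not_nat_betaEq_arr (h.betaEq.symm.trans h'.betaEq)).elim
    | flatten_all h' => exact (Ty.not_nat_betaEq_all (h.betaEq.symm.trans h'.betaEq)).elim
  | flatten_arr h =>
    cases h' with
    | flatten_nat h' => exact (Ty.not_nat_betaEq_arr (h'.betaEq.symm.trans h.betaEq)).elim
    | flatten_arr h' =>
      obtain ⟨a, b⟩ := (h.betaEq.symm.trans h'.betaEq).arr_inj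
      exact .app (.tapp (.refl _) b) (.app (.refl _) (.app (.tapp (.refl _) a) (.refl _)))
    | flatten_all h' => exact (Ty.not_arr_betaEq_all (h.betaEq.symm.trans h'.betaEq)).elim
  | flatten_all h =>
    cases h' with
    | flatten_nat h' => exact (Ty.not_nat_betaEq_all (h'.betaEq.symm.trans h.betaEq)).elim
    | flatten_arr h' => exact (Ty.not_arr_betaEq_all (h'.betaEq.symm.trans h.betaEq)).elim
    | flatten_all h' =>
      obtain ⟨rfl, b⟩ := (h.betaEq.symm.trans h'.betaEq).all_inj
      exact .app (.tapp (.refl _) (b.inst .rfl)) (.refl _)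
  | lift_nat h =>
    cases h' with
    | lift_nat => exact .refl _
    | lift_arr h' => exact (Ty.not_nat_betaEq_arr (h.betaEq.symm.trans h'.betaEq)).elim
    | lift_all h' => exact (Ty.not_nat_betaEq_all (h.betaEq.symm.trans h'.betaEq)).elim
  | lift_arr h =>
    cases h' with
    | lift_nat h' => exact (Ty.not_nat_betaEq_arr (h'.betaEq.symm.trans h.betaEq)).elim
    | lift_arr h' =>
      obtain ⟨a, b⟩ := (h.betaEq.symm.trans h'.betaEq).arr_inj
      exact .lam a (.app (.tapp (.refl _) b) (.refl _))
    | lift_all h' => exact (Ty.not_arr_betaEq_all (h.betaEq.symm.trans h'.betaEq)).elim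
  | lift_all h =>
    cases h' with
    | lift_nat h' => exact (Ty.not_nat_betaEq_all (h'.betaEq.symm.trans h.betaEq)).elim
    | lift_arr h' => exact (Ty.not_arr_betaEq_all (h'.betaEq.symm.trans h.betaEq)).elim
    | lift_all h' =>
      obtain ⟨rfl, b⟩ := (h.betaEq.symm.trans h'.betaEq).all_inj
      exact .tlam _ (.app (.tapp (.refl _) b) (.refl _))

end Root

/-- The reduction rules at the root of a term. -/
inductive Contract : Tm → Tm → Prop
  | root {s t : Tm} : Root s t → Contract s t
  | op_nat {f : Sym} {op : ℕ → ℕ → ℕ} (hf : f.Op op) {ψ : Typ} (h : ψ.BetaEq .nat) (n m : ℕ) :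
      Contract (bin f ψ (num n) (num m)) (num (op n m))

namespace Contract

theorem sub {s t : Tm} (h : Contract s t) (g : ℕ → Tm) : Contract (s.sub g) (t.sub g) := by
  cases h with
  | root h => exact .root (h.sub g)
  | op_nat hf h n m => exact .op_nat hf h n m

theorem ren {s t : Tm} (h : Contract s t) (r : ℕ → ℕ) : Contract (s.ren r) (t.ren r) := by
  simpa only [ren_eq_sub] using h.sub _

theorem tsub {s t : Tm} (h : Contract s t) (q : TySub) : Contract (s.tsub q) (t.tsub q) := by
  cases h with
  | root h => exact .root (h.tsub q)
  | op_nat hf h n m => exact .op_nat hf (h.sub_left q) n m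

theorem unique {s t t' : Tm} (h : Contract s t) (h' : Contract s t') : Equiv t t' := by
  cases h with
  | root h =>
    cases h' with
    | root h' => exact h.unique h'
    | op_nat _ e =>
      cases h with
      | op_arr _ h => exact (Ty.not_nat_betaEq_arr (e.symm.trans h.betaEq)).elim
      | op_all _ h => exact (Ty.not_nat_betaEq_all (e.symm.trans h.betaEq)).elim
  | op_nat hf e =>
    cases h' with
    | root h =>
      cases h with
      | op_arr _ h => exact (Ty.not_nat_betaEq_arr (e.symm.trans h.betaEq)).elim
      | op_all _ h => exact (Ty.not_nat_betaEq_all (e.symm.trans h.betaEq)).elim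
    | op_nat hf' => cases hf <;> cases hf' <;> exact .refl _

end Contract

/-! ### Confluence -/

/-- Parallel reduction. A root contraction is allowed after the reduction of the components, also
when the redex arises only from these; types are converted freely. -/
inductive Par : Tm → Tm → Prop
  | var (x : ℕ) : Par (var x) (var x)
  | sym (f : Sym) : Par (sym f) (sym f)
  | lam {σ σ' : Typ} {t t' : Tm} : σ.BetaEq σ' → Par t t' → Par (lam σ t) (lam σ' t')
  | tlam (κ : Kind) {t t' : Tm} : Par t t' → Par (tlam κ t) (tlam κ t')
  | app {s s' t t' : Tm} : Par s s' → Par t t' → Par (app s t) (app s' t')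
  | tapp {κ : Kind} {t t' : Tm} {ψ ψ' : Ty κ} :
      Par t t' → ψ.BetaEq ψ' → Par (tapp t ψ) (tapp t' ψ')
  | app_contract {s s' t t' u v : Tm} : Par s s' → Par t t' → Contract (app s' t') u →
      Equiv u v → Par (app s t) v
  | tapp_contract {κ : Kind} {t t' u v : Tm} {ψ ψ' : Ty κ} : Par t t' → ψ.BetaEq ψ' →
      Contract (tapp t' ψ') u → Equiv u v → Par (tapp t ψ) v

namespace Par

theorem refl (t : Tm) : Par t t := by
  induction t with
  | var => exact .var _
  | sym => exact .sym _
  | lam _ _ ih => exact .lam .rfl ih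
  | tlam _ _ ih => exact .tlam _ ih
  | app _ _ ih₁ ih₂ => exact .app ih₁ ih₂
  | tapp _ _ ih => exact .tapp ih .rfl

theorem equiv {s t u : Tm} (h : Par s t) (e : Equiv t u) : Par s u := by
  induction h generalizing u with
  | var => cases e; exact .var _
  | sym => cases e; exact .sym _
  | lam e' _ ih => cases e with | lam e h => exact .lam (e'.trans e) (ih h)
  | tlam _ _ ih => cases e with | tlam _ h => exact .tlam _ (ih h)
  | app _ _ ih₁ ih₂ => cases e with | app a b => exact .app (ih₁ a) (ih₂ b)
  | tapp _ e' ih => cases e with | tapp h e => exact .tapp (ih h) (e'.trans e)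
  | app_contract h₁ h₂ h e' _ _ => exact .app_contract h₁ h₂ h (e'.trans e)
  | tapp_contract h₁ e₁ h e' _ => exact .tapp_contract h₁ e₁ h (e'.trans e)

theorem of_equiv_left {s t u : Tm} (e : Equiv s t) (h : Par t u) : Par s u := by
  induction h generalizing s with
  | var => cases e; exact .var _
  | sym => cases e; exact .sym _
  | lam e' _ ih => cases e with | lam e h => exact .lam (e.trans e') (ih h)
  | tlam _ _ ih => cases e with | tlam _ h => exact .tlam _ (ih h)
  | app _ _ ih₁ ih₂ => cases e with | app a b => exact .app (ih₁ a) (ih₂ b)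
  | tapp _ e' ih => cases e with | tapp h e => exact .tapp (ih h) (e.trans e')
  | app_contract _ _ h e' ih₁ ih₂ =>
    cases e with | app a b => exact .app_contract (ih₁ a) (ih₂ b) h e'
  | tapp_contract _ e₁ h e' ih =>
    cases e with | tapp a e => exact .tapp_contract (ih a) (e.trans e₁) h e'

theorem tsub {s t : Tm} (h : Par s t) (q : TySub) : Par (s.tsub q) (t.tsub q) := by
  induction h generalizing q with
  | var => exact .var _
  | sym => exact .sym _
  | lam e _ ih => exact .lam (e.sub_left q) (ih _)
  | tlam _ _ ih => exact .tlam _ (ih _)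
  | app _ _ ih₁ ih₂ => exact .app (ih₁ _) (ih₂ _)
  | tapp _ e ih => exact .tapp (ih _) (e.sub_left q)
  | app_contract _ _ h e ih₁ ih₂ =>
    exact .app_contract (ih₁ q) (ih₂ q) (h.tsub q) (e.tsub q)
  | tapp_contract _ e' h e ih => exact .tapp_contract (ih q) (e'.sub_left q) (h.tsub q) (e.tsub q)

theorem tren {s t : Tm} (h : Par s t) (q : TyRen) : Par (s.tren q) (t.tren q) := by
  simpa only [tren_eq_tsub] using h.tsub _

theorem ren {s t : Tm} (h : Par s t) (r : ℕ → ℕ) : Par (s.ren r) (t.ren r) := by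
  induction h generalizing r with
  | var => exact .var _
  | sym => exact .sym _
  | lam e _ ih => exact .lam e (ih _)
  | tlam _ _ ih => exact .tlam _ (ih _)
  | app _ _ ih₁ ih₂ => exact .app (ih₁ _) (ih₂ _)
  | tapp _ e ih => exact .tapp (ih _) e
  | app_contract _ _ h e ih₁ ih₂ =>
    exact .app_contract (ih₁ r) (ih₂ r) (h.ren r) (e.ren r)
  | tapp_contract _ e' h e ih =>
    exact .tapp_contract (ih r) e' (h.ren r) (e.ren r)

theorem sub {s t : Tm} (h : Par s t) {g g' : ℕ → Tm} (hg : ∀ x, Par (g x) (g' x)) :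
    Par (s.sub g) (t.sub g') := by
  induction h generalizing g g' with
  | var => exact hg _
  | sym => exact .sym _
  | lam e _ ih =>
    refine .lam e (ih fun x => ?_)
    cases x with
    | zero => exact .var _
    | succ x => exact (hg x).ren _
  | tlam _ _ ih => exact .tlam _ (ih fun x => (hg x).tren _)
  | app _ _ ih₁ ih₂ => exact .app (ih₁ hg) (ih₂ hg)
  | tapp _ e ih => exact .tapp (ih hg) e
  | app_contract _ _ h e ih₁ ih₂ =>
    exact .app_contract (ih₁ hg) (ih₂ hg) (h.sub g') (e.sub fun _ => .refl _)
  | tapp_contract _ e' h e ih =>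
    exact .tapp_contract (ih hg) e' (h.sub g') (e.sub fun _ => .refl _)

theorem of_sym {f : Sym} {t : Tm} (h : Par (Tm.sym f) t) : t = .sym f := by cases h; rfl

theorem of_tapp_sym {f : Sym} {κ : Kind} {ψ : Ty κ} {t : Tm} (h : Par (.tapp (.sym f) ψ) t) :
    ∃ ψ', t = .tapp (.sym f) ψ' ∧ ψ.BetaEq ψ' := by
  cases h with
  | tapp h e => cases h.of_sym; exact ⟨_, rfl, e⟩
  | tapp_contract h _ h' _ =>
    cases h.of_sym
    cases h' with | root h' => cases h'

theorem of_bin_left {f : Sym} {op : ℕ → ℕ → ℕ} (hf : f.Op op) {ψ : Typ} {s t : Tm}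
    (h : Par (.app (.tapp (.sym f) ψ) s) t) :
    ∃ ψ' s', t = .app (.tapp (.sym f) ψ') s' ∧ ψ.BetaEq ψ' ∧ Par s s' := by
  cases h with
  | app h h' => obtain ⟨_, rfl, e⟩ := h.of_tapp_sym; exact ⟨_, _, rfl, e, h'⟩
  | app_contract h _ h' _ =>
    obtain ⟨_, rfl, e⟩ := h.of_tapp_sym
    cases h' with | root h' => cases h' <;> cases hf

theorem of_lam {σ : Typ} {s t : Tm} (h : Par (.lam σ s) t) :
    ∃ σ' s', t = .lam σ' s' ∧ σ.BetaEq σ' ∧ Par s s' := by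
  cases h with | lam e h => exact ⟨_, _, rfl, e, h⟩

theorem inst {s s' t t' : Tm} (hs : Par s s') (ht : Par t t') :
    Par (s.sub (instSub t)) (s'.sub (instSub t')) :=
  hs.sub fun x => by
    cases x with
    | zero => exact ht
    | succ x => exact .var x

theorem tinst {s s' : Tm} {κ : Kind} {ψ ψ' : Ty κ} (hs : Par s s') (e : ψ.BetaEq ψ') :
    Par (s.tsub (TySub.inst ψ)) (s'.tsub (TySub.inst ψ')) := by
  have key : ∀ {t : Tm} {q q' : TySub}, (∀ κ n, (q κ n).BetaEq (q' κ n)) →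
      Equiv (t.tsub q) (t.tsub q') := by
    intro t
    induction t with
    | var => exact fun _ => .refl _
    | sym => exact fun _ => .refl _
    | lam σ _ ih => exact fun h => .lam (.sub_right σ h) (ih h)
    | tlam κ _ ih =>
      intro q q' h
      refine .tlam _ (ih fun κ' n => ?_)
      by_cases e : κ' = κ
      · subst e
        cases n with
        | zero => simpa using .rfl
        | succ n => simpa using (h _ _).ren _
      · simpa [e] using (h _ _).ren _
    | app _ _ ih₁ ih₂ => exact fun h => .app (ih₁ h) (ih₂ h)
    | tapp _ ψ ih => exact fun h => .tapp (ih h) (.sub_right ψ h)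
  refine (hs.tsub _).equiv (key fun κ' n => ?_)
  by_cases h : κ' = κ
  · subst h
    cases n with
    | zero => simpa [TySub.inst_eq_cons] using e
    | succ n => simpa [TySub.inst_eq_cons] using .rfl
  · simpa [TySub.inst_eq_cons, h] using .rfl

theorem bin (f : Sym) {ψ ψ' : Typ} {s s' t t' : Tm} (e : ψ.BetaEq ψ') (hs : Par s s')
    (ht : Par t t') : Par (.bin f ψ s t) (.bin f ψ' s' t') :=
  .app (.app (.tapp (.sym f) e) hs) ht

theorem op {f : Sym} {ψ ψ' : Typ} {s s' : Tm} (e : ψ.BetaEq ψ') (hs : Par s s') :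
    Par (.app (.tapp (.sym f) ψ) s) (.app (.tapp (.sym f) ψ') s') := .app (.tapp (.sym f) e) hs

end Par

/-- A redex remains one when its components are reduced, and the contracta are again related. -/
theorem Contract.par_app {s s' t t' u : Tm} (h : Contract (app s t) u) (hs : Par s s')
    (ht : Par t t') : ∃ v, Contract (app s' t') v ∧ Par u v := by
  cases h with
  | root h =>
    cases h with
    | beta σ b =>
      obtain ⟨_, _, rfl, _, h⟩ := hs.of_lam
      exact ⟨_, .root (.beta _ _ _), h.inst ht⟩
    | op_arr hf h =>
      obtain ⟨_, _, rfl, e, hs⟩ := hs.of_bin_left hf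
      obtain ⟨_, _, h', a, b⟩ := (e.symm.trans h.betaEq).reds_arr
      exact ⟨_, .root (.op_arr hf h' _ _), .lam a.betaEq (.bin _ b.betaEq
        (.app (hs.ren _) (.var 0)) (.app (ht.ren _) (.var 0)))⟩
    | op_all hf h =>
      obtain ⟨_, _, rfl, e, hs⟩ := hs.of_bin_left hf
      obtain ⟨_, h', b⟩ := (e.symm.trans h.betaEq).reds_all
      exact ⟨_, .root (.op_all hf h' _ _), .tlam _ (.bin _ b.betaEq
        (.tapp (hs.tren _) .rfl) (.tapp (ht.tren _) .rfl))⟩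
    | flatten_nat h =>
      obtain ⟨_, rfl, e⟩ := hs.of_tapp_sym
      exact ⟨_, .root (.flatten_nat (e.symm.trans h.betaEq).reds_nat _), ht⟩
    | flatten_arr h =>
      obtain ⟨_, rfl, e⟩ := hs.of_tapp_sym
      obtain ⟨_, _, h', a, b⟩ := (e.symm.trans h.betaEq).reds_arr
      exact ⟨_, .root (.flatten_arr h' _), .op b.betaEq (.app ht (.op a.betaEq (.refl _)))⟩
    | flatten_all h =>
      obtain ⟨_, rfl, e⟩ := hs.of_tapp_sym
      obtain ⟨_, h', b⟩ := (e.symm.trans h.betaEq).reds_all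
      exact ⟨_, .root (.flatten_all h' _), .op (b.betaEq.inst .rfl) (.tapp ht .rfl)⟩
    | lift_nat h =>
      obtain ⟨_, rfl, e⟩ := hs.of_tapp_sym
      exact ⟨_, .root (.lift_nat (e.symm.trans h.betaEq).reds_nat _), ht⟩
    | lift_arr h =>
      obtain ⟨_, rfl, e⟩ := hs.of_tapp_sym
      obtain ⟨_, _, h', a, b⟩ := (e.symm.trans h.betaEq).reds_arr
      exact ⟨_, .root (.lift_arr h' _), .lam a.betaEq (.op b.betaEq (ht.ren _))⟩
    | lift_all h =>
      obtain ⟨_, rfl, e⟩ := hs.of_tapp_sym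
      obtain ⟨_, h', b⟩ := (e.symm.trans h.betaEq).reds_all
      exact ⟨_, .root (.lift_all h' _), .tlam _ (.op b.betaEq (ht.tren _))⟩
  | op_nat hf e n m =>
    obtain ⟨_, _, rfl, e', hs⟩ := hs.of_bin_left hf
    cases hs.of_sym
    cases ht.of_sym
    exact ⟨_, .op_nat hf (e'.symm.trans e) n m, .refl _⟩

theorem Contract.par_tapp {s s' u : Tm} {κ : Kind} {ψ ψ' : Ty κ} (h : Contract (tapp s ψ) u)
    (hs : Par s s') (e : ψ.BetaEq ψ') : ∃ v, Contract (tapp s' ψ') v ∧ Par u v := by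
  cases h with
  | root h =>
    cases h with
    | tbeta b => cases hs with | tlam _ h => exact ⟨_, .root (.tbeta _ _), h.tinst e⟩

/-- Every term has a complete development: a parallel reduct to which all its parallel reducts
reduce. -/
theorem Par.exists_development (t : Tm) : ∃ c, ∀ u, Par t u → Par u c := by
  induction t with
  | var x => exact ⟨_, fun _ h => by cases h; exact .var x⟩
  | sym f => exact ⟨_, fun _ h => by cases h; exact .sym f⟩
  | lam σ t ih =>
    obtain ⟨c, hc⟩ := ih
    exact ⟨.lam σ c, fun _ h => by cases h with | lam e h => exact .lam e.symm (hc _ h)⟩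
  | tlam κ t ih =>
    obtain ⟨c, hc⟩ := ih
    exact ⟨.tlam κ c, fun _ h => by cases h with | tlam _ h => exact .tlam _ (hc _ h)⟩
  | app s t ih₁ ih₂ =>
    obtain ⟨c, hc⟩ := ih₁
    obtain ⟨d, hd⟩ := ih₂
    by_cases H : ∃ v, Contract (.app c d) v
    · obtain ⟨v, hv⟩ := H
      refine ⟨v, fun _ h => ?_⟩
      cases h with
      | app a b => exact .app_contract (hc _ a) (hd _ b) hv (.refl _)
      | app_contract a b h e =>
        obtain ⟨w, hw, p⟩ := h.par_app (hc _ a) (hd _ b)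
        have p := p.equiv (hw.unique hv)
        exact Par.of_equiv_left e.symm p
    · refine ⟨.app c d, fun _ h => ?_⟩
      cases h with
      | app a b => exact .app (hc _ a) (hd _ b)
      | app_contract a b h e =>
        obtain ⟨w, hw, p⟩ := h.par_app (hc _ a) (hd _ b)
        exact (H ⟨w, hw⟩).elim
  | tapp t ψ ih =>
    obtain ⟨c, hc⟩ := ih
    by_cases H : ∃ v, Contract (.tapp c ψ) v
    · obtain ⟨v, hv⟩ := H
      refine ⟨v, fun _ h => ?_⟩
      cases h with
      | tapp a e => exact .tapp_contract (hc _ a) e.symm hv (.refl _)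
      | tapp_contract a e' h e =>
        obtain ⟨w, hw, p⟩ := h.par_tapp (hc _ a) e'.symm
        have p := p.equiv (hw.unique hv)
        exact Par.of_equiv_left e.symm p
    · refine ⟨.tapp c ψ, fun _ h => ?_⟩
      cases h with
      | tapp a e => exact .tapp (hc _ a) e.symm
      | tapp_contract a e' h e =>
        obtain ⟨w, hw, p⟩ := h.par_tapp (hc _ a) e'.symm
        exact (H ⟨w, hw⟩).elim

theorem Par.join {s t u : Tm} (h₁ : Relation.ReflTransGen Par s t)
    (h₂ : Relation.ReflTransGen Par s u) :
    ∃ v, Relation.ReflTransGen Par t v ∧ Relation.ReflTransGen Par u v :=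
  Relation.church_rosser (fun a b c hb hc => by
    obtain ⟨d, hd⟩ := Par.exists_development a
    exact ⟨d, .single (hd _ hb), .single (hd _ hc)⟩) h₁ h₂

theorem Contract.par {s t : Tm} (h : Contract s t) : Par s t := by
  have app : ∀ {s t u}, Contract (.app s t) u → Par (.app s t) u := fun h =>
    .app_contract (.refl _) (.refl _) h (.refl _)
  cases h with
  | op_nat hf e n m => exact app (.op_nat hf e n m)
  | root h =>
    cases h with
    | tbeta => exact .tapp_contract (.refl _) .rfl (.root (.tbeta _ _)) (.refl _)
    | beta => exact app (.root (.beta _ _ _))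
    | op_arr hf h => exact app (.root (.op_arr hf h _ _))
    | op_all hf h => exact app (.root (.op_all hf h _ _))
    | flatten_nat h => exact app (.root (.flatten_nat h _))
    | flatten_arr h => exact app (.root (.flatten_arr h _))
    | flatten_all h => exact app (.root (.flatten_all h _))
    | lift_nat h => exact app (.root (.lift_nat h _))
    | lift_arr h => exact app (.root (.lift_arr h _))
    | lift_all h => exact app (.root (.lift_all h _))

theorem Step.par {s t : Tm} (h : Step s t) : Par s t := by
  induction h with
  | lam _ _ ih => exact .lam .rfl ih
  | tlam _ _ ih => exact .tlam _ ih
  | appR _ _ ih => exact .app (.refl _) ih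
  | appL _ _ ih => exact .app ih (.refl _)
  | tapp _ _ ih => exact .tapp ih .rfl
  | beta => exact (Contract.root (.beta _ _ _)).par
  | tbeta => exact (Contract.root (.tbeta _ _)).par
  | add_nat n m => exact (Contract.op_nat .add .rfl n m).par
  | mul_nat n m => exact (Contract.op_nat .mul .rfl n m).par
  | add_arr => exact (Contract.root (.op_arr .add .refl _ _)).par
  | mul_arr => exact (Contract.root (.op_arr .mul .refl _ _)).par
  | add_all => exact (Contract.root (.op_all .add .refl _ _)).par
  | mul_all => exact (Contract.root (.op_all .mul .refl _ _)).par
  | flatten_nat => exact (Contract.root (.flatten_nat .refl _)).par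
  | flatten_arr => exact (Contract.root (.flatten_arr .refl _)).par
  | flatten_all => exact (Contract.root (.flatten_all .refl _)).par
  | lift_nat => exact (Contract.root (.lift_nat .refl _)).par
  | lift_arr => exact (Contract.root (.lift_arr .refl _)).par
  | lift_all => exact (Contract.root (.lift_all .refl _)).par

theorem HasNF.num_unique {t : Tm} {n m : ℕ} (hn : t.HasNF (num n)) (hm : t.HasNF (num m)) :
    n = m := by
  have key : ∀ {v}, Relation.ReflTransGen Red t v → Relation.ReflTransGen Par t v := fun h => by
    induction h with
    | refl => exact .refl
    | tail _ h ih =>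
      obtain ⟨_, _, e, h, e'⟩ := h
      exact ih.tail (.of_equiv_left e (h.par.equiv e'))
  have eq_num : ∀ {n v}, Relation.ReflTransGen Par (num n) v → v = num n := fun h => by
    induction h with
    | refl => rfl
    | tail _ h ih => subst ih; exact h.of_sym
  obtain ⟨v, h₁, h₂⟩ := Par.join (key hn.1) (key hm.1)
  have := (eq_num h₁).symm.trans (eq_num h₂)
  simpa [num] using this

/-! ### Weak head reduction -/

/-- Weak head reduction, without the computation of `⊕` and `⊗` on numbers. -/
inductive HStep : Tm → Tm → Prop
  | root {s t : Tm} : Root s t → HStep s t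
  | appL {s s' : Tm} (t : Tm) : HStep s s' → HStep (app s t) (app s' t)
  | tappL {s s' : Tm} {κ : Kind} (ψ : Ty κ) : HStep s s' → HStep (tapp s ψ) (tapp s' ψ)

theorem HStep.sub {s t : Tm} (h : HStep s t) (g : ℕ → Tm) : HStep (s.sub g) (t.sub g) := by
  induction h with
  | root h => exact .root (h.sub g)
  | appL _ _ ih => exact .appL _ ih
  | tappL _ _ ih => exact .tappL _ ih

/-- The head of the term is not a variable. -/
inductive Rigid : Tm → Prop
  | sym (f : Sym) : Rigid (sym f)
  | lam (σ : Typ) (t : Tm) : Rigid (lam σ t)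
  | tlam (κ : Kind) (t : Tm) : Rigid (tlam κ t)
  | app {s : Tm} (t : Tm) : Rigid s → Rigid (app s t)
  | tapp {s : Tm} {κ : Kind} (ψ : Ty κ) : Rigid s → Rigid (tapp s ψ)

namespace Rigid

theorem of_ren {r : ℕ → ℕ} {t : Tm} (h : Rigid (t.ren r)) : Rigid t := by
  induction t with
  | var => cases h
  | sym => exact .sym _
  | lam => exact .lam _ _
  | tlam => exact .tlam _ _
  | app _ _ ih => cases h with | app _ h => exact .app _ (ih h)
  | tapp _ _ ih => cases h with | tapp _ h => exact .tapp _ (ih h)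

theorem sub_eq_sym {t : Tm} (h : Rigid t) {g : ℕ → Tm} {f : Sym} (e : t.sub g = .sym f) :
    t = .sym f := by
  cases h with
  | sym => exact e
  | _ => cases e

theorem sub_eq_tapp {t : Tm} (h : Rigid t) {g : ℕ → Tm} {s' : Tm} {κ : Kind} {ψ : Ty κ}
    (e : t.sub g = .tapp s' ψ) : ∃ s, t = .tapp s ψ ∧ Rigid s ∧ s.sub g = s' := by
  cases h with
  | tapp _ h => cases e; exact ⟨_, rfl, h, rfl⟩
  | _ => cases e

theorem sub_eq_app {t : Tm} (h : Rigid t) {g : ℕ → Tm} {s' u' : Tm}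
    (e : t.sub g = .app s' u') : ∃ s u, t = .app s u ∧ Rigid s ∧ s.sub g = s' ∧ u.sub g = u' := by
  cases h with
  | app _ h => cases e; exact ⟨_, _, rfl, h, rfl, rfl⟩
  | _ => cases e

theorem sub_eq_tapp_sym {t : Tm} (h : Rigid t) {g : ℕ → Tm} {f : Sym} {κ : Kind} {ψ : Ty κ}
    (e : t.sub g = .tapp (.sym f) ψ) : t = .tapp (.sym f) ψ := by
  replace e := h.sub_eq_tapp e
  obtain ⟨s, rfl, h, e⟩ := e
  cases h.sub_eq_sym e
  rfl

theorem sub_eq_bin {t : Tm} (h : Rigid t) {g : ℕ → Tm} {f : Sym} {ψ : Typ} {a' b' : Tm}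
    (e : t.sub g = .bin f ψ a' b') : ∃ a b, t = .bin f ψ a b ∧ a.sub g = a' ∧ b.sub g = b' := by
  replace e := h.sub_eq_app e
  obtain ⟨s, b, rfl, h, e, hb⟩ := e
  replace e := h.sub_eq_app e
  obtain ⟨s, a, rfl, h, e, ha⟩ := e
  cases h.sub_eq_tapp_sym e
  exact ⟨_, _, rfl, ha, hb⟩

end Rigid

theorem HStep.rigid {s t : Tm} (h : HStep s t) : Rigid s := by
  induction h with
  | root h => cases h <;> repeat constructor
  | appL _ _ ih => exact .app _ ih
  | tappL _ _ ih => exact .tapp _ ih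

/-- A root contraction in an instance of a rigid term comes from the term itself. -/
theorem Root.of_sub {s u : Tm} {g : ℕ → Tm} (h : Root (s.sub g) u) (hs : Rigid s) :
    ∃ t, Root s t ∧ t.sub g = u := by
  generalize e : s.sub g = s' at h
  cases h with
  | beta σ b a =>
    replace e := hs.sub_eq_app e
    obtain ⟨s, a, rfl, hs, e, rfl⟩ := e
    cases hs <;> cases e
    exact ⟨_, .beta _ _ _, by rw [inst_sub]⟩
  | tbeta b ψ =>
    replace e := hs.sub_eq_tapp e
    obtain ⟨s, rfl, hs, e⟩ := e
    cases hs <;> cases e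
    exact ⟨_, .tbeta _ _, by rw [tinst_sub]⟩
  | op_arr hf h =>
    obtain ⟨a, b, rfl, rfl, rfl⟩ := hs.sub_eq_bin e
    exact ⟨_, .op_arr hf h _ _, by simp only [Tm.sub, ren_succ_upSub]; rfl⟩
  | op_all hf h =>
    obtain ⟨a, b, rfl, rfl, rfl⟩ := hs.sub_eq_bin e
    exact ⟨_, .op_all hf h _ _, by simp only [Tm.sub, ← tren_of_sub]⟩
  | flatten_nat h =>
    replace e := hs.sub_eq_app e
    obtain ⟨_, b, rfl, hs, e, rfl⟩ := e
    cases hs.sub_eq_tapp_sym e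
    exact ⟨_, .flatten_nat h _, rfl⟩
  | flatten_arr h =>
    replace e := hs.sub_eq_app e
    obtain ⟨_, b, rfl, hs, e, rfl⟩ := e
    cases hs.sub_eq_tapp_sym e
    exact ⟨_, .flatten_arr h _, rfl⟩
  | flatten_all h =>
    replace e := hs.sub_eq_app e
    obtain ⟨_, b, rfl, hs, e, rfl⟩ := e
    cases hs.sub_eq_tapp_sym e
    exact ⟨_, .flatten_all h _, rfl⟩
  | lift_nat h =>
    replace e := hs.sub_eq_app e
    obtain ⟨_, b, rfl, hs, e, rfl⟩ := e
    cases hs.sub_eq_tapp_sym e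
    exact ⟨_, .lift_nat h _, rfl⟩
  | lift_arr h =>
    replace e := hs.sub_eq_app e
    obtain ⟨_, b, rfl, hs, e, rfl⟩ := e
    cases hs.sub_eq_tapp_sym e
    exact ⟨_, .lift_arr h _, by simp only [Tm.lift, Tm.sub, ren_succ_upSub]⟩
  | lift_all h =>
    replace e := hs.sub_eq_app e
    obtain ⟨_, b, rfl, hs, e, rfl⟩ := e
    cases hs.sub_eq_tapp_sym e
    exact ⟨_, .lift_all h _, by simp only [Tm.lift, Tm.sub, ← tren_of_sub]⟩

theorem HStep.of_sub {s u : Tm} {g : ℕ → Tm} (h : HStep (s.sub g) u) (hs : Rigid s) :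
    ∃ t, HStep s t ∧ t.sub g = u := by
  generalize e : s.sub g = s' at h
  induction h generalizing s with
  | root h =>
    subst e
    obtain ⟨t, h, e⟩ := h.of_sub hs
    exact ⟨t, .root h, e⟩
  | appL _ _ ih =>
    replace e := hs.sub_eq_app e
    obtain ⟨s, b, rfl, hs, e, rfl⟩ := e
    obtain ⟨t, h, rfl⟩ := ih hs e
    exact ⟨_, .appL _ h, rfl⟩
  | tappL _ _ ih =>
    replace e := hs.sub_eq_tapp e
    obtain ⟨s, rfl, hs, e⟩ := e
    obtain ⟨t, h, rfl⟩ := ih hs e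
    exact ⟨_, .tappL _ h, rfl⟩

theorem HStep.of_ren {s u : Tm} {r : ℕ → ℕ} (h : HStep (s.ren r) u) :
    ∃ t, HStep s t ∧ t.ren r = u := by
  have hs := h.rigid.of_ren
  rw [ren_eq_sub] at h
  obtain ⟨t, h, e⟩ := h.of_sub hs
  exact ⟨t, h, by rw [ren_eq_sub, e]⟩

theorem tren_eq_tapp {t s' : Tm} {q : TyRen} {κ : Kind} {ψ' : Ty κ} (e : t.tren q = .tapp s' ψ') :
    ∃ s ψ, t = .tapp s ψ ∧ s.tren q = s' ∧ ψ.ren q = ψ' := by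
  cases t <;> cases e
  exact ⟨_, _, rfl, rfl, rfl⟩

theorem tren_eq_app {t s' u' : Tm} {q : TyRen} (e : t.tren q = .app s' u') :
    ∃ s u, t = .app s u ∧ s.tren q = s' ∧ u.tren q = u' := by
  cases t <;> cases e
  exact ⟨_, _, rfl, rfl, rfl⟩

theorem tren_eq_sym {t : Tm} {f : Sym} {q : TyRen} (e : t.tren q = .sym f) : t = .sym f := by
  cases t <;> cases e
  rfl

theorem tren_eq_op {t : Tm} {q : TyRen} {f : Sym} {ψ' : Typ} {a' : Tm}
    (e : t.tren q = .app (.tapp (.sym f) ψ') a') :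
    ∃ ψ a, t = .app (.tapp (.sym f) ψ) a ∧ ψ.ren q = ψ' ∧ a.tren q = a' := by
  replace e := tren_eq_app e
  obtain ⟨_, a, rfl, e, ha⟩ := e
  replace e := tren_eq_tapp e
  obtain ⟨_, ψ, rfl, e, hψ⟩ := e
  cases tren_eq_sym e
  exact ⟨_, _, rfl, hψ, ha⟩

theorem tren_eq_bin {t : Tm} {q : TyRen} {f : Sym} {ψ' : Typ} {a' b' : Tm}
    (e : t.tren q = .bin f ψ' a' b') :
    ∃ ψ a b, t = .bin f ψ a b ∧ ψ.ren q = ψ' ∧ a.tren q = a' ∧ b.tren q = b' := by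
  replace e := tren_eq_app e
  obtain ⟨_, b, rfl, e, hb⟩ := e
  obtain ⟨_, a, rfl, hψ, ha⟩ := tren_eq_op e
  exact ⟨_, _, _, rfl, hψ, ha, hb⟩

theorem Root.of_tren {s u : Tm} {q : TyRen} (h : Root (s.tren q) u) :
    ∃ t, Root s t ∧ t.tren q = u := by
  have arr : ∀ {ψ σ' τ' : Typ}, (ψ.ren q).Reds (.arr σ' τ') →
      ∃ σ τ, ψ.Reds (.arr σ τ) ∧ σ.ren q = σ' ∧ τ.ren q = τ' := fun h => by
    replace h := h.of_ren
    obtain ⟨φ, h, e⟩ := h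
    cases φ <;> cases e
    exact ⟨_, _, h, rfl, rfl⟩
  have all : ∀ {ψ τ' : Typ} {κ : Kind}, (ψ.ren q).Reds (.all κ τ') →
      ∃ τ, ψ.Reds (.all κ τ) ∧ τ.ren (q.up κ) = τ' := fun h => by
    replace h := h.of_ren
    obtain ⟨φ, h, e⟩ := h
    cases φ <;> cases e
    exact ⟨_, h, rfl⟩
  have nat : ∀ {ψ : Typ}, (ψ.ren q).Reds .nat → ψ.Reds .nat := fun h => by
    replace h := h.of_ren
    obtain ⟨φ, h, e⟩ := h
    cases φ <;> cases e
    exact h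
  generalize e : s.tren q = s' at h
  cases h with
  | beta σ b a =>
    replace e := tren_eq_app e
    obtain ⟨s, a, rfl, e, rfl⟩ := e
    cases s <;> cases e
    exact ⟨_, .beta _ _ _, by rw [inst_tren]⟩
  | tbeta b ψ =>
    replace e := tren_eq_tapp e
    obtain ⟨s, ψ, rfl, e, rfl⟩ := e
    cases s <;> cases e
    exact ⟨_, .tbeta _ _, by rw [tinst_tren]⟩
  | op_arr hf h =>
    obtain ⟨ψ, a, b, rfl, rfl, rfl, rfl⟩ := tren_eq_bin e
    replace h := arr h
    obtain ⟨σ, τ, h, rfl, rfl⟩ := h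
    exact ⟨_, .op_arr hf h _ _, by simp only [Tm.tren, tren_of_ren]⟩
  | op_all hf h =>
    obtain ⟨ψ, a, b, rfl, rfl, rfl, rfl⟩ := tren_eq_bin e
    replace h := all h
    obtain ⟨τ, h, rfl⟩ := h
    exact ⟨_, .op_all hf h _ _, by simp [Tm.tren, Ty.ren, tren_shift_up]⟩
  | flatten_nat h =>
    obtain ⟨ψ, a, rfl, rfl, rfl⟩ := tren_eq_op e
    exact ⟨_, .flatten_nat (nat h) _, rfl⟩
  | flatten_arr h =>
    obtain ⟨ψ, a, rfl, rfl, rfl⟩ := tren_eq_op e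
    replace h := arr h
    obtain ⟨σ, τ, h, rfl, rfl⟩ := h
    exact ⟨_, .flatten_arr h _, rfl⟩
  | flatten_all h =>
    obtain ⟨ψ, a, rfl, rfl, rfl⟩ := tren_eq_op e
    replace h := all h
    obtain ⟨τ, h, rfl⟩ := h
    exact ⟨_, .flatten_all h _, by
      simp only [Tm.flatten, Tm.tren, Ty.inst_ren, (chi_closed _).ren_eq]⟩
  | lift_nat h =>
    obtain ⟨ψ, a, rfl, rfl, rfl⟩ := tren_eq_op e
    exact ⟨_, .lift_nat (nat h) _, rfl⟩
  | lift_arr h =>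
    obtain ⟨ψ, a, rfl, rfl, rfl⟩ := tren_eq_op e
    replace h := arr h
    obtain ⟨σ, τ, h, rfl, rfl⟩ := h
    exact ⟨_, .lift_arr h _, by simp only [Tm.lift, Tm.tren, tren_of_ren]⟩
  | lift_all h =>
    obtain ⟨ψ, a, rfl, rfl, rfl⟩ := tren_eq_op e
    replace h := all h
    obtain ⟨τ, h, rfl⟩ := h
    exact ⟨_, .lift_all h _, by simp only [Tm.lift, Tm.tren, tren_shift_up]⟩

theorem HStep.of_tren {s u : Tm} {q : TyRen} (h : HStep (s.tren q) u) :
    ∃ t, HStep s t ∧ t.tren q = u := by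
  generalize e : s.tren q = s' at h
  induction h generalizing s with
  | root h =>
    subst e
    obtain ⟨t, h, e⟩ := h.of_tren
    exact ⟨t, .root h, e⟩
  | appL _ _ ih =>
    replace e := tren_eq_app e
    obtain ⟨s, b, rfl, e, rfl⟩ := e
    obtain ⟨t, h, rfl⟩ := ih e
    exact ⟨_, .appL _ h, rfl⟩
  | tappL _ _ ih =>
    replace e := tren_eq_tapp e
    obtain ⟨s, _, rfl, e, rfl⟩ := e
    obtain ⟨t, h, rfl⟩ := ih e
    exact ⟨_, .tappL _ h, rfl⟩

/-! ### Terms with a normalizing strategy -/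

/-- The terms that a normalizing strategy, which performs weak head reduction first, brings to a
normal form; with `b = true`, those for which an application of the result to arguments creates no
redex. -/
inductive Norm : Bool → Tm → Prop
  | var (b : Bool) (x : ℕ) : Norm b (var x)
  | app (b : Bool) {s t : Tm} : Norm true s → Norm false t → Norm b (app s t)
  | tapp (b : Bool) {s : Tm} {κ : Kind} (ψ : Ty κ) : Norm true s → Norm b (tapp s ψ)
  | op_neutral (b : Bool) {f : Sym} {op : ℕ → ℕ → ℕ} (hf : f.Op op) {ψ ν : Typ} {s t : Tm} :
      ψ.Reds ν → ν.Neutral → Norm false s → Norm false t → Norm b (bin f ψ s t)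
  | flatten_neutral (b : Bool) {ψ ν : Typ} {s : Tm} :
      ψ.Reds ν → ν.Neutral → Norm false s → Norm b (flatten ψ s)
  | lift_neutral (b : Bool) {ψ ν : Typ} {s : Tm} :
      ψ.Reds ν → ν.Neutral → Norm false s → Norm b (lift ψ s)
  | sym (f : Sym) : Norm false (sym f)
  | tapp_sym (f : Sym) {κ : Kind} (ψ : Ty κ) : Norm false (tapp (sym f) ψ)
  | op_left {f : Sym} {op : ℕ → ℕ → ℕ} (hf : f.Op op) (ψ : Typ) {s : Tm} :
      Norm false s → Norm false (app (tapp (sym f) ψ) s)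
  | op_nat {f : Sym} {op : ℕ → ℕ → ℕ} (hf : f.Op op) {ψ : Typ} {s t : Tm} :
      ψ.Reds .nat → Norm false s → Norm false t → Norm false (bin f ψ s t)
  | lam (σ : Typ) {t : Tm} : Norm false t → Norm false (lam σ t)
  | tlam (κ : Kind) {t : Tm} : Norm false t → Norm false (tlam κ t)
  | exp {t t' : Tm} : HStep t t' → Norm false t' → Norm false t

theorem Norm.weaken {b : Bool} {t : Tm} (h : Norm b t) : Norm false t := by
  cases h with
  | var => exact .var _ _
  | app _ h₁ h₂ => exact .app _ h₁ h₂
  | tapp _ _ h => exact .tapp _ _ h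
  | op_neutral _ hf h₁ h₂ h₃ h₄ => exact .op_neutral _ hf h₁ h₂ h₃ h₄
  | flatten_neutral _ h₁ h₂ h₃ => exact .flatten_neutral _ h₁ h₂ h₃
  | lift_neutral _ h₁ h₂ h₃ => exact .lift_neutral _ h₁ h₂ h₃
  | sym => exact .sym _
  | tapp_sym => exact .tapp_sym _ _
  | op_left hf _ h => exact .op_left hf _ h
  | op_nat hf h₁ h₂ h₃ => exact .op_nat hf h₁ h₂ h₃
  | lam _ h => exact .lam _ h
  | tlam _ h => exact .tlam _ h
  | exp h h' => exact .exp h h'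

theorem Norm.of_tren {b : Bool} {t : Tm} {q : TyRen} (h : Norm b (t.tren q)) : Norm b t := by
  have neutral : ∀ {ψ ν' : Typ}, (ψ.ren q).Reds ν' → ν'.Neutral →
      ∃ ν, ψ.Reds ν ∧ ν.Neutral := fun h hn => by
    replace h := h.of_ren
    obtain ⟨φ, h, rfl⟩ := h
    exact ⟨φ, h, hn.of_ren⟩
  generalize e : t.tren q = t' at h
  induction h generalizing t q with
  | var => cases t <;> cases e; exact .var _ _
  | app _ _ _ ih₁ ih₂ => cases t <;> cases e; exact .app _ (ih₁ neutral rfl) (ih₂ neutral rfl)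
  | tapp _ _ _ ih => cases t <;> cases e; exact .tapp _ _ (ih neutral rfl)
  | op_neutral _ hf h hn _ _ ih₁ ih₂ =>
    obtain ⟨ψ, a, b, rfl, rfl, rfl, rfl⟩ := tren_eq_bin e
    obtain ⟨ν, h, hn⟩ := neutral h hn
    exact .op_neutral _ hf h hn (ih₁ neutral rfl) (ih₂ neutral rfl)
  | flatten_neutral _ h hn _ ih =>
    obtain ⟨ψ, a, rfl, rfl, rfl⟩ := tren_eq_op e
    obtain ⟨ν, h, hn⟩ := neutral h hn
    exact .flatten_neutral _ h hn (ih neutral rfl)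
  | lift_neutral _ h hn _ ih =>
    obtain ⟨ψ, a, rfl, rfl, rfl⟩ := tren_eq_op e
    obtain ⟨ν, h, hn⟩ := neutral h hn
    exact .lift_neutral _ h hn (ih neutral rfl)
  | sym => cases tren_eq_sym e; exact .sym _
  | tapp_sym =>
    replace e := tren_eq_tapp e
    obtain ⟨_, _, rfl, e, _⟩ := e
    cases tren_eq_sym e
    exact .tapp_sym _ _
  | op_left hf _ _ ih =>
    obtain ⟨ψ, a, rfl, rfl, rfl⟩ := tren_eq_op e
    exact .op_left hf _ (ih neutral rfl)
  | op_nat hf h _ _ ih₁ ih₂ =>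
    obtain ⟨ψ, a, b, rfl, rfl, rfl, rfl⟩ := tren_eq_bin e
    replace h := h.of_ren
    obtain ⟨φ, h, e⟩ := h
    cases φ <;> cases e
    exact .op_nat hf h (ih₁ neutral rfl) (ih₂ neutral rfl)
  | lam _ _ ih => cases t <;> cases e; exact .lam _ (ih neutral rfl)
  | tlam _ _ ih =>
    cases t <;> cases e
    refine .tlam _ (ih (fun h hn => ?_) rfl)
    replace h := h.of_ren
    obtain ⟨φ, h, rfl⟩ := h
    exact ⟨φ, h, hn.of_ren⟩
  | exp h _ ih =>
    subst e
    replace h := h.of_tren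
    obtain ⟨_, h, rfl⟩ := h
    exact .exp h (ih neutral rfl)

theorem ren_eq_tapp {t s' : Tm} {r : ℕ → ℕ} {κ : Kind} {ψ : Ty κ} (e : t.ren r = .tapp s' ψ) :
    ∃ s, t = .tapp s ψ ∧ s.ren r = s' := by
  cases t <;> cases e
  exact ⟨_, rfl, rfl⟩

theorem ren_eq_app {t s' u' : Tm} {r : ℕ → ℕ} (e : t.ren r = .app s' u') :
    ∃ s u, t = .app s u ∧ s.ren r = s' ∧ u.ren r = u' := by
  cases t <;> cases e
  exact ⟨_, _, rfl, rfl, rfl⟩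

theorem ren_eq_sym {t : Tm} {f : Sym} {r : ℕ → ℕ} (e : t.ren r = .sym f) : t = .sym f := by
  cases t <;> cases e
  rfl

theorem ren_eq_op {t : Tm} {r : ℕ → ℕ} {f : Sym} {ψ : Typ} {a' : Tm}
    (e : t.ren r = .app (.tapp (.sym f) ψ) a') :
    ∃ a, t = .app (.tapp (.sym f) ψ) a ∧ a.ren r = a' := by
  replace e := ren_eq_app e
  obtain ⟨_, a, rfl, e, ha⟩ := e
  replace e := ren_eq_tapp e
  obtain ⟨_, rfl, e⟩ := e
  cases ren_eq_sym e
  exact ⟨_, rfl, ha⟩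

theorem ren_eq_bin {t : Tm} {r : ℕ → ℕ} {f : Sym} {ψ : Typ} {a' b' : Tm}
    (e : t.ren r = .bin f ψ a' b') :
    ∃ a b, t = .bin f ψ a b ∧ a.ren r = a' ∧ b.ren r = b' := by
  replace e := ren_eq_app e
  obtain ⟨_, b, rfl, e, hb⟩ := e
  obtain ⟨a, rfl, ha⟩ := ren_eq_op e
  exact ⟨_, _, rfl, ha, hb⟩

theorem Norm.of_ren {b : Bool} {t : Tm} {r : ℕ → ℕ} (h : Norm b (t.ren r)) : Norm b t := by
  generalize e : t.ren r = t' at h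
  induction h generalizing t r with
  | var => cases t <;> cases e; exact .var _ _
  | app _ _ _ ih₁ ih₂ => cases t <;> cases e; exact .app _ (ih₁ rfl) (ih₂ rfl)
  | tapp _ _ _ ih => cases t <;> cases e; exact .tapp _ _ (ih rfl)
  | op_neutral _ hf h hn _ _ ih₁ ih₂ =>
    obtain ⟨a, b, rfl, rfl, rfl⟩ := ren_eq_bin e
    exact .op_neutral _ hf h hn (ih₁ rfl) (ih₂ rfl)
  | flatten_neutral _ h hn _ ih =>
    obtain ⟨a, rfl, rfl⟩ := ren_eq_op e
    exact .flatten_neutral _ h hn (ih rfl)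
  | lift_neutral _ h hn _ ih =>
    obtain ⟨a, rfl, rfl⟩ := ren_eq_op e
    exact .lift_neutral _ h hn (ih rfl)
  | sym => cases ren_eq_sym e; exact .sym _
  | tapp_sym =>
    replace e := ren_eq_tapp e
    obtain ⟨_, rfl, e⟩ := e
    cases ren_eq_sym e
    exact .tapp_sym _ _
  | op_left hf _ _ ih =>
    obtain ⟨a, rfl, rfl⟩ := ren_eq_op e
    exact .op_left hf _ (ih rfl)
  | op_nat hf h _ _ ih₁ ih₂ =>
    obtain ⟨a, b, rfl, rfl, rfl⟩ := ren_eq_bin e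
    exact .op_nat hf h (ih₁ rfl) (ih₂ rfl)
  | lam _ _ ih => cases t <;> cases e; exact .lam _ (ih rfl)
  | tlam _ _ ih => cases t <;> cases e; exact .tlam _ (ih rfl)
  | exp h _ ih =>
    subst e
    replace h := h.of_ren
    obtain ⟨_, h, rfl⟩ := h
    exact .exp h (ih rfl)

theorem Norm.of_inst_var {b : Bool} {t : Tm} {x : ℕ} (h : Norm b (t.sub (instSub (.var x)))) :
    Norm b t := by
  rw [inst_var] at h
  exact h.of_ren

theorem Norm.of_tinst_var {b : Bool} {t : Tm} {κ : Kind} {a : ℕ}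
    (h : Norm b (t.tsub (TySub.inst (.var κ a)))) : Norm b t := by
  rw [tinst_var] at h
  exact h.of_tren

/-! ### Reduction preserves types and creates no free variables -/

theorem Free.of_inst {x : ℕ} {t a : Tm} (h : (t.sub (instSub a)).Free x) :
    t.Free (x + 1) ∨ a.Free x := by
  obtain ⟨y, hy, h⟩ := Free.of_sub h
  cases y with
  | zero => exact .inr h
  | succ y => cases h; exact .inl hy

theorem Free.of_ren_succ {x : ℕ} {t : Tm} (h : (t.ren Nat.succ).Free (x + 1)) : t.Free x := by
  obtain ⟨y, hy, e⟩ := Free.of_ren h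
  cases e
  exact hy

theorem TFree.of_inst {κ : Kind} {x : ℕ} {t a : Tm} (h : (t.sub (instSub a)).TFree κ x) :
    t.TFree κ x ∨ a.TFree κ x := by
  rcases h.of_sub with h | ⟨y, hy, h⟩
  · exact .inl h
  · cases y with
    | zero => exact .inr h
    | succ y => exact h.elim

theorem TFree.of_tren_shift {κ κ' : Kind} {a : ℕ} {t : Tm}
    (h : (t.tren (TyRen.shift κ')).TFree κ (if κ' = κ then a + 1 else a)) : t.TFree κ a := by
  obtain ⟨b, hb, e⟩ := h.of_tren
  by_cases hk : κ = κ'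
  · subst hk; simp at e; exact e ▸ hb
  · simp [hk, Ne.symm hk] at e; exact e ▸ hb

theorem Root.free {s t : Tm} (h : Root s t) {x : ℕ} (hx : t.Free x) : s.Free x := by
  cases h with
  | beta => exact Free.of_inst hx
  | tbeta =>
    replace hx := free_tsub.1 hx
    exact hx
  | op_arr =>
    simp only [Tm.Free, false_or, Nat.add_eq_zero_iff, one_ne_zero, and_false, or_false] at hx ⊢
    exact hx.imp Free.of_ren_succ Free.of_ren_succ
  | op_all => simpa only [Tm.Free, free_tren] using hx
  | flatten_nat => exact .inr hx
  | flatten_arr => simpa [Tm.flatten, Tm.lift, Tm.num, Tm.Free] using hx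
  | flatten_all => exact hx
  | lift_nat => exact .inr hx
  | lift_arr =>
    simp only [Tm.lift, Tm.Free, false_or] at hx ⊢
    exact Free.of_ren_succ hx
  | lift_all => simpa only [Tm.lift, Tm.Free, free_tren] using hx

theorem Root.tFree {s t : Tm} (h : Root s t) {κ : Kind} {a : ℕ} (ha : t.TFree κ a) :
    s.TFree κ a := by
  cases h with
  | beta => exact (TFree.of_inst ha).imp Or.inr id
  | tbeta => exact ha.of_tinst
  | op_arr _ h =>
    have := @h.free κ _ a
    simp only [Tm.TFree, Ty.Free, false_or, or_false, tFree_ren] at ha this ⊢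
    tauto
  | @op_all _ _ _ _ _ κ' h s t =>
    have h₁ := @h.free κ _ a
    have h₂ := @TFree.of_tren_shift κ κ' a s
    have h₃ := @TFree.of_tren_shift κ κ' a t
    have h₄ : ¬ (κ' = κ ∧ 0 = if κ' = κ then a + 1 else a) := fun h => by simp [h.1] at h
    simp only [Tm.TFree, Ty.Free, false_or, Ty.Free] at ha h₁ h₂ h₃ ⊢
    have h₅ : ¬ (κ' = κ ∧ (if κ' = κ then a + 1 else a) = 0) := fun h => by simp [h.1] at h
    tauto
  | flatten_nat => exact .inr ha
  | flatten_arr h =>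
    have := @h.free κ _ a
    simp only [Tm.flatten, Tm.lift, Tm.num, Tm.TFree, Ty.Free, false_or, or_false] at ha this ⊢
    tauto
  | @flatten_all ψ τ κ' h s =>
    have h₁ := @h.free κ _ a
    have h₂ := @Ty.Free.of_inst κ _ _ a τ (chi κ')
    have h₃ := chi_closed κ' κ a
    simp only [Tm.flatten, Tm.TFree, Ty.Free, false_or] at ha h₁ ⊢
    tauto
  | lift_nat => exact .inr ha
  | lift_arr h =>
    have := @h.free κ _ a
    simp only [Tm.lift, Tm.TFree, Ty.Free, false_or, tFree_ren] at ha this ⊢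
    tauto
  | @lift_all _ _ κ' h s =>
    have h₁ := @h.free κ _ a
    have h₂ := @TFree.of_tren_shift κ κ' a s
    simp only [Tm.lift, Tm.TFree, Ty.Free, false_or] at ha h₁ h₂ ⊢
    tauto

theorem _root_.PolyInterp.HasType.of_root {Γ : Ctx} {s t : Tm} {τ : Typ} (hs : HasType Γ s τ)
    (h : Root s t) : HasType Γ t τ := by
  have shift : ∀ {Γ : Ctx} {t : Tm} {κ : Kind} {ρ : Typ}, HasType Γ t (.all κ ρ) →
      HasType (fun x => (Γ x).ren (TyRen.shift κ))
        (.tapp (t.tren (TyRen.shift κ)) (.var κ 0)) ρ := by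
    intro Γ t κ ρ h
    have := (h.tren (TyRen.shift κ)).tapp (.var κ 0)
    rwa [Ty.inst_var, Ty.ren_ren, show (fun κ' n => TyRen.inst κ 0 κ'
        ((TyRen.shift κ).up κ κ' n)) = fun _ n => n by
      funext κ' n
      by_cases e : κ' = κ
      · subst e; cases n <;> simp [TyRen.inst]
      · simp [TyRen.inst, e], Ty.ren_eq_sub, Ty.sub_var] at this
  have succ : ∀ {Γ : Ctx} {t : Tm} {σ ρ : Typ}, HasType Γ t (.arr σ ρ) →
      HasType (Γ.cons σ) (.app (t.ren Nat.succ) (.var 0)) ρ := fun {Γ t σ ρ} h =>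
    HasType.app (h.ren (Δ := Γ.cons σ) (r := Nat.succ) fun _ _ => .rfl) (.var (Γ.cons σ) 0)
  cases h with
  | beta =>
    obtain ⟨_, h, ha⟩ := hs.of_app
    obtain ⟨_, h, e⟩ := h.of_lam
    obtain ⟨e₁, e₂⟩ := e.arr_inj
    exact (h.inst (ha.conv e₁.symm)).conv e₂
  | tbeta _ ψ =>
    obtain ⟨_, h, e⟩ := hs.of_tapp
    obtain ⟨_, h, e'⟩ := h.of_tlam
    exact (h.tinst ψ).conv ((e'.all_inj.2.inst .rfl).trans e)
  | op_arr hf h =>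
    obtain ⟨h₁, h₂, e⟩ := hs.of_bin hf
    exact (HasType.lam (.bin hf (succ (h₁.conv h.betaEq)) (succ (h₂.conv h.betaEq)))).conv
      (h.betaEq.symm.trans e)
  | op_all hf h =>
    obtain ⟨h₁, h₂, e⟩ := hs.of_bin hf
    exact (HasType.tlam (.bin hf (shift (h₁.conv h.betaEq)) (shift (h₂.conv h.betaEq)))).conv
      (h.betaEq.symm.trans e)
  | flatten_nat h =>
    obtain ⟨h₁, e⟩ := hs.of_flatten
    exact h₁.conv (h.betaEq.trans e)
  | flatten_arr h =>
    obtain ⟨h₁, e⟩ := hs.of_flatten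
    exact (HasType.flatten ((h₁.conv h.betaEq).app (.lift _ (.num _ _)))).conv e
  | flatten_all h =>
    obtain ⟨h₁, e⟩ := hs.of_flatten
    exact (HasType.flatten ((h₁.conv h.betaEq).tapp _)).conv e
  | lift_nat h =>
    obtain ⟨h₁, e⟩ := hs.of_lift
    exact h₁.conv (h.betaEq.symm.trans e)
  | lift_arr h =>
    obtain ⟨h₁, e⟩ := hs.of_lift
    exact (HasType.lam (.lift _ (h₁.ren fun _ _ => .rfl))).conv (h.betaEq.symm.trans e)
  | lift_all h =>
    obtain ⟨h₁, e⟩ := hs.of_lift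
    exact (HasType.tlam (.lift _ (h₁.tren _))).conv (h.betaEq.symm.trans e)

theorem Step.red {s t : Tm} (h : Step s t) : Red s t := ⟨s, t, .refl _, h, .refl _⟩

theorem Contract.red {s t : Tm} (h : Contract s t) : Red s t := by
  have op : ∀ (f : Sym) {ψ ψ' : Typ} (s : Tm), ψ.BetaEq ψ' →
      Equiv (.app (.tapp (.sym f) ψ) s) (.app (.tapp (.sym f) ψ') s) :=
    fun f _ _ s e => .app (.tapp (.refl _) e) (.refl _)
  have bin : ∀ (f : Sym) {ψ ψ' : Typ} (s t : Tm), ψ.BetaEq ψ' →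
      Equiv (.bin f ψ s t) (.bin f ψ' s t) := fun f _ _ s t e => .app (op f s e) (.refl _)
  cases h with
  | op_nat hf e n m => cases hf with
    | add => exact ⟨_, _, bin _ _ _ e, .add_nat n m, .refl _⟩
    | mul => exact ⟨_, _, bin _ _ _ e, .mul_nat n m, .refl _⟩
  | root h =>
    cases h with
    | beta => exact (Step.beta _ _ _).red
    | tbeta => exact (Step.tbeta _ _).red
    | op_arr hf h => cases hf with
      | add => exact ⟨_, _, bin _ _ _ h.betaEq, .add_arr _ _ _ _, .refl _⟩
      | mul => exact ⟨_, _, bin _ _ _ h.betaEq, .mul_arr _ _ _ _, .refl _⟩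
    | op_all hf h => cases hf with
      | add => exact ⟨_, _, bin _ _ _ h.betaEq, .add_all _ _ _ _, .refl _⟩
      | mul => exact ⟨_, _, bin _ _ _ h.betaEq, .mul_all _ _ _ _, .refl _⟩
    | flatten_nat h => exact ⟨_, _, op _ _ h.betaEq, .flatten_nat _, .refl _⟩
    | flatten_arr h => exact ⟨_, _, op _ _ h.betaEq, .flatten_arr _ _ _, .refl _⟩
    | flatten_all h => exact ⟨_, _, op _ _ h.betaEq, .flatten_all _ _ _, .refl _⟩
    | lift_nat h => exact ⟨_, _, op _ _ h.betaEq, .lift_nat _, .refl _⟩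
    | lift_arr h => exact ⟨_, _, op _ _ h.betaEq, .lift_arr _ _ _, .refl _⟩
    | lift_all h => exact ⟨_, _, op _ _ h.betaEq, .lift_all _ _ _, .refl _⟩

namespace Red

theorem appL {s s' : Tm} (h : Red s s') (t : Tm) : Red (app s t) (app s' t) := by
  obtain ⟨_, _, e, h, e'⟩ := h
  exact ⟨_, _, .app e (.refl _), .appL t h, .app e' (.refl _)⟩

theorem appR (s : Tm) {t t' : Tm} (h : Red t t') : Red (app s t) (app s t') := by
  obtain ⟨_, _, e, h, e'⟩ := h
  exact ⟨_, _, .app (.refl _) e, .appR s h, .app (.refl _) e'⟩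

theorem tapp {s s' : Tm} (h : Red s s') {κ : Kind} (ψ : Ty κ) : Red (tapp s ψ) (tapp s' ψ) := by
  obtain ⟨_, _, e, h, e'⟩ := h
  exact ⟨_, _, .tapp e .rfl, .tapp ψ h, .tapp e' .rfl⟩

theorem lam (σ : Typ) {s s' : Tm} (h : Red s s') : Red (lam σ s) (lam σ s') := by
  obtain ⟨_, _, e, h, e'⟩ := h
  exact ⟨_, _, .lam .rfl e, .lam σ h, .lam .rfl e'⟩

theorem tlam (κ : Kind) {s s' : Tm} (h : Red s s') : Red (tlam κ s) (tlam κ s') := by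
  obtain ⟨_, _, e, h, e'⟩ := h
  exact ⟨_, _, .tlam κ e, .tlam κ h, .tlam κ e'⟩

end Red

/-- Reduction in any number of steps. -/
abbrev Reds : Tm → Tm → Prop := Relation.ReflTransGen Red

namespace Reds

theorem appL {s s' : Tm} (h : Reds s s') (t : Tm) : Reds (app s t) (app s' t) :=
  Relation.ReflTransGen.lift (fun s => Tm.app s t) (fun _ _ h => Red.appL h t) _ _ h

theorem appR (s : Tm) {t t' : Tm} (h : Reds t t') : Reds (app s t) (app s t') :=
  Relation.ReflTransGen.lift (Tm.app s) (fun _ _ h => Red.appR s h) _ _ h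

theorem tapp {s s' : Tm} (h : Reds s s') {κ : Kind} (ψ : Ty κ) : Reds (tapp s ψ) (tapp s' ψ) :=
  Relation.ReflTransGen.lift (fun s => Tm.tapp s ψ) (fun _ _ h => Red.tapp h ψ) _ _ h

theorem lam (σ : Typ) {s s' : Tm} (h : Reds s s') : Reds (lam σ s) (lam σ s') :=
  Relation.ReflTransGen.lift (Tm.lam σ) (fun _ _ h => Red.lam σ h) _ _ h

theorem tlam (κ : Kind) {s s' : Tm} (h : Reds s s') : Reds (tlam κ s) (tlam κ s') :=
  Relation.ReflTransGen.lift (Tm.tlam κ) (fun _ _ h => Red.tlam κ h) _ _ h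

end Reds

/-- `v` is reached from `t` by reduction, with no new free variables and the same types. -/
structure Reaches (t v : Tm) : Prop where
  reds : Reds t v
  free : ∀ x, v.Free x → t.Free x
  tFree : ∀ κ a, v.TFree κ a → t.TFree κ a
  hasType : ∀ Γ τ, HasType Γ t τ → HasType Γ v τ

namespace Reaches

theorem refl (t : Tm) : Reaches t t := ⟨.refl, fun _ h => h, fun _ _ h => h, fun _ _ h => h⟩

theorem trans {s t u : Tm} (h : Reaches s t) (h' : Reaches t u) : Reaches s u :=
  ⟨h.reds.trans h'.reds, fun x hx => h.free x (h'.free x hx),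
    fun κ a ha => h.tFree κ a (h'.tFree κ a ha), fun Γ τ ht => h'.hasType Γ τ (h.hasType Γ τ ht)⟩

theorem isClosed {s t : Tm} (h : Reaches s t) (hs : s.IsClosed) : t.IsClosed :=
  ⟨fun x hx => hs.1 x (h.free x hx), fun κ a ha => hs.2 κ a (h.tFree κ a ha)⟩

theorem app {s s' t t' : Tm} (hs : Reaches s s') (ht : Reaches t t') :
    Reaches (app s t) (app s' t') where
  reds := (hs.reds.appL t).trans (ht.reds.appR s')
  free x h := h.imp (hs.free x) (ht.free x)
  tFree κ a h := h.imp (hs.tFree κ a) (ht.tFree κ a)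
  hasType Γ τ h := by
    obtain ⟨_, h₁, h₂⟩ := h.of_app
    exact (hs.hasType _ _ h₁).app (ht.hasType _ _ h₂)

theorem tapp {s s' : Tm} (hs : Reaches s s') {κ : Kind} (ψ : Ty κ) :
    Reaches (tapp s ψ) (tapp s' ψ) where
  reds := hs.reds.tapp ψ
  free x h := hs.free x h
  tFree κ a h := h.imp (hs.tFree κ a) id
  hasType Γ τ h := by
    obtain ⟨_, h₁, e⟩ := h.of_tapp
    exact ((hs.hasType _ _ h₁).tapp ψ).conv e

theorem lam {s s' : Tm} (hs : Reaches s s') (σ : Typ) : Reaches (lam σ s) (lam σ s') where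
  reds := hs.reds.lam σ
  free x h := hs.free _ h
  tFree κ a h := h.imp id (hs.tFree κ a)
  hasType Γ τ h := by
    obtain ⟨_, h₁, e⟩ := h.of_lam
    exact (HasType.lam (hs.hasType _ _ h₁)).conv e

theorem tlam {s s' : Tm} (hs : Reaches s s') (κ : Kind) : Reaches (tlam κ s) (tlam κ s') where
  reds := hs.reds.tlam κ
  free x h := hs.free _ h
  tFree κ a h := hs.tFree _ _ h
  hasType Γ τ h := by
    obtain ⟨_, h₁, e⟩ := h.of_tlam
    exact (HasType.tlam (hs.hasType _ _ h₁)).conv e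

end Reaches

theorem Root.reaches {s t : Tm} (h : Root s t) : Reaches s t :=
  ⟨.single (Contract.root h).red, fun _ => h.free, fun _ _ => h.tFree, fun _ _ hs => hs.of_root h⟩

theorem HStep.reaches {s t : Tm} (h : HStep s t) : Reaches s t := by
  induction h with
  | root h => exact h.reaches
  | appL t _ ih => exact ih.app (.refl t)
  | tappL ψ _ ih => exact ih.tapp ψ

theorem reaches_op_nat {f : Sym} {op : ℕ → ℕ → ℕ} (hf : f.Op op) {ψ : Typ} (h : ψ.Reds .nat)
    (n m : ℕ) : Reaches (bin f ψ (num n) (num m)) (num (op n m)) :=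
  ⟨.single (Contract.op_nat hf h.betaEq n m).red, fun _ h => h.elim, fun _ _ h => h.elim,
    fun _ _ ht => (HasType.num _ _).conv (h.betaEq.symm.trans (ht.of_bin hf).2.2)⟩

/-! ### Normal forms -/

/-- The shape of normal forms; with `b = true`, of those whose application to arguments creates no
redex. -/
inductive NF : Bool → Tm → Prop
  | var (b : Bool) (x : ℕ) : NF b (var x)
  | app (b : Bool) {s t : Tm} : NF true s → NF false t → NF b (app s t)
  | tapp (b : Bool) {s : Tm} {κ : Kind} (ψ : Ty κ) : NF true s → NF b (tapp s ψ)
  | op_neutral (b : Bool) {f : Sym} {op : ℕ → ℕ → ℕ} (hf : f.Op op) {ψ ν : Typ} {s t : Tm} :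
      ψ.BetaEq ν → ν.Neutral → NF false s → NF false t → NF b (bin f ψ s t)
  | flatten_neutral (b : Bool) {ψ ν : Typ} {s : Tm} :
      ψ.BetaEq ν → ν.Neutral → NF false s → NF b (flatten ψ s)
  | lift_neutral (b : Bool) {ψ ν : Typ} {s : Tm} :
      ψ.BetaEq ν → ν.Neutral → NF false s → NF b (lift ψ s)
  | sym (f : Sym) : NF false (sym f)
  | tapp_sym (f : Sym) {κ : Kind} (ψ : Ty κ) : NF false (tapp (sym f) ψ)
  | op_left {f : Sym} {op : ℕ → ℕ → ℕ} (hf : f.Op op) (ψ : Typ) {s : Tm} :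
      NF false s → NF false (app (tapp (sym f) ψ) s)
  | op_nat {f : Sym} {op : ℕ → ℕ → ℕ} (hf : f.Op op) {ψ : Typ} {s t : Tm} :
      ψ.BetaEq .nat → NF false s → NF false t → (¬ ∃ n m, s = num n ∧ t = num m) →
      NF false (bin f ψ s t)
  | lam (σ : Typ) {t : Tm} : NF false t → NF false (lam σ t)
  | tlam (κ : Kind) {t : Tm} : NF false t → NF false (tlam κ t)

namespace NF

theorem equiv {b : Bool} {s t : Tm} (h : NF b s) (e : Equiv s t) : NF b t := by
  induction h generalizing t with
  | var => cases e; exact .var _ _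
  | app _ _ _ ih₁ ih₂ => cases e with | app a b => exact .app _ (ih₁ a) (ih₂ b)
  | tapp _ _ _ ih => cases e with | tapp a e => exact .tapp _ _ (ih a)
  | op_neutral _ hf h hn _ _ ih₁ ih₂ =>
    cases e with | app e₁ e₂ => cases e₁ with | app e₃ e₄ => cases e₃ with | tapp e₅ e₆ =>
    cases e₅
    exact .op_neutral _ hf (e₆.symm.trans h) hn (ih₁ e₄) (ih₂ e₂)
  | flatten_neutral _ h hn _ ih =>
    cases e with | app e₃ e₄ => cases e₃ with | tapp e₅ e₆ =>
    cases e₅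
    exact .flatten_neutral _ (e₆.symm.trans h) hn (ih e₄)
  | lift_neutral _ h hn _ ih =>
    cases e with | app e₃ e₄ => cases e₃ with | tapp e₅ e₆ =>
    cases e₅
    exact .lift_neutral _ (e₆.symm.trans h) hn (ih e₄)
  | sym => cases e; exact .sym _
  | tapp_sym => cases e with | tapp a e => cases a; exact .tapp_sym _ _
  | op_left hf _ _ ih =>
    cases e with | app e₃ e₄ => cases e₃ with | tapp e₅ e₆ =>
    cases e₅
    exact .op_left hf _ (ih e₄)
  | op_nat hf h _ _ hne ih₁ ih₂ =>
    cases e with | app e₁ e₂ => cases e₁ with | app e₃ e₄ => cases e₃ with | tapp e₅ e₆ =>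
    cases e₅
    refine .op_nat hf (e₆.symm.trans h) (ih₁ e₄) (ih₂ e₂) ?_
    rintro ⟨n, m, rfl, rfl⟩
    cases e₄
    cases e₂
    exact hne ⟨n, m, rfl, rfl⟩
  | lam _ _ ih => cases e with | lam _ e => exact .lam _ (ih e)
  | tlam _ _ ih => cases e with | tlam _ e => exact .tlam _ (ih e)

theorem of_op_left {b : Bool} {f : Sym} {ψ : Typ} {s : Tm} {op : ℕ → ℕ → ℕ} (hf : f.Op op)
    (h : NF b (.app (.tapp (.sym f) ψ) s)) : b = false := by
  cases h with
  | app _ h => cases h with | tapp _ _ h => cases h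
  | op_left => rfl
  | _ => cases hf

theorem of_bin {b : Bool} {f : Sym} {ψ : Typ} {s t : Tm} {op : ℕ → ℕ → ℕ} (hf : f.Op op)
    (h : NF b (.bin f ψ s t)) :
    (∃ ν, ψ.BetaEq ν ∧ ν.Neutral) ∨ ψ.BetaEq .nat ∧ ¬ ∃ n m, s = num n ∧ t = num m := by
  cases h with
  | app _ h => cases h.of_op_left hf
  | op_neutral _ _ h hn => exact .inl ⟨_, h, hn⟩
  | op_nat _ h _ _ hne => exact .inr ⟨h, hne⟩

theorem of_unary {b : Bool} {f : Sym} {ψ : Typ} {s : Tm} (hf : f = .flatten ∨ f = .lift)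
    (h : NF b (.app (.tapp (.sym f) ψ) s)) : ∃ ν, ψ.BetaEq ν ∧ ν.Neutral := by
  cases h with
  | app _ h => cases h with | tapp _ _ h => cases h
  | flatten_neutral _ h hn => exact ⟨_, h, hn⟩
  | lift_neutral _ h hn => exact ⟨_, h, hn⟩
  | op_left hf' => cases hf' <;> simp at hf

theorem not_step {b : Bool} {s t : Tm} (h : NF b s) : ¬ Step s t := fun h' => by
  induction h' generalizing b with
  | lam _ _ ih => cases h with | lam _ h => exact ih h
  | tlam _ _ ih => cases h with | tlam _ h => exact ih h
  | appR _ _ ih =>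
    cases h with
    | app _ _ h => exact ih h
    | op_neutral _ _ _ _ _ h => exact ih h
    | flatten_neutral _ _ _ h => exact ih h
    | lift_neutral _ _ _ h => exact ih h
    | op_left _ _ h => exact ih h
    | op_nat _ _ _ h => exact ih h
  | appL _ h' ih =>
    cases h with
    | app _ h => exact ih h
    | op_neutral _ hf _ _ h => exact ih (.op_left hf _ h)
    | flatten_neutral => exact ih (.tapp_sym _ _)
    | lift_neutral => exact ih (.tapp_sym _ _)
    | op_left => exact ih (.tapp_sym _ _)
    | op_nat hf _ h => exact ih (.op_left hf _ h)
  | tapp _ h' ih =>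
    cases h with
    | tapp _ _ h => exact ih h
    | tapp_sym => cases h'
  | beta => cases h with | app _ h => cases h
  | tbeta => cases h with | tapp _ _ h => cases h
  | add_nat n m =>
    rcases h.of_bin .add with ⟨_, h, hn⟩ | ⟨_, h⟩
    · exact hn.not_betaEq_nat h.symm
    · exact h ⟨_, _, rfl, rfl⟩
  | mul_nat n m =>
    rcases h.of_bin .mul with ⟨_, h, hn⟩ | ⟨_, h⟩
    · exact hn.not_betaEq_nat h.symm
    · exact h ⟨_, _, rfl, rfl⟩
  | add_arr =>
    rcases h.of_bin .add with ⟨_, h, hn⟩ | ⟨h, _⟩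
    · exact hn.not_betaEq_arr h.symm
    · exact Ty.not_nat_betaEq_arr h.symm
  | mul_arr =>
    rcases h.of_bin .mul with ⟨_, h, hn⟩ | ⟨h, _⟩
    · exact hn.not_betaEq_arr h.symm
    · exact Ty.not_nat_betaEq_arr h.symm
  | add_all =>
    rcases h.of_bin .add with ⟨_, h, hn⟩ | ⟨h, _⟩
    · exact hn.not_betaEq_all h.symm
    · exact Ty.not_nat_betaEq_all h.symm
  | mul_all =>
    rcases h.of_bin .mul with ⟨_, h, hn⟩ | ⟨h, _⟩
    · exact hn.not_betaEq_all h.symm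
    · exact Ty.not_nat_betaEq_all h.symm
  | flatten_nat => obtain ⟨_, h, hn⟩ := h.of_unary (.inl rfl); exact hn.not_betaEq_nat h.symm
  | flatten_arr => obtain ⟨_, h, hn⟩ := h.of_unary (.inl rfl); exact hn.not_betaEq_arr h.symm
  | flatten_all => obtain ⟨_, h, hn⟩ := h.of_unary (.inl rfl); exact hn.not_betaEq_all h.symm
  | lift_nat => obtain ⟨_, h, hn⟩ := h.of_unary (.inr rfl); exact hn.not_betaEq_nat h.symm
  | lift_arr => obtain ⟨_, h, hn⟩ := h.of_unary (.inr rfl); exact hn.not_betaEq_arr h.symm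
  | lift_all => obtain ⟨_, h, hn⟩ := h.of_unary (.inr rfl); exact hn.not_betaEq_all h.symm

theorem normal {b : Bool} {s : Tm} (h : NF b s) : s.Normal := by
  rintro t ⟨_, _, e, h', _⟩
  exact (h.equiv e).not_step h'

end NF

theorem Norm.exists_nf {b : Bool} {t : Tm} (h : Norm b t) : ∃ v, Reaches t v ∧ NF b v := by
  have op : ∀ (f : Sym) (ψ : Typ) {s v : Tm}, Reaches s v →
      Reaches (.app (.tapp (.sym f) ψ) s) (.app (.tapp (.sym f) ψ) v) :=
    fun f ψ _ _ h => .app (.refl _) h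
  induction h with
  | var => exact ⟨_, .refl _, .var _ _⟩
  | app _ _ _ ih₁ ih₂ =>
    obtain ⟨_, h₁, n₁⟩ := ih₁
    obtain ⟨_, h₂, n₂⟩ := ih₂
    exact ⟨_, h₁.app h₂, .app _ n₁ n₂⟩
  | tapp _ ψ _ ih =>
    obtain ⟨_, h₁, n₁⟩ := ih
    exact ⟨_, h₁.tapp ψ, .tapp _ _ n₁⟩
  | op_neutral _ hf h hn _ _ ih₁ ih₂ =>
    obtain ⟨_, h₁, n₁⟩ := ih₁
    obtain ⟨_, h₂, n₂⟩ := ih₂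
    exact ⟨_, (op _ _ h₁).app h₂, .op_neutral _ hf h.betaEq hn n₁ n₂⟩
  | flatten_neutral _ h hn _ ih =>
    obtain ⟨_, h₁, n₁⟩ := ih
    exact ⟨_, op _ _ h₁, .flatten_neutral _ h.betaEq hn n₁⟩
  | lift_neutral _ h hn _ ih =>
    obtain ⟨_, h₁, n₁⟩ := ih
    exact ⟨_, op _ _ h₁, .lift_neutral _ h.betaEq hn n₁⟩
  | sym => exact ⟨_, .refl _, .sym _⟩
  | tapp_sym => exact ⟨_, .refl _, .tapp_sym _ _⟩
  | op_left hf _ _ ih =>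
    obtain ⟨_, h₁, n₁⟩ := ih
    exact ⟨_, op _ _ h₁, .op_left hf _ n₁⟩
  | op_nat hf h _ _ ih₁ ih₂ =>
    obtain ⟨v₁, h₁, n₁⟩ := ih₁
    obtain ⟨v₂, h₂, n₂⟩ := ih₂
    by_cases H : ∃ n m, v₁ = num n ∧ v₂ = num m
    · obtain ⟨n, m, rfl, rfl⟩ := H
      exact ⟨_, ((op _ _ h₁).app h₂).trans (reaches_op_nat hf h n m), .sym _⟩
    · exact ⟨_, (op _ _ h₁).app h₂, .op_nat hf h.betaEq n₁ n₂ H⟩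
  | lam σ _ ih =>
    obtain ⟨_, h₁, n₁⟩ := ih
    exact ⟨_, h₁.lam σ, .lam _ n₁⟩
  | tlam κ _ ih =>
    obtain ⟨_, h₁, n₁⟩ := ih
    exact ⟨_, h₁.tlam κ, .tlam _ n₁⟩
  | exp h _ ih =>
    obtain ⟨_, h₁, n₁⟩ := ih
    exact ⟨_, h.reaches.trans h₁, n₁⟩

end Tm
open Tm

/-! ### Reducibility candidates -/

/-- The reducibility candidates for the type `ψ`. They contain untyped terms; the type only fixes
the type indices under which the candidate is closed with respect to the function symbols. -/
structure Cand (ψ : Typ) (S : Set Tm) : Prop where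
  norm : ∀ t ∈ S, Norm false t
  neutral : ∀ t, Norm true t → t ∈ S
  exp : ∀ t t', HStep t t' → t' ∈ S → t ∈ S
  bin : ∀ {f op}, Sym.Op f op → ∀ ψ', Ty.BetaEq ψ' ψ → ∀ s ∈ S, ∀ t ∈ S, Tm.bin f ψ' s t ∈ S
  lift : ∀ ψ', Ty.BetaEq ψ' ψ → ∀ s, Norm false s → Tm.lift ψ' s ∈ S
  flatten : ∀ ψ', Ty.BetaEq ψ' ψ → ∀ s ∈ S, Norm false (Tm.flatten ψ' s)

theorem Cand.betaEq {ψ ψ' : Typ} {S : Set Tm} (h : Cand ψ S) (e : ψ.BetaEq ψ') : Cand ψ' S where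
  norm := h.norm
  neutral := h.neutral
  exp := h.exp
  bin hf _ e' := h.bin hf _ (e'.trans e.symm)
  lift _ e' := h.lift _ (e'.trans e.symm)
  flatten _ e' := h.flatten _ (e'.trans e.symm)

/-- The meanings of type constructors of a given kind. Functions between meanings are unrestricted;
`Valid` selects those that respect candidates. -/
def Sem : Kind → Type
  | .star => Set Tm
  | .arr κ₁ κ₂ => Sem κ₁ → Sem κ₂

instance : Membership Tm (Sem .star) := inferInstanceAs (Membership Tm (Set Tm))

/-- `S` is a possible meaning of `ψ`, the condition of the logical relation over all kinds. -/
def Valid : (κ : Kind) → Ty κ → Sem κ → Prop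
  | .star, ψ, S => Cand ψ S
  | .arr κ₁ κ₂, φ, F => ∀ (ψ : Ty κ₁) (S : Sem κ₁), Valid κ₁ ψ S → Valid κ₂ (.app φ ψ) (F S)

theorem Valid.betaEq {κ : Kind} {ψ ψ' : Ty κ} {S : Sem κ} (h : Valid κ ψ S) (e : ψ.BetaEq ψ') :
    Valid κ ψ' S := by
  induction κ with
  | star => exact Cand.betaEq h e
  | arr _ _ _ ih => exact fun φ F hF => ih (h φ F hF) (e.app .rfl)

/-- The meaning given to `nat`, to the constructors `χ_κ` and to free variables. That `χ_κ` has a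
meaning at all is what the rule for `flatten` at quantified types needs. -/
def Sem.dflt : (κ : Kind) → Sem κ
  | .star => {t | Norm false t}
  | .arr _ κ₂ => fun _ => Sem.dflt κ₂

theorem cand_nat : Cand .nat {t | Norm false t} where
  norm _ h := h
  neutral _ h := h.weaken
  exp _ _ h h' := .exp h h'
  bin hf _ e _ hs _ ht := .op_nat hf e.reds_nat hs ht
  lift _ e _ hs := .exp (.root (.lift_nat e.reds_nat _)) hs
  flatten _ e _ hs := .exp (.root (.flatten_nat e.reds_nat _)) hs

theorem cand_neutral {ψ : Typ} (hψ : ψ.Neutral) : Cand ψ {t | Norm false t} := by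
  have key : ∀ ψ' : Typ, ψ'.BetaEq ψ → ∃ ν, ψ'.Reds ν ∧ ν.Neutral := fun ψ' e => by
    obtain ⟨ν, h, h'⟩ := e.join
    exact ⟨ν, h, h'.neutral hψ⟩
  refine ⟨fun _ h => h, fun _ h => h.weaken, fun _ _ h h' => .exp h h', ?_, ?_, ?_⟩
  · intro f op hf ψ' e s hs t ht
    obtain ⟨ν, h, hn⟩ := key _ e
    exact Norm.op_neutral _ hf h hn hs ht
  · intro ψ' e s hs
    obtain ⟨ν, h, hn⟩ := key _ e
    exact Norm.lift_neutral _ h hn hs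
  · intro ψ' e s hs
    obtain ⟨ν, h, hn⟩ := key _ e
    exact .flatten_neutral _ h hn hs

theorem valid_neutral {κ : Kind} {ψ : Ty κ} (h : ψ.Neutral) : Valid κ ψ (Sem.dflt κ) := by
  induction κ with
  | star => exact cand_neutral h
  | arr _ _ _ ih => exact fun φ _ _ => ih (.app φ h)

theorem valid_chi (κ : Kind) : Valid κ (chi κ) (Sem.dflt κ) := by
  induction κ with
  | star => exact cand_nat
  | arr κ₁ κ₂ _ ih =>
    refine fun ψ _ _ => ih.betaEq (Ty.BetaEq.symm ?_)
    have := (Ty.Reds.betaEq (.single (Ty.Step.beta (chi κ₂) ψ)))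
    rwa [Ty.inst, (chi_closed κ₂).sub_eq] at this

/-- The meaning of `σ → τ`. -/
def arrowSet (A B : Set Tm) : Set Tm := {s | Norm false s ∧ ∀ a ∈ A, Tm.app s a ∈ B}

/-- The meaning of `∀ α : κ. τ`. -/
def allSet (κ : Kind) (F : Sem κ → Set Tm) : Set Tm :=
  {s | Norm false s ∧ ∀ ψ S, Valid κ ψ S → Tm.tapp s ψ ∈ F S}

theorem mem_arrowSet_of_lam {σ τ ρ : Typ} {A B : Set Tm} (hA : Cand σ A) (hB : Cand τ B)
    {b : Tm} (hb : ∀ a ∈ A, b.sub (instSub a) ∈ B) : Tm.lam ρ b ∈ arrowSet A B :=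
  ⟨.lam _ (.of_inst_var (hB.norm _ (hb (.var 0) (hA.neutral _ (.var _ _))))),
    fun a ha => hB.exp _ _ (.root (.beta _ _ _)) (hb a ha)⟩

theorem mem_arrowSet_of_hStep {τ : Typ} {A B : Set Tm} (hB : Cand τ B) {t t' : Tm}
    (h : HStep t t') (ht : t' ∈ arrowSet A B) : t ∈ arrowSet A B :=
  ⟨.exp h ht.1, fun a ha => hB.exp _ _ (.appL _ h) (ht.2 a ha)⟩

theorem Cand.arrow {σ τ : Typ} {A B : Set Tm} (hA : Cand σ A) (hB : Cand τ B) :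
    Cand (.arr σ τ) (arrowSet A B) where
  norm _ h := h.1
  neutral t h := ⟨h.weaken, fun a ha => hB.neutral _ (.app _ h (hA.norm a ha))⟩
  exp _ _ h h' := mem_arrowSet_of_hStep hB h h'
  bin hf ψ' e s hs t ht := by
    obtain ⟨σ', τ', h, h₁, h₂⟩ := e.reds_arr
    refine mem_arrowSet_of_hStep hB (.root (.op_arr hf h s t))
      (mem_arrowSet_of_lam hA hB fun a ha => ?_)
    have := hB.bin hf _ h₂.betaEq.symm _ (hs.2 a ha) _ (ht.2 a ha)
    simpa only [Tm.sub, ren_succ_inst, instSub] using this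
  lift ψ' e s hs := by
    obtain ⟨σ', τ', h, h₁, h₂⟩ := e.reds_arr
    refine mem_arrowSet_of_hStep hB (.root (.lift_arr h s))
      (mem_arrowSet_of_lam hA hB fun a ha => ?_)
    have := hB.lift _ h₂.betaEq.symm _ hs
    simpa only [Tm.lift, Tm.sub, ren_succ_inst] using this
  flatten ψ' e s hs := by
    obtain ⟨σ', τ', h, h₁, h₂⟩ := e.reds_arr
    exact .exp (.root (.flatten_arr h s)) (hB.flatten _ h₂.betaEq.symm _
      (hs.2 _ (hA.lift _ h₁.betaEq.symm _ (.sym _))))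

theorem mem_allSet_of_tlam {κ : Kind} {τ : Typ} {F : Sem κ → Set Tm}
    (hF : ∀ ψ S, Valid κ ψ S → Cand (τ.inst ψ) (F S)) {b : Tm}
    (hb : ∀ ψ S, Valid κ ψ S → b.tsub (TySub.inst ψ) ∈ F S) : Tm.tlam κ b ∈ allSet κ F := by
  have h0 := valid_neutral (.var κ 0)
  exact ⟨.tlam _ (.of_tinst_var ((hF _ _ h0).norm _ (hb _ _ h0))),
    fun ψ S hS => (hF ψ S hS).exp _ _ (.root (.tbeta _ _)) (hb ψ S hS)⟩

theorem mem_allSet_of_hStep {κ : Kind} {τ : Typ} {F : Sem κ → Set Tm}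
    (hF : ∀ ψ S, Valid κ ψ S → Cand (τ.inst ψ) (F S)) {t t' : Tm} (h : HStep t t')
    (ht : t' ∈ allSet κ F) : t ∈ allSet κ F :=
  ⟨.exp h ht.1, fun ψ S hS => (hF ψ S hS).exp _ _ (.tappL _ h) (ht.2 ψ S hS)⟩

theorem Cand.all {κ : Kind} {τ : Typ} {F : Sem κ → Set Tm}
    (hF : ∀ ψ S, Valid κ ψ S → Cand (τ.inst ψ) (F S)) : Cand (.all κ τ) (allSet κ F) where
  norm _ h := h.1
  neutral t h := ⟨h.weaken, fun ψ S hS => (hF ψ S hS).neutral _ (.tapp _ _ h)⟩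
  exp _ _ h h' := mem_allSet_of_hStep hF h h'
  bin hf ψ' e s hs t ht := by
    obtain ⟨τ', h, h₂⟩ := e.reds_all
    refine mem_allSet_of_hStep hF (.root (.op_all hf h s t))
      (mem_allSet_of_tlam hF fun ψ S hS => ?_)
    have := (hF ψ S hS).bin hf _ (h₂.betaEq.symm.inst .rfl) _ (hs.2 ψ S hS) _ (ht.2 ψ S hS)
    simp only [Tm.tsub, tren_shift_inst, Ty.sub]
    rwa [show TySub.inst ψ κ 0 = ψ by simp [TySub.inst_eq_cons]]
  lift ψ' e s hs := by
    obtain ⟨τ', h, h₂⟩ := e.reds_all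
    refine mem_allSet_of_hStep hF (.root (.lift_all h s))
      (mem_allSet_of_tlam hF fun ψ S hS => ?_)
    have := (hF ψ S hS).lift _ (h₂.betaEq.symm.inst .rfl) _ hs
    simpa only [Tm.lift, Tm.tsub, tren_shift_inst, Ty.inst] using this
  flatten ψ' e s hs := by
    obtain ⟨τ', h, h₂⟩ := e.reds_all
    exact .exp (.root (.flatten_all h s)) ((hF _ _ (valid_chi κ)).flatten _
      (h₂.betaEq.symm.inst .rfl) _ (hs.2 _ _ (valid_chi κ)))

/-! ### The meaning of type constructors -/

/-- Meanings of the type constructor variables. -/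
abbrev Env : Type := (κ : Kind) → ℕ → Sem κ

/-- The environment that gives the meaning `S` to the variable with index `0` of the kind of `S` and
the meanings of `ρ` to the other variables, shifted down. -/
def Env.cons {κ : Kind} (S : Sem κ) (ρ : Env) : Env := fun κ' n =>
  if h : κ = κ' then
    match n with
    | 0 => h ▸ S
    | m + 1 => ρ κ' m
  else ρ κ' n

namespace Env

@[simp] theorem cons_zero {κ : Kind} (S : Sem κ) (ρ : Env) : Env.cons S ρ κ 0 = S := by
  simp [cons]

@[simp] theorem cons_succ {κ : Kind} (S : Sem κ) (ρ : Env) (n : ℕ) :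
    Env.cons S ρ κ (n + 1) = ρ κ n := by simp [cons]

@[simp] theorem cons_of_ne {κ κ' : Kind} (h : ¬κ' = κ) (S : Sem κ) (ρ : Env) (n : ℕ) :
    Env.cons S ρ κ' n = ρ κ' n := by simp [cons, Ne.symm h]

theorem cons_comp_up {κ : Kind} (S : Sem κ) (ρ : Env) (r : TyRen) :
    (fun κ' n => Env.cons S ρ κ' (r.up κ κ' n)) = Env.cons S (fun κ' n => ρ κ' (r κ' n)) := by
  funext κ' n
  by_cases e : κ' = κ
  · subst e; cases n <;> simp
  · simp [e]

theorem cons_comp_shift {κ : Kind} (S : Sem κ) (ρ : Env) :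
    (fun κ' n => Env.cons S ρ κ' (TyRen.shift κ κ' n)) = ρ := by
  funext κ' n
  by_cases e : κ' = κ
  · subst e; simp
  · simp [e]

end Env

/-- The meaning of a type constructor. -/
def Ty.eval : {κ : Kind} → Ty κ → Env → Sem κ
  | _, .var κ n, ρ => ρ κ n
  | _, .nat, _ => {t : Tm | Tm.Norm false t}
  | _, .app φ ψ, ρ => (φ.eval ρ : Sem _ → Sem _) (ψ.eval ρ)
  | _, .arr σ τ, ρ => arrowSet (σ.eval ρ) (τ.eval ρ)
  | _, .all κ τ, ρ => allSet κ fun S => τ.eval (Env.cons S ρ)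
  | _, .lam _ φ, ρ => fun S => φ.eval (Env.cons S ρ)

namespace Ty

theorem eval_ren {κ : Kind} (τ : Ty κ) (r : TyRen) (ρ : Env) :
    (τ.ren r).eval ρ = τ.eval fun κ' n => ρ κ' (r κ' n) := by
  induction τ generalizing r ρ with
  | var | nat => rfl
  | app _ _ ih₁ ih₂ | arr _ _ ih₁ ih₂ => simp only [ren, eval, ih₁, ih₂] <;> rfl
  | all _ _ ih | lam _ _ ih => simp only [ren, eval, ih, Env.cons_comp_up]; rfl

theorem eval_sub {κ : Kind} (τ : Ty κ) (s : TySub) (ρ : Env) :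
    (τ.sub s).eval ρ = τ.eval fun κ' n => (s κ' n).eval ρ := by
  have up : ∀ (s : TySub) (ρ : Env) {κ : Kind} (S : Sem κ),
      (fun κ' n => (s.up κ κ' n).eval (Env.cons S ρ)) =
        Env.cons S fun κ' n => (s κ' n).eval ρ := by
    intro s ρ κ S
    funext κ' n
    by_cases e : κ' = κ
    · subst e; cases n <;> simp [eval, eval_ren, Env.cons_comp_shift]
    · simp [e, eval_ren, Env.cons_comp_shift]
  induction τ generalizing s ρ with
  | var | nat => rfl
  | app _ _ ih₁ ih₂ | arr _ _ ih₁ ih₂ => simp only [sub, eval, ih₁, ih₂] <;> rfl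
  | all _ _ ih | lam _ _ ih => simp only [sub, eval, ih, up]; rfl

theorem eval_inst {κ κ' : Kind} (φ : Ty κ') (ψ : Ty κ) (ρ : Env) :
    (φ.inst ψ).eval ρ = φ.eval (Env.cons (ψ.eval ρ) ρ) := by
  rw [inst, eval_sub]
  congr 1
  funext κ' n
  rw [TySub.inst_eq_cons]
  by_cases e : κ' = κ
  · subst e; cases n <;> simp [eval]
  · simp [e, eval]

theorem Step.eval_eq {κ : Kind} {φ φ' : Ty κ} (h : Step φ φ') (ρ : Env) :
    φ.eval ρ = φ'.eval ρ := by
  induction h generalizing ρ with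
  | beta => rw [eval_inst]; rfl
  | _ => simp only [eval, *] <;> rfl

theorem BetaEq.eval_eq {κ : Kind} {φ φ' : Ty κ} (h : φ.BetaEq φ') (ρ : Env) :
    φ.eval ρ = φ'.eval ρ := by
  induction h with
  | rel _ _ h => exact h.eval_eq ρ
  | refl => exact Eq.refl _
  | symm _ _ _ ih => exact ih.symm
  | trans _ _ _ _ _ ih₁ ih₂ => exact ih₁.trans ih₂

theorem valid_eval {κ : Kind} (τ : Ty κ) {ω : TySub} {ρ : Env}
    (h : ∀ κ n, Valid κ (ω κ n) (ρ κ n)) : Valid κ (τ.sub ω) (τ.eval ρ) := by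
  have cons : ∀ {ω : TySub} {ρ : Env}, (∀ κ n, Valid κ (ω κ n) (ρ κ n)) →
      ∀ {κ : Kind} {ψ : Ty κ} {S : Sem κ}, Valid κ ψ S →
      ∀ κ' n, Valid κ' (TySub.cons ψ ω κ' n) (Env.cons S ρ κ' n) := by
    intro ω ρ h κ ψ S hS κ' n
    by_cases e : κ' = κ
    · subst e
      cases n with
      | zero => simpa using hS
      | succ n => simpa using h _ n
    · simpa [e] using h _ n
  induction τ generalizing ω ρ with
  | var => exact h _ _
  | nat => exact cand_nat
  | app _ _ ih₁ ih₂ => exact ih₁ h _ _ (ih₂ h)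
  | arr _ _ ih₁ ih₂ => exact Cand.arrow (ih₁ h) (ih₂ h)
  | all κ τ ih =>
    refine Cand.all fun ψ S hS => ?_
    rw [sub_up_inst]
    exact ih (cons h hS)
  | lam κ φ ih =>
    intro ψ S hS
    have := ih (cons h hS)
    rw [← sub_up_inst] at this
    exact this.betaEq (Reds.betaEq (.single (Step.beta _ _))).symm

end Ty

/-- The fundamental theorem: instances of a typed term by reducible terms are reducible. -/
theorem HasType.mem_eval {Γ : Ctx} {t : Tm} {τ : Typ} (ht : HasType Γ t τ) {ω : TySub} {ρ : Env}
    (h : ∀ κ n, Valid κ (ω κ n) (ρ κ n)) {g : ℕ → Tm} (hg : ∀ x, g x ∈ (Γ x).eval ρ) :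
    (t.tsub ω).sub g ∈ τ.eval ρ := by
  induction ht generalizing ω ρ g with
  | var Γ x => exact hg x
  | sym Γ f =>
    cases f with
    | num n => exact Norm.sym _
    | add =>
      refine ⟨.sym _, fun ψ S hS => ⟨.tapp_sym _ _, fun a ha => ?_⟩⟩
      rw [Ty.eval, Env.cons_zero] at ha
      refine ⟨.op_left .add _ (Cand.norm hS a ha), fun b hb => ?_⟩
      rw [Ty.eval, Env.cons_zero] at hb ⊢
      exact Cand.bin hS .add _ .rfl _ ha _ hb
    | mul =>
      refine ⟨.sym _, fun ψ S hS => ⟨.tapp_sym _ _, fun a ha => ?_⟩⟩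
      rw [Ty.eval, Env.cons_zero] at ha
      refine ⟨.op_left .mul _ (Cand.norm hS a ha), fun b hb => ?_⟩
      rw [Ty.eval, Env.cons_zero] at hb ⊢
      exact Cand.bin hS .mul _ .rfl _ ha _ hb
    | flatten =>
      refine ⟨.sym _, fun ψ S hS => ⟨.tapp_sym _ _, fun a ha => ?_⟩⟩
      rw [Ty.eval, Env.cons_zero] at ha
      exact Cand.flatten hS _ .rfl _ ha
    | lift =>
      refine ⟨.sym _, fun ψ S hS => ⟨.tapp_sym _ _, fun a ha => ?_⟩⟩
      rw [Ty.eval, Env.cons_zero]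
      exact Cand.lift hS _ .rfl _ ha
  | @lam Γ σ τ t _ ih =>
    refine mem_arrowSet_of_lam (σ.valid_eval h) (τ.valid_eval h) fun a ha => ?_
    rw [sub_upSub_inst]
    exact ih h fun x => by
      cases x with
      | zero => exact ha
      | succ x => exact hg x
  | @tlam Γ κ τ t _ ih =>
    have cons : ∀ (ψ : Ty κ) (S : Sem κ), Valid κ ψ S →
        ∀ κ' n, Valid κ' (TySub.cons ψ ω κ' n) (Env.cons S ρ κ' n) := by
      intro ψ S hS κ' n
      by_cases e : κ' = κ
      · subst e
        cases n with
        | zero => simpa using hS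
        | succ n => simpa using h _ n
      · simpa [e] using h _ n
    refine mem_allSet_of_tlam (τ := τ.sub (ω.up κ)) (fun ψ S hS => ?_) fun ψ S hS => ?_
    · rw [Ty.sub_up_inst]
      exact τ.valid_eval (cons ψ S hS)
    · rw [← tinst_sub, tsub_up_inst]
      exact ih (cons ψ S hS) fun x => by
        rw [Ty.eval_ren, Env.cons_comp_shift]
        exact hg x
  | app _ _ ih₁ ih₂ => exact (ih₁ h hg).2 _ (ih₂ h hg)
  | tapp ψ _ ih =>
    rw [Ty.eval_inst]
    exact (ih h hg).2 _ _ (ψ.valid_eval h)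
  | conv _ e ih => exact e.eval_eq ρ ▸ ih h hg

theorem HasType.norm {Γ : Ctx} {t : Tm} {τ : Typ} (ht : HasType Γ t τ) : Norm false t := by
  have h : ∀ κ n, Valid κ (Ty.var κ n) (Sem.dflt κ) := fun κ n => valid_neutral (.var κ n)
  have := ht.mem_eval (ω := Ty.var) (ρ := fun κ _ => Sem.dflt κ) h (g := Tm.var) fun x =>
    ((Γ x).valid_eval h).neutral _ (.var _ _)
  rw [tsub_var, sub_var] at this
  exact (τ.valid_eval h).norm _ this

theorem HasType.exists_final {Γ : Ctx} {t : Tm} {τ : Typ} (ht : HasType Γ t τ)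
    (hc : t.IsClosed) : ∃ q, Reaches t q ∧ Final τ q ∧ q.IsClosed := by
  obtain ⟨q, h, hq⟩ := ht.norm.exists_nf
  have hc' := h.isClosed hc
  exact ⟨q, h, ⟨hc'.hasType (h.hasType _ _ ht) _, hc'.closed, hq.normal⟩, hc'⟩

/-! ### Expansion -/

namespace Tm

/-- `s` reduces to `s'`, up to conversion of the types that occur in the terms. -/
def Exp (s s' : Tm) : Prop := ∃ u, Reds s u ∧ Equiv u s'

theorem Red.of_equiv {s t u : Tm} (e : Equiv s t) (h : Red t u) : Red s u := by
  obtain ⟨a, b, e₁, h, e₂⟩ := h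
  exact ⟨a, b, e.trans e₁, h, e₂⟩

namespace Exp

theorem of_reds {s s' : Tm} (h : Reds s s') : Exp s s' := ⟨_, h, .refl _⟩

theorem of_equiv {s s' : Tm} (h : Equiv s s') : Exp s s' := ⟨_, .refl, h⟩

theorem refl (s : Tm) : Exp s s := ⟨_, .refl, .refl _⟩

theorem trans {s t u : Tm} (h : Exp s t) (h' : Exp t u) : Exp s u := by
  obtain ⟨a, h₁, e₁⟩ := h
  obtain ⟨b, h₂, e₂⟩ := h'
  rcases Relation.ReflTransGen.cases_head h₂ with rfl | ⟨c, hc, h₃⟩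
  · exact ⟨a, h₁, e₁.trans e₂⟩
  · exact ⟨b, h₁.trans (.head (hc.of_equiv e₁) h₃), e₂⟩

theorem app {s s' t t' : Tm} (h : Exp s s') (h' : Exp t t') : Exp (app s t) (app s' t') := by
  obtain ⟨a, h₁, e₁⟩ := h
  obtain ⟨b, h₂, e₂⟩ := h'
  exact ⟨_, (h₁.appL t).trans (h₂.appR a), .app e₁ e₂⟩

theorem tapp {s s' : Tm} (h : Exp s s') {κ : Kind} (ψ : Ty κ) : Exp (tapp s ψ) (tapp s' ψ) := by
  obtain ⟨a, h₁, e₁⟩ := h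
  exact ⟨_, h₁.tapp ψ, .tapp e₁ .rfl⟩

end Exp

theorem HStep.exp {s t : Tm} (h : HStep s t) : Exp s t := .of_reds h.reaches.reds

theorem Reaches.exp {s t : Tm} (h : Reaches s t) : Exp s t := .of_reds h.reds

theorem normal_num (n : ℕ) : (num n).Normal := (NF.sym _).normal

theorem HasNF.of_exp {s s' : Tm} {n : ℕ} (h : Exp s s') (h' : s'.HasNF (num n)) :
    s.HasNF (num n) := by
  obtain ⟨u, h₁, e⟩ := h.trans (.of_reds h'.1)
  cases e
  exact ⟨h₁, normal_num n⟩

theorem Normal.equiv {s t : Tm} (h : s.Normal) (e : Equiv s t) : t.Normal :=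
  fun _ h' => h _ (h'.of_equiv e)

theorem HasNF.bin {f : Sym} {op : ℕ → ℕ → ℕ} (hf : f.Op op) {ψ : Typ} (hψ : ψ.Reds .nat)
    {s t : Tm} {n m : ℕ} (hs : s.HasNF (num n)) (ht : t.HasNF (num m)) :
    (Tm.bin f ψ s t).HasNF (num (op n m)) :=
  .of_exp (.app (.app (.refl _) (.of_reds hs.1)) (.of_reds ht.1))
    ⟨(reaches_op_nat hf hψ n m).reds, normal_num _⟩

theorem exp_bin_arr_app {f : Sym} {op : ℕ → ℕ → ℕ} (hf : f.Op op) (σ τ : Typ) (s t q : Tm) :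
    Exp (.app (Tm.bin f (.arr σ τ) s t) q) (Tm.bin f τ (.app s q) (.app t q)) := by
  have h := HStep.appL q (.root (.op_arr hf (ψ := .arr σ τ) .refl s t))
  refine h.exp.trans ?_
  have h' := HStep.exp (.root (.beta σ (Tm.bin f τ (Tm.app (s.ren Nat.succ) (.var 0))
    (Tm.app (t.ren Nat.succ) (.var 0))) q))
  simpa only [Tm.sub, ren_succ_inst, instSub] using h'

theorem exp_bin_all_tapp {f : Sym} {op : ℕ → ℕ → ℕ} (hf : f.Op op) {κ : Kind} (τ : Typ)
    (s t : Tm) (ψ : Ty κ) :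
    Exp (.tapp (Tm.bin f (.all κ τ) s t) ψ) (Tm.bin f (τ.inst ψ) (.tapp s ψ) (.tapp t ψ)) := by
  have h := HStep.tappL ψ (.root (.op_all hf (ψ := .all κ τ) .refl s t))
  refine h.exp.trans ?_
  have h' := HStep.exp (.root (.tbeta (Tm.bin f τ (Tm.tapp (s.tren (TyRen.shift κ)) (.var κ 0))
    (Tm.tapp (t.tren (TyRen.shift κ)) (.var κ 0))) ψ))
  simp only [Tm.tsub, tren_shift_inst, Ty.sub] at h'
  rwa [show TySub.inst ψ κ 0 = ψ by simp [TySub.inst_eq_cons]] at h'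

theorem exp_lift_arr_app (σ τ : Typ) (s q : Tm) :
    Exp (.app (.lift (.arr σ τ) s) q) (.lift τ s) := by
  refine (HStep.appL q (.root (.lift_arr (ψ := .arr σ τ) .refl s))).exp.trans ?_
  have h' := HStep.exp (.root (.beta σ (.lift τ (s.ren Nat.succ)) q))
  simpa only [Tm.lift, Tm.sub, ren_succ_inst] using h'

theorem exp_lift_all_tapp {κ : Kind} (τ : Typ) (s : Tm) (ψ : Ty κ) :
    Exp (.tapp (.lift (.all κ τ) s) ψ) (.lift (τ.inst ψ) s) := by
  refine (HStep.tappL ψ (.root (.lift_all (ψ := .all κ τ) .refl s))).exp.trans ?_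
  have h' := HStep.exp (.root (.tbeta (.lift τ (s.tren (TyRen.shift κ))) ψ))
  simpa only [Tm.lift, Tm.tsub, tren_shift_inst, Ty.inst] using h'

end Tm

theorem Final.conv {σ τ : Typ} {q : Tm} (h : Final σ q) (e : σ.BetaEq τ) : Final τ q :=
  ⟨h.1.conv e, h.2⟩

theorem Final.exists_isClosed {σ : Typ} {q : Tm} (h : Final σ q) :
    ∃ q', Equiv q q' ∧ Final σ q' ∧ q'.IsClosed := by
  obtain ⟨h₁, ⟨q', e, hc⟩, hn⟩ := h
  exact ⟨q', e, ⟨h₁.equiv e, IsClosed.closed hc, hn.equiv e⟩, hc⟩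

theorem Ty.HasNF.of_arr {σ τ ν : Typ} (h : (Ty.arr σ τ).HasNF ν) :
    ∃ σ' τ', ν = .arr σ' τ' ∧ σ.HasNF σ' ∧ τ.HasNF τ' := by
  obtain ⟨σ', τ', rfl, h₁, h₂⟩ := Reds.of_arr h.1
  exact ⟨σ', τ', Eq.refl _, ⟨h₁, fun _ h' => h.2 _ (.arrL _ h')⟩, h₂, fun _ h' => h.2 _ (.arrR _ h')⟩

theorem Ty.HasNF.of_all {κ : Kind} {τ ν : Typ} (h : (Ty.all κ τ).HasNF ν) :
    ∃ τ', ν = .all κ τ' ∧ τ.HasNF τ' := by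
  obtain ⟨τ', rfl, h₁⟩ := Reds.of_all h.1
  exact ⟨τ', Eq.refl _, h₁, fun _ h' => h.2 _ (.all _ h')⟩

/-! ### The order at closed types that need not be normal -/

/-- The order at the normal form of `σ`. With it the rules of the order apply at every closed type,
with arbitrary closed terms as arguments (`OrdAt.app`). -/
def OrdAt (P : ℕ → ℕ → Prop) (σ : Typ) (s t : Tm) : Prop :=
  ∃ ν, σ.HasNF ν ∧ ClosedOrder P ν s t

/-- The closed order is a fixed point of its defining rules. -/
theorem isOrderCand_closedOrder (P : ℕ → ℕ → Prop) : IsOrderCand P (ClosedOrder P) := by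
  rintro σ s t ⟨R, hR, h'⟩
  rcases hR σ s t h' with h | ⟨τ₁, τ₂, rfl, h⟩ | ⟨κ, ρ, rfl, h⟩
  · exact .inl h
  · exact .inr (.inl ⟨τ₁, τ₂, rfl, fun q hq => ⟨R, hR, h q hq⟩⟩)
  · refine .inr (.inr ⟨κ, ρ, rfl, fun ψ hψ => ?_⟩)
    obtain ⟨ν, hν, h⟩ := h ψ hψ
    exact ⟨ν, hν, R, hR, h⟩

/-- The closure of a typed relation under expansion. -/
def UpTo (R : Typ → Tm → Tm → Prop) (σ : Typ) (s t : Tm) : Prop :=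
  ∃ s' t', Exp s s' ∧ Exp t t' ∧ R σ s' t'

theorem UpTo.of {R : Typ → Tm → Tm → Prop} {σ : Typ} {s t : Tm} (h : R σ s t) : UpTo R σ s t :=
  ⟨s, t, .refl _, .refl _, h⟩

namespace OrdAt

/-- Coinduction up to expansion, at types that need not be normal. -/
theorem coinduction {P : ℕ → ℕ → Prop} (R : Typ → Tm → Tm → Prop)
    (conv : ∀ σ σ' s t, σ.BetaEq σ' → R σ s t → UpTo R σ' s t)
    (nat : ∀ s t, R .nat s t → ∃ n m, s.HasNF (num n) ∧ t.HasNF (num m) ∧ P n m)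
    (arr : ∀ σ τ s t, R (.arr σ τ) s t → ∀ q, HasType (fun _ => .nat) q σ → q.IsClosed →
      UpTo R τ (.app s q) (.app t q))
    (all : ∀ κ τ s t, R (.all κ τ) s t → ∀ ψ : Ty κ, ψ.Closed →
      UpTo R (τ.inst ψ) (.tapp s ψ) (.tapp t ψ))
    {σ : Typ} {s t : Tm} (hσ : σ.Closed) (h : R σ s t) : OrdAt P σ s t := by
  have conv' : ∀ {σ σ' s t}, Ty.BetaEq σ σ' → UpTo R σ s t → UpTo R σ' s t := by
    rintro σ σ' s t e ⟨s₁, t₁, hs, ht, h⟩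
    obtain ⟨s₂, t₂, hs', ht', h⟩ := conv _ _ _ _ e h
    exact ⟨s₂, t₂, hs.trans hs', ht.trans ht', h⟩
  obtain ⟨ν, hν⟩ := Ty.exists_hasNF σ
  refine ⟨ν, hν, fun ν s t => ν.Closed ∧ (∀ ν', ¬ Ty.Step ν ν') ∧ UpTo R ν s t, ?_,
    hν.closed hσ, hν.2, conv _ _ _ _ hν.betaEq h⟩
  rintro ν s t ⟨hc, hn, s', t', hs, ht, h⟩
  rcases hc.exists_shape with h' | ⟨σ, τ, h'⟩ | ⟨κ, τ, h'⟩
  · cases Ty.eq_of_reds_of_normal h' hn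
    obtain ⟨n, m, h₁, h₂, h₃⟩ := nat _ _ h
    exact .inl ⟨rfl, n, m, h₁.of_exp hs, h₂.of_exp ht, h₃⟩
  · cases Ty.eq_of_reds_of_normal h' hn
    refine .inr (.inl ⟨σ, τ, rfl, fun q hq => ⟨fun κ a ha => hc κ a (.inr ha),
      fun _ h' => hn _ (.arrR _ h'), ?_⟩⟩)
    obtain ⟨q', e, hq', hqc⟩ := hq.exists_isClosed
    obtain ⟨s₂, t₂, hs', ht', h⟩ := arr _ _ _ _ h q' hq'.1 hqc
    exact ⟨s₂, t₂, (hs.app (.of_equiv e)).trans hs', (ht.app (.of_equiv e)).trans ht', h⟩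
  · cases Ty.eq_of_reds_of_normal h' hn
    refine .inr (.inr ⟨κ, τ, rfl, fun ψ hψ => ?_⟩)
    obtain ⟨ν, hν⟩ := Ty.exists_hasNF (τ.inst ψ)
    refine ⟨ν, hν, hν.closed ?_, hν.2, conv' hν.betaEq ?_⟩
    · intro κ' a ha
      rcases ha.of_inst with ha | ha
      · exact hc κ' a ha
      · exact hψ κ' a ha
    · obtain ⟨s₂, t₂, hs', ht', h⟩ := all _ _ _ _ h ψ hψ
      exact ⟨s₂, t₂, (hs.tapp ψ).trans hs', (ht.tapp ψ).trans ht', h⟩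

variable {P : ℕ → ℕ → Prop} {σ τ : Typ} {s t : Tm}

theorem conv (h : OrdAt P σ s t) (e : σ.BetaEq τ) : OrdAt P τ s t := by
  obtain ⟨ν, hν, h⟩ := h
  exact ⟨ν, hν.of_betaEq e, h⟩

theorem mono {Q : ℕ → ℕ → Prop} (hPQ : ∀ n m, P n m → Q n m) (h : OrdAt P σ s t) :
    OrdAt Q σ s t := by
  obtain ⟨ν, hν, R, hR, h⟩ := h
  refine ⟨ν, hν, R, fun σ s t h => ?_, h⟩
  rcases hR σ s t h with ⟨e, n, m, hn, hm, h⟩ | h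
  · exact .inl ⟨e, n, m, hn, hm, hPQ _ _ h⟩
  · exact .inr h

theorem of_nat (h : OrdAt P .nat s t) : ∃ n m, s.HasNF (num n) ∧ t.HasNF (num m) ∧ P n m := by
  obtain ⟨ν, hν, h⟩ := h
  cases Ty.Reds.of_nat hν.1
  rcases isOrderCand_closedOrder P _ _ _ h with ⟨_, h⟩ | ⟨_, _, e, _⟩ | ⟨_, _, e, _⟩
  · exact h
  · cases e
  · cases e

theorem app (h : OrdAt P (.arr σ τ) s t) {Γ : Ctx} {q : Tm} (hq : HasType Γ q σ)
    (hc : q.IsClosed) : OrdAt P τ (.app s q) (.app t q) := by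
  obtain ⟨ν, hν, h⟩ := h
  obtain ⟨σ', τ', rfl, hσ, hτ⟩ := hν.of_arr
  obtain ⟨v, hv, hf, _⟩ := hq.exists_final hc
  rcases isOrderCand_closedOrder P _ _ _ h with ⟨e, _⟩ | ⟨_, _, e, h⟩ | ⟨_, _, e, _⟩
  · cases e
  · cases e
    obtain ⟨R, hR, h⟩ := h v (hf.conv hσ.betaEq)
    have : ∀ {ν s t s' t'}, Exp s s' → Exp t t' → ClosedOrder P ν s' t' → ClosedOrder P ν s t := by
      intro ν s t s' t' hs ht h
      refine ⟨UpTo (ClosedOrder P), ?_, s', t', hs, ht, h⟩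
      rintro ν s t ⟨s', t', hs, ht, h⟩
      rcases isOrderCand_closedOrder P _ _ _ h with ⟨e, n, m, h₁, h₂, h₃⟩ | ⟨σ, τ, e, h⟩ |
        ⟨κ, τ, e, h⟩
      · exact .inl ⟨e, n, m, h₁.of_exp hs, h₂.of_exp ht, h₃⟩
      · exact .inr (.inl ⟨σ, τ, e, fun q hq =>
          ⟨_, _, hs.app (.refl q), ht.app (.refl q), h q hq⟩⟩)
      · refine .inr (.inr ⟨κ, τ, e, fun ψ hψ => ?_⟩)
        obtain ⟨ν, hν, h⟩ := h ψ hψ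
        exact ⟨ν, hν, _, _, hs.tapp ψ, ht.tapp ψ, h⟩
    exact ⟨τ', hτ, this ((Exp.refl s).app hv.exp) ((Exp.refl t).app hv.exp) ⟨R, hR, h⟩⟩
  · cases e

theorem tapp {κ : Kind} (h : OrdAt P (.all κ τ) s t) {ψ : Ty κ} (hψ : ψ.Closed) :
    OrdAt P (τ.inst ψ) (.tapp s ψ) (.tapp t ψ) := by
  obtain ⟨ν, hν, h⟩ := h
  obtain ⟨τ', rfl, hτ⟩ := hν.of_all
  rcases isOrderCand_closedOrder P _ _ _ h with ⟨e, _⟩ | ⟨_, _, e, _⟩ | ⟨_, _, e, h⟩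
  · cases e
  · cases e
  · cases e
    obtain ⟨ν, hν, h⟩ := h ψ hψ
    exact ⟨ν, hν.of_betaEq (hτ.betaEq.symm.inst .rfl), h⟩

theorem exp (hσ : σ.Closed) {s' t' : Tm} (hs : Exp s s') (ht : Exp t t') (h : OrdAt P σ s' t') :
    OrdAt P σ s t := by
  refine coinduction (UpTo (OrdAt P)) ?_ ?_ ?_ ?_ hσ ⟨s', t', hs, ht, h⟩
  · rintro σ σ' s t e ⟨s', t', hs, ht, h⟩
    exact .of ⟨s', t', hs, ht, h.conv e⟩
  · rintro s t ⟨s', t', hs, ht, h⟩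
    obtain ⟨n, m, h₁, h₂, h₃⟩ := h.of_nat
    exact ⟨n, m, h₁.of_exp hs, h₂.of_exp ht, h₃⟩
  · rintro σ τ s t ⟨s', t', hs, ht, h⟩ q hq hc
    exact .of ⟨_, _, hs.app (.refl q), ht.app (.refl q), h.app hq hc⟩
  · rintro κ τ s t ⟨s', t', hs, ht, h⟩ ψ hψ
    exact .of ⟨_, _, hs.tapp ψ, ht.tapp ψ, h.tapp hψ⟩

theorem equiv (hσ : σ.Closed) {s' t' : Tm} (hs : Equiv s s') (ht : Equiv t t')
    (h : OrdAt P σ s t) : OrdAt P σ s' t' := h.exp hσ (.of_equiv hs.symm) (.of_equiv ht.symm)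

theorem trans {Q S : ℕ → ℕ → Prop} (hPQ : ∀ n m k, P n m → Q m k → S n k) (hσ : σ.Closed) {u : Tm}
    (h : OrdAt P σ s t) (h' : OrdAt Q σ t u) : OrdAt S σ s u := by
  refine coinduction (fun σ s u => ∃ t, OrdAt P σ s t ∧ OrdAt Q σ t u) ?_ ?_ ?_ ?_ hσ ⟨t, h, h'⟩
  · rintro σ σ' s u e ⟨t, h, h'⟩
    exact .of ⟨t, h.conv e, h'.conv e⟩
  · rintro s u ⟨t, h, h'⟩
    obtain ⟨n, m, h₁, h₂, h₃⟩ := h.of_nat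
    obtain ⟨m', k, h₄, h₅, h₆⟩ := h'.of_nat
    cases h₂.num_unique h₄
    exact ⟨n, k, h₁, h₅, hPQ _ _ _ h₃ h₆⟩
  · rintro σ τ s u ⟨t, h, h'⟩ q hq hc
    exact .of ⟨_, h.app hq hc, h'.app hq hc⟩
  · rintro κ τ s u ⟨t, h, h'⟩ ψ hψ
    exact .of ⟨_, h.tapp hψ, h'.tapp hψ⟩

/-! ### Monotonicity of the function symbols -/

theorem bin {f : Sym} {op : ℕ → ℕ → ℕ} (hf : f.Op op) {Q S : ℕ → ℕ → Prop}
    (hop : ∀ n m k l, P n m → Q k l → S (op n k) (op m l)) (hσ : σ.Closed) {s' t' : Tm}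
    (h : OrdAt P σ s t) (h' : OrdAt Q σ s' t') :
    OrdAt S σ (Tm.bin f σ s s') (Tm.bin f σ t t') := by
  refine coinduction (fun σ u v => ∃ s t s' t', OrdAt P σ s t ∧ OrdAt Q σ s' t' ∧
    u = Tm.bin f σ s s' ∧ v = Tm.bin f σ t t') ?_ ?_ ?_ ?_ hσ ⟨s, t, s', t', h, h', rfl, rfl⟩
  · rintro σ σ' _ _ e ⟨s, t, s', t', h, h', rfl, rfl⟩
    exact ⟨_, _, .of_equiv (.app (.app (.tapp (.sym f) e) (.refl _)) (.refl _)),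
      .of_equiv (.app (.app (.tapp (.sym f) e) (.refl _)) (.refl _)), s, t, s', t', h.conv e,
      h'.conv e, rfl, rfl⟩
  · rintro _ _ ⟨s, t, s', t', h, h', rfl, rfl⟩
    obtain ⟨n, m, h₁, h₂, h₃⟩ := h.of_nat
    obtain ⟨k, l, h₄, h₅, h₆⟩ := h'.of_nat
    exact ⟨_, _, .bin hf .refl h₁ h₄, .bin hf .refl h₂ h₅, hop _ _ _ _ h₃ h₆⟩
  · rintro σ τ _ _ ⟨s, t, s', t', h, h', rfl, rfl⟩ q hq hc
    exact ⟨_, _, exp_bin_arr_app hf _ _ _ _ _, exp_bin_arr_app hf _ _ _ _ _, _, _, _, _,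
      h.app hq hc, h'.app hq hc, rfl, rfl⟩
  · rintro κ τ _ _ ⟨s, t, s', t', h, h', rfl, rfl⟩ ψ hψ
    exact ⟨_, _, exp_bin_all_tapp hf _ _ _ _, exp_bin_all_tapp hf _ _ _ _, _, _, _, _,
      h.tapp hψ, h'.tapp hψ, rfl, rfl⟩

theorem equiv_lift {σ' : Typ} (e : σ.BetaEq σ') (s : Tm) : Equiv (.lift σ s) (.lift σ' s) :=
  .app (.tapp (.sym _) e) (.refl _)

theorem lift (hσ : σ.Closed) (h : OrdAt P .nat s t) : OrdAt P σ (Tm.lift σ s) (Tm.lift σ t) := by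
  refine coinduction (fun σ u v => ∃ s t, OrdAt P .nat s t ∧ u = Tm.lift σ s ∧ v = Tm.lift σ t)
    ?_ ?_ ?_ ?_ hσ ⟨s, t, h, rfl, rfl⟩
  · rintro σ σ' _ _ e ⟨s, t, h, rfl, rfl⟩
    exact ⟨_, _, .of_equiv (equiv_lift e _), .of_equiv (equiv_lift e _), s, t, h, rfl, rfl⟩
  · rintro _ _ ⟨s, t, h, rfl, rfl⟩
    obtain ⟨n, m, h₁, h₂, h₃⟩ := h.of_nat
    exact ⟨n, m, h₁.of_exp (HStep.exp (.root (.lift_nat .refl _))),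
      h₂.of_exp (HStep.exp (.root (.lift_nat .refl _))), h₃⟩
  · rintro σ τ _ _ ⟨s, t, h, rfl, rfl⟩ q hq hc
    exact ⟨_, _, exp_lift_arr_app _ _ _ _, exp_lift_arr_app _ _ _ _, s, t, h, rfl, rfl⟩
  · rintro κ τ _ _ ⟨s, t, h, rfl, rfl⟩ ψ hψ
    exact ⟨_, _, exp_lift_all_tapp _ _ _, exp_lift_all_tapp _ _ _, s, t, h, rfl, rfl⟩

/-- A term above `lift k` has values that are at least `k`. -/
theorem and_of_lift {Q : ℕ → ℕ → Prop} (k : ℕ) (hσ : σ.Closed) (h : OrdAt P σ s t)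
    (h' : OrdAt Q σ s (Tm.lift σ (num k))) : OrdAt (fun n m => P n m ∧ Q n k) σ s t := by
  refine coinduction (fun σ s t => OrdAt P σ s t ∧ ∃ l, OrdAt Q σ s l ∧ Exp l (Tm.lift σ (num k)))
    ?_ ?_ ?_ ?_ hσ ⟨h, _, h', .refl _⟩
  · rintro σ σ' s t e ⟨h, l, h', hl⟩
    exact .of ⟨h.conv e, l, h'.conv e, hl.trans (.of_equiv (equiv_lift e _))⟩
  · rintro s t ⟨h, l, h', hl⟩
    obtain ⟨n, m, h₁, h₂, h₃⟩ := h.of_nat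
    obtain ⟨n', m', h₄, h₅, h₆⟩ := h'.of_nat
    cases h₁.num_unique h₄
    cases h₅.num_unique (HasNF.of_exp (hl.trans (HStep.exp (.root (.lift_nat .refl _))))
      ⟨.refl, normal_num k⟩)
    exact ⟨n, m, h₁, h₂, h₃, h₆⟩
  · rintro σ τ s t ⟨h, l, h', hl⟩ q hq hc
    exact .of ⟨h.app hq hc, _, h'.app hq hc,
      (hl.app (.refl q)).trans (exp_lift_arr_app _ _ _ _)⟩
  · rintro κ τ s t ⟨h, l, h', hl⟩ ψ hψ
    exact .of ⟨h.tapp hψ, _, h'.tapp hψ, (hl.tapp ψ).trans (exp_lift_all_tapp _ _ _)⟩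

end OrdAt

/-! ### Evaluation of closed terms of type `nat` -/

/-- `t` evaluates to `n` by weak head reduction. -/
inductive Ev : Tm → ℕ → Prop
  | num (n : ℕ) : Ev (num n) n
  | step {t t' : Tm} {n : ℕ} : HStep t t' → Ev t' n → Ev t n
  | op {f : Sym} {op : ℕ → ℕ → ℕ} (hf : f.Op op) {ψ : Typ} {s t : Tm} {n m : ℕ} :
      ψ.Reds .nat → Ev s n → Ev t m → Ev (Tm.bin f ψ s t) (op n m)

theorem Ev.hasNF {t : Tm} {n : ℕ} (h : Ev t n) : t.HasNF (.num n) := by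
  induction h with
  | num n => exact ⟨.refl, normal_num n⟩
  | step h _ ih => exact ih.of_exp h.exp
  | op hf hψ _ _ ih₁ ih₂ => exact .bin hf hψ ih₁ ih₂

theorem Tm.Norm.not_isClosed {t : Tm} (h : Norm true t) : ¬ t.IsClosed := fun hc => by
  generalize hb : true = b at h
  induction h with
  | var _ x => exact hc.1 x rfl
  | app _ _ _ ih =>
    exact ih ⟨fun x hx => hc.1 x (.inl hx), fun κ a ha => hc.2 κ a (.inl ha)⟩ rfl
  | tapp _ _ _ ih => exact ih ⟨fun x hx => hc.1 x hx, fun κ a ha => hc.2 κ a (.inl ha)⟩ rfl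
  | op_neutral _ _ h hn =>
    exact hn.not_closed (h.closed fun κ a ha => hc.2 κ a (.inl (.inl (.inr ha))))
  | flatten_neutral _ h hn =>
    exact hn.not_closed (h.closed fun κ a ha => hc.2 κ a (.inl (.inr ha)))
  | lift_neutral _ h hn =>
    exact hn.not_closed (h.closed fun κ a ha => hc.2 κ a (.inl (.inr ha)))
  | _ => cases hb

/-- In a closed term of type `nat` no type index is neutral, so that weak head reduction does not get
stuck before a number is reached. -/
theorem HasType.exists_ev {Γ : Ctx} {t : Tm} (ht : HasType Γ t .nat) (hc : t.IsClosed) :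
    ∃ n, Ev t n := by
  have key : ∀ {b : Bool} {t : Tm}, Norm b t → HasType Γ t .nat → t.IsClosed → ∃ n, Ev t n := by
    intro b t h
    induction h with
    | var b x => exact fun _ hc => (hc.1 x rfl).elim
    | app b h h' => exact fun _ hc => ((Norm.app true h h').not_isClosed hc).elim
    | tapp b ψ h => exact fun _ hc => ((Norm.tapp true ψ h).not_isClosed hc).elim
    | op_neutral b hf h hn h₁ h₂ =>
      exact fun _ hc => ((Norm.op_neutral true hf h hn h₁ h₂).not_isClosed hc).elim
    | flatten_neutral b h hn h₁ =>
      exact fun _ hc => ((Norm.flatten_neutral true h hn h₁).not_isClosed hc).elim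
    | lift_neutral b h hn h₁ =>
      exact fun _ hc => ((Norm.lift_neutral true h hn h₁).not_isClosed hc).elim
    | sym f =>
      intro ht _
      have e := ht.of_sym
      cases f with
      | num n => exact ⟨n, .num n⟩
      | _ => exact (Ty.not_nat_betaEq_all e.symm).elim
    | tapp_sym f ψ =>
      intro ht _
      obtain ⟨τ, h, e⟩ := ht.of_tapp
      have e' := h.of_sym
      cases f with
      | num n => exact (Ty.not_nat_betaEq_all e').elim
      | _ =>
        obtain ⟨rfl, e₁⟩ := e'.all_inj
        exact (Ty.not_nat_betaEq_arr ((e₁.inst (.rfl : ψ.BetaEq ψ)).trans e).symm).elim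
    | op_left hf ψ =>
      intro ht _
      obtain ⟨σ, h, _⟩ := ht.of_app
      exact (Ty.not_nat_betaEq_arr (h.of_tapp_sym hf.type).arr_inj.2.symm).elim
    | op_nat hf h _ _ ih₁ ih₂ =>
      intro ht hc
      obtain ⟨h₁, h₂, e⟩ := ht.of_bin hf
      obtain ⟨n, hn⟩ := ih₁ (h₁.conv e)
        ⟨fun x hx => hc.1 x (.inl (.inr hx)), fun κ a ha => hc.2 κ a (.inl (.inr ha))⟩
      obtain ⟨m, hm⟩ := ih₂ (h₂.conv e)
        ⟨fun x hx => hc.1 x (.inr hx), fun κ a ha => hc.2 κ a (.inr ha)⟩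
      exact ⟨_, .op hf h hn hm⟩
    | lam =>
      intro ht _
      obtain ⟨_, _, e⟩ := ht.of_lam
      exact (Ty.not_nat_betaEq_arr e.symm).elim
    | tlam =>
      intro ht _
      obtain ⟨_, _, e⟩ := ht.of_tlam
      exact (Ty.not_nat_betaEq_all e.symm).elim
    | exp h _ ih =>
      intro ht hc
      obtain ⟨n, hn⟩ := ih (h.reaches.hasType _ _ ht) (h.reaches.isClosed hc)
      exact ⟨n, .step h hn⟩
  exact key ht.norm ht hc

/-- `flatten` is monotone. The relation is followed along the evaluation of the smaller side, since
the type index need not become smaller. -/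
theorem OrdAt.flatten {P : ℕ → ℕ → Prop} {σ : Typ} (hσ : σ.Closed) {s t : Tm} {Γ : Ctx}
    (ht : HasType Γ t σ) (hc : t.IsClosed) (h : OrdAt P σ s t) :
    OrdAt P .nat (Tm.flatten σ s) (Tm.flatten σ t) := by
  have key : ∀ {u : Tm} {m : ℕ}, Ev u m → ∀ (σ : Typ) (s t : Tm), σ.Closed → u = Tm.flatten σ t →
      OrdAt P σ s t → ∃ n, (Tm.flatten σ s).HasNF (.num n) ∧ P n m := by
    intro u m hu
    induction hu with
    | num n => intro σ s t _ e; cases e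
    | op => intro σ s t _ e; cases e
    | @step u u' m hs hu' ih =>
      rintro σ s t hσ rfl h
      cases hs with
      | appL _ hs => cases hs with
        | root hs => cases hs
        | tappL _ hs => cases hs with | root hs => cases hs
      | root hs =>
        cases hs with
        | flatten_nat h' =>
          obtain ⟨n, m', h₁, h₂, h₃⟩ := (h.conv h'.betaEq).of_nat
          have e := h₂.num_unique hu'.hasNF
          exact ⟨n, h₁.of_exp (HStep.exp (.root (.flatten_nat h' _))), e ▸ h₃⟩
        | @flatten_arr _ σ₁ τ h' =>
          have hc := h'.closed hσ
          have hc₁ : σ₁.Closed := fun κ a ha => hc κ a (.inl ha)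
          obtain ⟨n, h₁, h₂⟩ := ih τ (.app s (.lift σ₁ (.num 0))) _ (fun κ a ha => hc κ a (.inr ha))
            rfl ((h.conv h'.betaEq).app (.lift (Γ := Γ) _ (.num _ _)) (.lift hc₁ (.sym _)))
          exact ⟨n, h₁.of_exp (HStep.exp (.root (.flatten_arr h' _))), h₂⟩
        | @flatten_all _ τ κ h' =>
          have hc := h'.closed hσ
          obtain ⟨n, h₁, h₂⟩ := ih _ (.tapp s (chi κ)) _ (fun κ' a ha => by
            rcases ha.of_inst with ha | ha
            · exact hc κ' a ha
            · exact chi_closed _ κ' a ha) rfl ((h.conv h'.betaEq).tapp (chi_closed κ))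
          exact ⟨n, h₁.of_exp (HStep.exp (.root (.flatten_all h' _))), h₂⟩
  obtain ⟨m, hm⟩ := (HasType.flatten ht).exists_ev
    ⟨fun x hx => hc.1 x (by simpa [Tm.flatten, Tm.Free] using hx), fun κ a ha => by
      rcases ha with (ha | ha) | ha
      · exact ha
      · exact hσ κ a ha
      · exact hc.2 κ a ha⟩
  obtain ⟨n, h₁, h₂⟩ := key hm σ s t hσ rfl h
  refine coinduction (fun σ u v => σ.BetaEq .nat ∧ u.HasNF (.num n) ∧ v.HasNF (.num m)) ?_ ?_ ?_ ?_
    (fun _ _ h => h) ⟨.rfl, h₁, hm.hasNF⟩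
  · exact fun σ σ' s t e h => .of ⟨e.symm.trans h.1, h.2⟩
  · exact fun s t h => ⟨n, m, h.2.1, h.2.2, h₂⟩
  · exact fun _ _ _ _ h => (Ty.not_nat_betaEq_arr h.1.symm).elim
  · exact fun _ _ _ _ h => (Ty.not_nat_betaEq_all h.1.symm).elim

theorem OrdAt.refl {Γ : Ctx} {σ : Typ} {t : Tm} (hσ : σ.Closed) (ht : HasType Γ t σ)
    (hc : t.IsClosed) : OrdAt (· ≥ ·) σ t t := by
  refine coinduction (fun σ s t => s = t ∧ HasType Γ t σ ∧ t.IsClosed) ?_ ?_ ?_ ?_ hσ ⟨rfl, ht, hc⟩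
  · rintro σ σ' s t e ⟨rfl, h, hc⟩
    exact .of ⟨rfl, h.conv e, hc⟩
  · rintro s t ⟨rfl, h, hc⟩
    obtain ⟨n, hn⟩ := h.exists_ev hc
    exact ⟨n, n, hn.hasNF, hn.hasNF, le_rfl⟩
  · rintro σ τ s t ⟨rfl, h, hc⟩ q hq hqc
    exact .of ⟨rfl, h.app (hqc.hasType hq _), hc.app hqc⟩
  · rintro κ τ s t ⟨rfl, h, hc⟩ ψ hψ
    exact .of ⟨rfl, h.tapp ψ, hc.tapp hψ⟩

/-! ### Weak monotonicity -/

/-- The substitution of closed terms of the declared types for all term variables. -/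
def Ground (Γ : Ctx) (g : ℕ → Tm) : Prop := ∀ x, (g x).IsClosed ∧ HasType Γ (g x) (Γ x)

theorem Ground.hasType {Γ : Ctx} {g : ℕ → Tm} (hg : Ground Γ g) {t : Tm} {τ : Typ}
    (ht : HasType Γ t τ) : HasType Γ (t.sub g) τ := ht.sub fun x _ => (hg x).2

theorem Ground.isClosed {Γ : Ctx} {g : ℕ → Tm} (hg : Ground Γ g) {t : Tm}
    (ht : ∀ κ a, ¬ t.TFree κ a) : (t.sub g).IsClosed := .sub_of ht fun x => (hg x).1

theorem Tm.tsub_eq_self {t : Tm} (ht : ∀ κ a, ¬ t.TFree κ a) (ω : TySub) : t.tsub ω = t := by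
  rw [tsub_congr (s' := Ty.var) t fun κ a h => (ht κ a h).elim, tsub_var]

theorem chiSub_closed (κ : Kind) (a : ℕ) : ((fun κ _ => chi κ : TySub) κ a).Closed := chi_closed κ

/-- In a closed context a term without type constructor variables also has a closed type. -/
theorem HasType.close {Γ : Ctx} (hΓ : ∀ x, (Γ x).Closed) {t : Tm} {τ : Typ} (h : HasType Γ t τ)
    (ht : ∀ κ a, ¬ t.TFree κ a) : HasType Γ t (τ.sub fun κ _ => chi κ) := by
  have := h.tsub fun κ _ => chi κ
  rw [tsub_eq_self ht] at this
  exact this.ctx fun x _ => by rw [(hΓ x).sub_eq]; exact .rfl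

theorem Tm.IsClosed.rigid {t : Tm} (h : t.IsClosed) : Rigid t := by
  induction t with
  | var x => exact (h.1 x rfl).elim
  | sym => exact .sym _
  | lam => exact .lam _ _
  | tlam => exact .tlam _ _
  | app _ _ ih =>
    exact .app _ (ih ⟨fun x hx => h.1 x (.inl hx), fun κ a ha => h.2 κ a (.inl ha)⟩)
  | tapp _ _ ih =>
    exact .tapp _ (ih ⟨fun x hx => h.1 x hx, fun κ a ha => h.2 κ a (.inl ha)⟩)

section

variable {Γ : Ctx} (hΓ : ∀ x, (Γ x).Closed) {g g' : ℕ → Tm} (hg : Ground Γ g) (hg' : Ground Γ g')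
  (hgg' : ∀ x, OrdAt (· ≥ ·) (Γ x) (g x) (g' x))

include hΓ hg hg' hgg'

/-- A variable at the head of a term is replaced by its value under the smaller substitution. -/
theorem exists_rigid {t : Tm} {τ : Typ} (hτ : τ.Closed) (h : HasType Γ t τ)
    (ht : ∀ κ a, ¬ t.TFree κ a) : ∃ t', Rigid t' ∧ HasType Γ t' τ ∧ (∀ κ a, ¬ t'.TFree κ a) ∧
      t'.sub g' = t.sub g' ∧ OrdAt (· ≥ ·) τ (t.sub g) (t'.sub g) := by
  induction t generalizing τ with
  | var x =>
    refine ⟨g' x, (hg' x).1.rigid, (hg' x).2.conv h.of_var, (hg' x).1.2, (hg' x).1.sub_eq _, ?_⟩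
    rw [(hg' x).1.sub_eq]
    exact (hgg' x).conv h.of_var
  | sym => exact ⟨_, .sym _, h, ht, rfl, .refl hτ (hg.hasType h) (hg.isClosed ht)⟩
  | lam => exact ⟨_, .lam _ _, h, ht, rfl, .refl hτ (hg.hasType h) (hg.isClosed ht)⟩
  | tlam => exact ⟨_, .tlam _ _, h, ht, rfl, .refl hτ (hg.hasType h) (hg.isClosed ht)⟩
  | app s u ih =>
    obtain ⟨σ, h₁, h₂⟩ := h.of_app
    have hs : ∀ κ a, ¬ s.TFree κ a := fun κ a ha => ht κ a (.inl ha)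
    have hu : ∀ κ a, ¬ u.TFree κ a := fun κ a ha => ht κ a (.inr ha)
    have h₁ := h₁.close hΓ hs
    have h₂ := h₂.close hΓ hu
    rw [Ty.sub, hτ.sub_eq] at h₁
    have hc : (Ty.arr (σ.sub fun κ _ => chi κ) τ).Closed :=
      fun κ a ha => Or.elim ha (Ty.closed_sub σ chiSub_closed κ a) (hτ κ a)
    obtain ⟨s', r, hs', hc, e, ho⟩ := ih hc h₁ hs
    exact ⟨.app s' u, .app _ r, hs'.app h₂, fun κ a ha => ha.elim (hc κ a) (hu κ a),
      by simp only [Tm.sub, e], ho.app (hg.hasType h₂) (hg.isClosed hu)⟩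
  | @tapp κ s ψ ih =>
    obtain ⟨ρ, h₁, h₂⟩ := h.of_tapp
    have hs : ∀ κ a, ¬ s.TFree κ a := fun κ a ha => ht κ a (.inl ha)
    have hψ : ψ.Closed := fun κ a ha => ht κ a (.inr ha)
    have h₁ := h₁.close hΓ hs
    have h₂ := h₂.sub_left fun κ _ => chi κ
    rw [hτ.sub_eq, Ty.inst_sub', hψ.sub_eq] at h₂
    obtain ⟨s', r, hs', hc, e, ho⟩ := ih (Ty.closed_sub (.all κ ρ) chiSub_closed) h₁ hs
    exact ⟨.tapp s' ψ, .tapp _ r, (hs'.tapp ψ).conv h₂, fun κ a ha => ha.elim (hc κ a) (hψ κ a),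
      by simp only [Tm.sub, e], (ho.tapp hψ).conv h₂⟩

/-- At type `nat`, a larger substitution gives a larger value. The evaluation of the smaller
instance is followed; each of its steps is one of the term itself, as soon as the head of the term
is not a variable. -/
theorem Ev.sub_ge {t : Tm} {n : ℕ} (h : HasType Γ t .nat) (ht : ∀ κ a, ¬ t.TFree κ a)
    (he : Ev (t.sub g') n) : ∃ m, n ≤ m ∧ (t.sub g).HasNF (.num m) := by
  have nat : Ty.nat.Closed := fun _ _ h => h
  -- It is enough to treat the terms whose head is not a variable.
  have key : ∀ {u : Tm} {n : ℕ}, (∀ t, Rigid t → HasType Γ t .nat → (∀ κ a, ¬ t.TFree κ a) →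
      t.sub g' = u → ∃ m, n ≤ m ∧ (t.sub g).HasNF (.num m)) →
      ∀ t, HasType Γ t .nat → (∀ κ a, ¬ t.TFree κ a) → t.sub g' = u →
      ∃ m, n ≤ m ∧ (t.sub g).HasNF (.num m) := by
    intro u n H t h ht e
    obtain ⟨t', r, h', hc, e', ho⟩ := exists_rigid hΓ hg hg' hgg' nat h ht
    obtain ⟨m, hm, hnf⟩ := H t' r h' hc (e'.trans e)
    obtain ⟨k, m', h₁, h₂, h₃⟩ := ho.of_nat
    cases h₂.num_unique hnf
    exact ⟨k, hm.trans h₃, h₁⟩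
  generalize e : t.sub g' = u at he
  induction he generalizing t with
  | num n =>
    refine key (fun t r _ _ e => ?_) t h ht e
    cases r.sub_eq_sym e
    exact ⟨n, le_rfl, .refl, normal_num n⟩
  | step hs _ ih =>
    refine key (fun t r h ht e => ?_) t h ht e
    subst e
    obtain ⟨t', hs', e⟩ := hs.of_sub r
    obtain ⟨m, hm, hnf⟩ := ih (hs'.reaches.hasType _ _ h)
      (fun κ a ha => ht κ a (hs'.reaches.tFree κ a ha)) e
    exact ⟨m, hm, hnf.of_exp (hs'.sub g).exp⟩
  | @op f op hf ψ s₁ s₂ n₁ n₂ hψ _ _ ih₁ ih₂ =>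
    refine key (fun t r h ht e => ?_) t h ht e
    obtain ⟨a, b, rfl, ha, hb⟩ := r.sub_eq_bin e
    obtain ⟨h₁, h₂, _⟩ := h.of_bin hf
    obtain ⟨m₁, hm₁, hnf₁⟩ := ih₁ (h₁.conv hψ.betaEq)
      (fun κ x hx => ht κ x (.inl (.inr hx))) ha
    obtain ⟨m₂, hm₂, hnf₂⟩ := ih₂ (h₂.conv hψ.betaEq) (fun κ x hx => ht κ x (.inr hx)) hb
    refine ⟨op m₁ m₂, ?_, .bin hf hψ hnf₁ hnf₂⟩
    cases hf with
    | add => exact Nat.add_le_add hm₁ hm₂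
    | mul => exact Nat.mul_le_mul hm₁ hm₂

/-- Typed terms are weakly monotone in their term variables. -/
theorem OrdAt.sub_ge {t : Tm} {τ : Typ} (hτ : τ.Closed) (h : HasType Γ t τ)
    (ht : ∀ κ a, ¬ t.TFree κ a) : OrdAt (· ≥ ·) τ (t.sub g) (t.sub g') := by
  refine coinduction (fun τ s s' => ∃ t, HasType Γ t τ ∧ (∀ κ a, ¬ t.TFree κ a) ∧ s = t.sub g ∧
    s' = t.sub g') ?_ ?_ ?_ ?_ hτ ⟨t, h, ht, rfl, rfl⟩
  · rintro τ τ' _ _ e ⟨t, h, ht, rfl, rfl⟩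
    exact .of ⟨t, h.conv e, ht, rfl, rfl⟩
  · rintro _ _ ⟨t, h, ht, rfl, rfl⟩
    obtain ⟨n, hn⟩ := (hg'.hasType h).exists_ev (hg'.isClosed ht)
    obtain ⟨m, hm, hnf⟩ := hn.sub_ge hΓ hg hg' hgg' h ht
    exact ⟨m, n, hnf, hn.hasNF, hm⟩
  · rintro σ τ _ _ ⟨t, h, ht, rfl, rfl⟩ q hq hc
    exact .of ⟨.app t q, h.app (hc.hasType hq _), fun κ a ha => ha.elim (ht κ a) (hc.2 κ a),
      by simp only [Tm.sub, hc.sub_eq], by simp only [Tm.sub, hc.sub_eq]⟩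
  · rintro κ τ _ _ ⟨t, h, ht, rfl, rfl⟩ ψ hψ
    exact .of ⟨.tapp t ψ, h.tapp ψ, fun κ a ha => ha.elim (ht κ a) (hψ κ a), rfl, rfl⟩

end

/-! ### Closures by terms without free variables -/

/-- The closures `γ ∘ ω` in which each `γ x` is a representative without free variables. -/
structure GroundClosure (Γ : Ctx) (ω : TySub) (γ : ℕ → Tm) : Prop where
  closed : ∀ κ a, (ω κ a).Closed
  ground : Ground (fun x => (Γ x).sub ω) γ

namespace GroundClosure

variable {Γ : Ctx} {ω : TySub} {γ : ℕ → Tm} (h : GroundClosure Γ ω γ)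

include h

theorem closed_sub (σ : Typ) : (σ.sub ω).Closed := Ty.closed_sub σ h.closed

theorem not_tFree (t : Tm) (κ : Kind) (a : ℕ) : ¬ (t.tsub ω).TFree κ a := fun ha => by
  obtain ⟨κ', b, _, ha⟩ := ha.of_tsub
  exact h.closed κ' b κ a ha

theorem isClosed (t : Tm) : ((t.tsub ω).sub γ).IsClosed := h.ground.isClosed (h.not_tFree t)

theorem hasType {t : Tm} {σ : Typ} (ht : HasType Γ t σ) :
    HasType (fun x => (Γ x).sub ω) ((t.tsub ω).sub γ) (σ.sub ω) := h.ground.hasType (ht.tsub ω)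

theorem update (x : ℕ) {q : Tm} (hc : q.IsClosed)
    (hq : HasType (fun x => (Γ x).sub ω) q ((Γ x).sub ω)) :
    GroundClosure Γ ω (Function.update γ x q) where
  closed := h.closed
  ground y := by
    by_cases e : y = x
    · subst e
      simpa using ⟨hc, hq⟩
    · simpa [e] using h.ground y

theorem update_of_hasType (x : ℕ) {s : Tm} (hs : HasType Γ s (Γ x)) :
    GroundClosure Γ ω (Function.update γ x ((s.tsub ω).sub γ)) :=
  h.update x (h.isClosed s) (h.hasType hs)

/-- Terms are weakly monotone in each variable. -/
theorem ordAt_update_ge {x : ℕ} {q q' : Tm} (hq : GroundClosure Γ ω (Function.update γ x q))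
    (hq' : GroundClosure Γ ω (Function.update γ x q')) (ho : OrdAt (· > ·) ((Γ x).sub ω) q q')
    {t : Tm} {σ : Typ} (ht : HasType Γ t σ) :
    OrdAt (· ≥ ·) (σ.sub ω) ((t.tsub ω).sub (Function.update γ x q))
      ((t.tsub ω).sub (Function.update γ x q')) := by
  refine OrdAt.sub_ge (fun x => h.closed_sub (Γ x)) hq.ground hq'.ground (fun y => ?_)
    (h.closed_sub σ) (ht.tsub ω) (h.not_tFree t)
  by_cases e : y = x
  · subst e
    simpa using ho.mono fun _ _ => le_of_lt
  · simpa [e] using OrdAt.refl (h.closed_sub (Γ y)) (h.ground y).2 (h.ground y).1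

end GroundClosure

theorem order_iff {P : ℕ → ℕ → Prop} {Γ : Ctx} {σ : Typ} {s t : Tm} :
    Order P Γ σ s t ↔ ∀ ω γ, GroundClosure Γ ω γ →
      OrdAt P (σ.sub ω) ((s.tsub ω).sub γ) ((t.tsub ω).sub γ) := by
  refine ⟨fun h ω γ hc => h ω γ ⟨hc.closed, fun x => ⟨(hc.ground x).1.closed, (hc.ground x).2⟩⟩,
    fun h ω γ ⟨hω, hγ⟩ => ?_⟩
  have : ∀ x, ∃ q, Equiv (γ x) q ∧ q.IsClosed := fun x => (hγ x).1
  choose γ' e hc using this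
  have e' := fun x => (e x).symm
  exact (h ω γ' ⟨hω, fun x => ⟨hc x, (hγ x).2.equiv (e x)⟩⟩).equiv (Ty.closed_sub σ hω)
    ((Tm.Equiv.refl _).sub e') ((Tm.Equiv.refl _).sub e')

theorem Tm.subst_tsub_sub (t : Tm) (x : ℕ) (s : Tm) (ω : TySub) (γ : ℕ → Tm) :
    ((t.subst x s).tsub ω).sub γ = (t.tsub ω).sub (Function.update γ x ((s.tsub ω).sub γ)) := by
  rw [Tm.subst, tsub_of_sub, sub_sub]
  congr 1
  funext y
  by_cases e : y = x
  · subst e; simp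
  · simp [e, Tm.tsub, Tm.sub]

theorem safe_iff {Γ : Ctx} {σ : Typ} {t : Tm} {x : ℕ} :
    Safe Γ σ t x ↔ HasType Γ t σ ∧ ∀ s₁ s₂, HasType Γ s₁ (Γ x) → HasType Γ s₂ (Γ x) →
      Succ Γ (Γ x) s₁ s₂ → ∀ ω γ, GroundClosure Γ ω γ → OrdAt (· > ·) (σ.sub ω)
        ((t.tsub ω).sub (Function.update γ x ((s₁.tsub ω).sub γ)))
        ((t.tsub ω).sub (Function.update γ x ((s₂.tsub ω).sub γ))) := by
  simp only [Safe, Succ, order_iff, subst_tsub_sub]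

/-! ### Applications of a variable -/

/-- The terms `x u₁ … u_m`. -/
inductive HeadVar (x : ℕ) : Tm → Prop
  | var : HeadVar x (.var x)
  | app {s : Tm} (t : Tm) : HeadVar x s → HeadVar x (.app s t)
  | tapp {s : Tm} {κ : Kind} (ψ : Ty κ) : HeadVar x s → HeadVar x (.tapp s ψ)

theorem HeadVar.spine {x : ℕ} {h : Tm} (hh : HeadVar x h) (us : List (Tm ⊕ (Σ κ : Kind, Ty κ))) :
    HeadVar x (PolyInterp.spine h us) := by
  induction us generalizing h with
  | nil => exact hh
  | cons u us ih =>
    rcases u with u | ⟨κ, ψ⟩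
    · exact ih (.app u hh)
    · exact ih (.tapp ψ hh)

theorem HeadVar.tsub {x : ℕ} {t : Tm} (h : HeadVar x t) (ω : TySub) : HeadVar x (t.tsub ω) := by
  induction h with
  | var => exact .var
  | app _ _ ih => exact .app _ ih
  | tapp _ _ ih => exact .tapp _ ih

theorem HeadVar.ordAt_gt {Γ : Ctx} (hΓ : ∀ x, (Γ x).Closed) {g g' : ℕ → Tm} (hg : Ground Γ g)
    (hg' : Ground Γ g') (hgg' : ∀ x, OrdAt (· ≥ ·) (Γ x) (g x) (g' x)) {x : ℕ}
    (hx : OrdAt (· > ·) (Γ x) (g x) (g' x)) {t : Tm} (h : HeadVar x t) {τ : Typ} (hτ : τ.Closed)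
    (ht : HasType Γ t τ) (hc : ∀ κ a, ¬ t.TFree κ a) :
    OrdAt (· > ·) τ (t.sub g) (t.sub g') := by
  induction h generalizing τ with
  | var => exact hx.conv ht.of_var
  | @app s u _ ih =>
    obtain ⟨σ, h₁, h₂⟩ := ht.of_app
    have hs : ∀ κ a, ¬ s.TFree κ a := fun κ a ha => hc κ a (.inl ha)
    have hu : ∀ κ a, ¬ u.TFree κ a := fun κ a ha => hc κ a (.inr ha)
    have h₁ := h₁.close hΓ hs
    have h₂ := h₂.close hΓ hu
    rw [Ty.sub, hτ.sub_eq] at h₁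
    have hc : (Ty.arr (σ.sub fun κ _ => chi κ) τ).Closed :=
      fun κ a ha => Or.elim ha (Ty.closed_sub σ chiSub_closed κ a) (hτ κ a)
    -- First the head becomes smaller, then the argument of the smaller head.
    refine ((ih hc h₁ hs).app (hg.hasType h₂) (hg.isClosed hu)).trans
      (fun n m k (h : n > m) (h' : m ≥ k) => lt_of_le_of_lt h' h) hτ ?_
    have hs' := hg'.isClosed hs
    have := OrdAt.sub_ge hΓ hg hg' hgg' (t := .app (s.sub g') u) hτ ((hg'.hasType h₁).app h₂)
      fun κ a ha => ha.elim (hs'.2 κ a) (hu κ a)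
    simpa only [Tm.sub, hs'.sub_eq] using this
  | @tapp s κ ψ _ ih =>
    obtain ⟨ρ, h₁, h₂⟩ := ht.of_tapp
    have hs : ∀ κ a, ¬ s.TFree κ a := fun κ a ha => hc κ a (.inl ha)
    have hψ : ψ.Closed := fun κ a ha => hc κ a (.inr ha)
    have h₁ := h₁.close hΓ hs
    have h₂ := h₂.sub_left fun κ _ => chi κ
    rw [hτ.sub_eq, Ty.inst_sub', hψ.sub_eq] at h₂
    exact ((ih (Ty.closed_sub (.all κ ρ) chiSub_closed) h₁ hs).tapp hψ).conv h₂

theorem HeadVar.safe {Γ : Ctx} {x : ℕ} {t : Tm} (h : HeadVar x t) {σ : Typ} (ht : HasType Γ t σ) :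
    Safe Γ σ t x := by
  refine safe_iff.2 ⟨ht, fun s₁ s₂ h₁ h₂ hs ω γ hc => ?_⟩
  have ho := order_iff.1 hs ω γ hc
  refine (h.tsub ω).ordAt_gt (fun x => hc.closed_sub (Γ x)) (hc.update_of_hasType x h₁).ground
    (hc.update_of_hasType x h₂).ground (fun y => ?_) (by simpa using ho) (hc.closed_sub σ)
    (ht.tsub ω) (hc.not_tFree t)
  exact hc.ordAt_update_ge (hc.update_of_hasType x h₁) (hc.update_of_hasType x h₂) ho (.var Γ y)

/-! ### Function symbols -/

section

variable {Γ : Ctx} {σ : Typ} {x : ℕ}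

theorem Safe.lift {t : Tm} (h : Safe Γ .nat t x) (σ : Typ) : Safe Γ σ (.lift σ t) x := by
  obtain ⟨ht, h⟩ := safe_iff.1 h
  exact safe_iff.2 ⟨.lift σ ht, fun s₁ s₂ h₁ h₂ hs ω γ hc =>
    (h s₁ s₂ h₁ h₂ hs ω γ hc).lift (hc.closed_sub σ)⟩

theorem Safe.flatten {t : Tm} (h : Safe Γ σ t x) : Safe Γ .nat (.flatten σ t) x := by
  obtain ⟨ht, h⟩ := safe_iff.1 h
  refine safe_iff.2 ⟨.flatten ht, fun s₁ s₂ h₁ h₂ hs ω γ hc => ?_⟩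
  have hc₂ := hc.update_of_hasType x h₂
  exact (h s₁ s₂ h₁ h₂ hs ω γ hc).flatten (hc.closed_sub σ) (hc₂.hasType ht) (hc₂.isClosed t)

theorem Safe.oplus_left {s t : Tm} (ht : HasType Γ t σ) (h : Safe Γ σ s x) :
    Safe Γ σ (.oplus σ s t) x := by
  obtain ⟨hs, h⟩ := safe_iff.1 h
  refine safe_iff.2 ⟨.bin .add hs ht, fun s₁ s₂ h₁ h₂ hss ω γ hc => ?_⟩
  exact (h s₁ s₂ h₁ h₂ hss ω γ hc).bin (S := (· > ·)) .add
    (fun n m k l (hnm : n > m) (hkl : k ≥ l) => Nat.add_lt_add_of_lt_of_le hnm hkl)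
    (hc.closed_sub σ) (hc.ordAt_update_ge (hc.update_of_hasType x h₁) (hc.update_of_hasType x h₂)
      (order_iff.1 hss ω γ hc) ht)

theorem Safe.oplus_right {s t : Tm} (hs : HasType Γ s σ) (h : Safe Γ σ t x) :
    Safe Γ σ (.oplus σ s t) x := by
  obtain ⟨ht, h⟩ := safe_iff.1 h
  refine safe_iff.2 ⟨.bin .add hs ht, fun s₁ s₂ h₁ h₂ hss ω γ hc => ?_⟩
  exact (hc.ordAt_update_ge (hc.update_of_hasType x h₁) (hc.update_of_hasType x h₂)
    (order_iff.1 hss ω γ hc) hs).bin (S := (· > ·)) .add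
    (fun n m k l (hnm : n ≥ m) (hkl : k > l) => Nat.add_lt_add_of_le_of_lt hnm hkl)
    (hc.closed_sub σ) (h s₁ s₂ h₁ h₂ hss ω γ hc)

theorem Safe.otimes_left {s t : Tm} (ht : HasType Γ t σ) (h : Safe Γ σ s x)
    (ht' : SuccEq Γ σ t (.lift σ (.num 1))) : Safe Γ σ (.otimes σ s t) x := by
  obtain ⟨hs, h⟩ := safe_iff.1 h
  refine safe_iff.2 ⟨.bin .mul hs ht, fun s₁ s₂ h₁ h₂ hss ω γ hc => ?_⟩
  have hc₁ := hc.update_of_hasType x h₁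
  have hge := hc.ordAt_update_ge hc₁ (hc.update_of_hasType x h₂) (order_iff.1 hss ω γ hc) ht
  exact (h s₁ s₂ h₁ h₂ hss ω γ hc).bin (S := (· > ·)) .mul
    (fun n m k l (hnm : n > m) hkl => lt_of_le_of_lt (Nat.mul_le_mul_left m hkl.1)
      (Nat.mul_lt_mul_of_pos_right hnm hkl.2)) (hc.closed_sub σ)
    (hge.and_of_lift 1 (hc.closed_sub σ) (order_iff.1 ht' ω _ hc₁))

theorem Safe.otimes_right {s t : Tm} (hs : HasType Γ s σ) (h : Safe Γ σ t x)
    (hs' : SuccEq Γ σ s (.lift σ (.num 1))) : Safe Γ σ (.otimes σ s t) x := by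
  obtain ⟨ht, h⟩ := safe_iff.1 h
  refine safe_iff.2 ⟨.bin .mul hs ht, fun s₁ s₂ h₁ h₂ hss ω γ hc => ?_⟩
  have hc₁ := hc.update_of_hasType x h₁
  have hge := hc.ordAt_update_ge hc₁ (hc.update_of_hasType x h₂) (order_iff.1 hss ω γ hc) hs
  exact (hge.and_of_lift 1 (hc.closed_sub σ) (order_iff.1 hs' ω _ hc₁)).bin (S := (· > ·)) .mul
    (fun n m k l hnm (hkl : k > l) => lt_of_le_of_lt (Nat.mul_le_mul_right l hnm.1)
      (Nat.mul_lt_mul_of_pos_left hkl hnm.2)) (hc.closed_sub σ)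
    (h s₁ s₂ h₁ h₂ hss ω γ hc)

end

/-! ### Separating a term from the terms substituted into it -/

theorem exists_bound_of_lt {p : ℕ → ℕ → Prop} (h : ∀ w, ∃ B, ∀ a, p w a → a < B) (N : ℕ) :
    ∃ B, ∀ w < N, ∀ a, p w a → a < B := by
  choose f hf using h
  refine ⟨(Finset.range N).sup f, fun w hw a ha => lt_of_lt_of_le (hf w a ha) ?_⟩
  exact Finset.le_sup (f := f) (Finset.mem_range.2 hw)

/-- In the definition of safety, the closure of `t` and that of the terms substituted into it may
be chosen independently, as long as they agree on the type of `x`: the free variables of the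
substituted terms can be renamed away from those of `t`. -/
theorem Safe.ordAt_of_closures {Γ : Ctx} (hΓ : ∀ τ : Typ, {y : ℕ | (Γ y).BetaEq τ}.Infinite)
    {x : ℕ} {σ : Typ} {t : Tm} (h : Safe Γ σ t x) {s₁ s₂ : Tm} (h₁ : HasType Γ s₁ (Γ x))
    (h₂ : HasType Γ s₂ (Γ x)) (hs : Succ Γ (Γ x) s₁ s₂) {ω ω' : TySub} {γ γ' : ℕ → Tm}
    (hc : GroundClosure Γ ω γ) (hc' : GroundClosure Γ ω' γ')
    (hx : t.Free x → ∃ ρ, (Γ x).BetaEq ρ ∧ ∀ κ a, ρ.Free κ a → ω κ a = ω' κ a) :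
    OrdAt (· > ·) (σ.sub ω') ((t.tsub ω').sub (Function.update γ' x ((s₁.tsub ω).sub γ)))
      ((t.tsub ω').sub (Function.update γ' x ((s₂.tsub ω).sub γ))) := by
  classical
  obtain ⟨ht, h⟩ := safe_iff.1 h
  by_cases hxt : t.Free x
  swap
  · have e : ∀ q, (t.tsub ω').sub (Function.update γ' x q) = (t.tsub ω').sub γ' := fun q =>
      sub_congr _ fun y hy =>
      Function.update_of_ne (by rintro rfl; exact hxt (free_tsub.1 hy)) _ _
    have := h s₁ s₂ h₁ h₂ hs ω' γ' hc'
    simpa only [e] using this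
  obtain ⟨ρ, hρ, hω⟩ := hx hxt
  obtain ⟨N, hN⟩ := t.exists_free_bound
  -- All type constructor variables that matter for `t` have indices below `B`.
  obtain ⟨B, hBρ, hBσ, hBt, hBΓ⟩ : ∃ B, (∀ κ a, ρ.Free κ a → a < B) ∧
      (∀ κ a, σ.Free κ a → a < B) ∧ (∀ κ a, t.TFree κ a → a < B) ∧
      ∀ w < N, ∀ κ a, (Γ w).Free κ a → a < B := by
    obtain ⟨B₁, hB₁⟩ := ρ.exists_free_bound
    obtain ⟨B₂, hB₂⟩ := σ.exists_free_bound
    obtain ⟨B₃, hB₃⟩ := t.exists_tFree_bound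
    obtain ⟨B₄, hB₄⟩ := exists_bound_of_lt (p := fun w a => ∃ κ, (Γ w).Free κ a) (fun w => by
      obtain ⟨B, hB⟩ := (Γ w).exists_free_bound
      exact ⟨B, fun a ⟨κ, ha⟩ => hB κ a ha⟩) N
    refine ⟨B₁ + B₂ + B₃ + B₄, fun κ a ha => ?_, fun κ a ha => ?_, fun κ a ha => ?_,
      fun w hw κ a ha => ?_⟩
    · have := hB₁ κ a ha; omega
    · have := hB₂ κ a ha; omega
    · have := hB₃ κ a ha; omega
    · have := hB₄ w hw a ⟨κ, ha⟩; omega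
  -- The other type constructor variables of the substituted terms are moved to indices from `B` on,
  -- and the term variables to indices from `N` on.
  let π : TyRen := fun κ a => if ρ.Free κ a then a else a + B
  obtain ⟨θ, hθ, hθΓ⟩ : ∃ θ : ℕ → ℕ, StrictMono θ ∧
      ∀ z, (Γ (θ z)).BetaEq ((Γ z).ren π) ∧ N ≤ θ z := by
    refine Filter.extraction_forall_of_frequently
      (P := fun z y => (Γ y).BetaEq ((Γ z).ren π) ∧ N ≤ y) fun z => ?_
    have := Nat.frequently_atTop_iff_infinite.2 (hΓ ((Γ z).ren π))
    exact this.and_eventually (Filter.eventually_ge_atTop N)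
  have hρπ : ρ.ren π = ρ := by
    rw [Ty.ren_congr (r' := fun _ a => a) ρ fun κ a ha => if_pos ha, Ty.ren_eq_sub, Ty.sub_var]
  have hΓπ : ((Γ x).ren π).BetaEq (Γ x) := by
    have := hρ.ren π
    rw [hρπ] at this
    exact this.trans hρ.symm
  have typed : ∀ {s : Tm}, HasType Γ s (Γ x) → HasType Γ ((s.tren π).ren θ) (Γ x) :=
    fun hs => ((hs.tren π).ren fun z _ => (hθΓ z).1.symm).conv hΓπ
  have close : ∀ (s : Tm) (ω : TySub) (γ : ℕ → Tm), (((s.tren π).ren θ).tsub ω).sub γ =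
      (s.tsub fun κ a => ω κ (π κ a)).sub fun z => γ (θ z) := fun s ω γ => by
    rw [tsub_of_ren, sub_of_ren, tsub_of_tren]
  have sub_π : ∀ (ω : TySub) (z : ℕ),
      ((Γ (θ z)).sub ω).BetaEq ((Γ z).sub fun κ a => ω κ (π κ a)) := fun ω z => by
    have := (hθΓ z).1.sub_left ω
    rwa [Ty.sub_of_ren] at this
  have succ : Succ Γ (Γ x) ((s₁.tren π).ren θ) ((s₂.tren π).ren θ) := by
    refine order_iff.2 fun ω₀ γ₀ hc₀ => ?_
    rw [close, close]
    refine (order_iff.1 hs (fun κ a => ω₀ κ (π κ a)) (fun z => γ₀ (θ z))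
      ⟨fun κ a => hc₀.closed κ _, fun z => ⟨(hc₀.ground (θ z)).1, ?_⟩⟩).conv ?_
    · exact ((hc₀.ground (θ z)).1.hasType (hc₀.ground (θ z)).2 _).conv (sub_π ω₀ z)
    · have := hΓπ.sub_left ω₀
      rwa [Ty.sub_of_ren] at this
  -- A closure that acts as `γ' ∘ ω'` on `t` and as `γ ∘ ω` on the renamed terms.
  let ω'' : TySub := fun κ a => if a < B then ω' κ a else ω κ (a - B)
  let γ'' : ℕ → Tm := fun w => if w < N then γ' w else
    if hw : ∃ z, θ z = w then γ hw.choose else .lift ((Γ w).sub ω'') (.num 0)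
  have hω'' : ∀ κ a, (ω'' κ a).Closed := fun κ a => by
    by_cases ha : a < B
    · simpa only [ω'', if_pos ha] using hc'.closed κ a
    · simpa only [ω'', if_neg ha] using hc.closed κ _
  have eω : (fun κ a => ω'' κ (π κ a)) = ω := by
    funext κ a
    by_cases ha : ρ.Free κ a
    · simp only [ω'', π, if_pos ha, if_pos (hBρ κ a ha), hω κ a ha]
    · simp [ω'', π, if_neg ha]
  have eω' : ∀ κ a, a < B → ω'' κ a = ω' κ a := fun κ a ha => if_pos ha
  have eγ : ∀ z, γ'' (θ z) = γ z := fun z => by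
    have hw : ∃ z', θ z' = θ z := ⟨z, rfl⟩
    simp only [γ'', if_neg (not_lt.2 (hθΓ z).2), dif_pos hw, hθ.injective hw.choose_spec]
  have hc'' : GroundClosure Γ ω'' γ'' := by
    refine ⟨hω'', fun w => ?_⟩
    by_cases hw : w < N
    · have e : (Γ w).sub ω'' = (Γ w).sub ω' :=
        Ty.sub_congr _ fun κ a ha => eω' κ a (hBΓ w hw κ a ha)
      simp only [γ'', if_pos hw, e]
      exact ⟨(hc'.ground w).1, (hc'.ground w).1.hasType (hc'.ground w).2 _⟩
    · by_cases hw' : ∃ z, θ z = w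
      · obtain ⟨z, rfl⟩ := hw'
        rw [eγ]
        refine ⟨(hc.ground z).1, ((hc.ground z).1.hasType (hc.ground z).2 _).conv ?_⟩
        have := sub_π ω'' z
        rw [eω] at this
        exact this.symm
      · simp only [γ'', if_neg hw, dif_neg hw']
        exact ⟨.lift (Ty.closed_sub _ hω'') (.sym _), .lift _ (.num _ _)⟩
  have res := h _ _ (typed h₁) (typed h₂) succ ω'' γ'' hc''
  rw [close, close, eω, Ty.sub_congr σ fun κ a ha => eω' κ a (hBσ κ a ha),
    tsub_congr t fun κ a ha => eω' κ a (hBt κ a ha)] at res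
  simp only [eγ] at res
  have e : ∀ q, (t.tsub ω').sub (Function.update γ'' x q) =
      (t.tsub ω').sub (Function.update γ' x q) := fun q => sub_congr _ fun y hy => by
    by_cases e : y = x
    · subst e; simp
    · simp [e, γ'', hN y (free_tsub.1 hy)]
  simpa only [e] using res

/-! ### Abstractions -/

theorem OrdAt.of_app {P : ℕ → ℕ → Prop} {σ τ : Typ} (hc : (Ty.arr σ τ).Closed) {s t : Tm}
    (h : ∀ q, HasType (fun _ => .nat) q σ → q.IsClosed → OrdAt P τ (.app s q) (.app t q)) :
    OrdAt P (.arr σ τ) s t := by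
  refine coinduction (fun ρ s t => OrdAt P ρ s t ∨ ∃ σ τ, ρ.BetaEq (.arr σ τ) ∧
    ∀ q, HasType (fun _ => .nat) q σ → q.IsClosed → OrdAt P τ (.app s q) (.app t q))
    ?_ ?_ ?_ ?_ hc (.inr ⟨σ, τ, .rfl, h⟩)
  · rintro ρ ρ' s t e (h | ⟨σ, τ, e', h⟩)
    · exact .of (.inl (h.conv e))
    · exact .of (.inr ⟨σ, τ, e.symm.trans e', h⟩)
  · rintro s t (h | ⟨σ, τ, e', h⟩)
    · exact h.of_nat
    · exact (Ty.not_nat_betaEq_arr e').elim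
  · rintro σ τ s t (h | ⟨σ', τ', e', h⟩) q hq hqc
    · exact .of (.inl (h.app hq hqc))
    · exact .of (.inl ((h q (hq.conv e'.arr_inj.1) hqc).conv e'.arr_inj.2.symm))
  · rintro κ τ s t (h | ⟨σ', τ', e', h⟩) ψ hψ
    · exact .of (.inl (h.tapp hψ))
    · exact (Ty.not_arr_betaEq_all e'.symm).elim

theorem OrdAt.of_tapp {P : ℕ → ℕ → Prop} {κ : Kind} {τ : Typ} (hc : (Ty.all κ τ).Closed)
    {s t : Tm} (h : ∀ ψ : Ty κ, ψ.Closed → OrdAt P (τ.inst ψ) (.tapp s ψ) (.tapp t ψ)) :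
    OrdAt P (.all κ τ) s t := by
  refine coinduction (fun ρ s t => OrdAt P ρ s t ∨ ∃ κ τ, ρ.BetaEq (.all κ τ) ∧
    ∀ ψ : Ty κ, ψ.Closed → OrdAt P (τ.inst ψ) (.tapp s ψ) (.tapp t ψ))
    ?_ ?_ ?_ ?_ hc (.inr ⟨κ, τ, .rfl, h⟩)
  · rintro ρ ρ' s t e (h | ⟨κ, τ, e', h⟩)
    · exact .of (.inl (h.conv e))
    · exact .of (.inr ⟨κ, τ, e.symm.trans e', h⟩)
  · rintro s t (h | ⟨κ, τ, e', h⟩)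
    · exact h.of_nat
    · exact (Ty.not_nat_betaEq_all e').elim
  · rintro σ τ s t (h | ⟨κ, τ', e', h⟩) q hq hqc
    · exact .of (.inl (h.app hq hqc))
    · exact (Ty.not_arr_betaEq_all e').elim
  · rintro κ τ s t (h | ⟨κ', τ', e', h⟩) ψ hψ
    · exact .of (.inl (h.tapp hψ))
    · obtain ⟨rfl, e⟩ := e'.all_inj
      exact .of (.inl ((h ψ hψ).conv (e.inst .rfl).symm))

theorem Safe.tlamVar {Γ : Ctx} (hΓ : ∀ τ : Typ, {y : ℕ | (Γ y).BetaEq τ}.Infinite) {x : ℕ}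
    {σ : Typ} {t : Tm} {κ : Kind} {a : ℕ}
    (hfree : ∀ z, t.Free z → ∃ ρ : Typ, (Γ z).BetaEq ρ ∧ ¬ ρ.Free κ a) (h : Safe Γ σ t x) :
    Safe Γ (allVar κ a σ) (tlamVar κ a t) x := by
  classical
  have ht := h.1
  -- `close κ a` and `shift κ` differ only at the variable `var κ a`.
  have ren : ∀ ρ : Typ, ¬ ρ.Free κ a → ρ.ren (TyRen.close κ a) = ρ.ren (TyRen.shift κ) :=
    fun ρ hρ => Ty.ren_congr ρ fun κ' b hb => by
      by_cases e : κ' = κ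
      · subst e
        simp [TyRen.close, show b ≠ a from fun e => hρ (e ▸ hb)]
      · simp [TyRen.close, e]
  have ht' : HasType Γ (PolyInterp.tlamVar κ a t) (allVar κ a σ) := by
    refine .tlam ((ht.tren (TyRen.close κ a)).ctx fun z hz => ?_)
    obtain ⟨ρ, hρ, hn⟩ := hfree z (free_tren.1 hz)
    have h₁ := hρ.ren (TyRen.close κ a)
    rw [ren ρ hn] at h₁
    exact h₁.trans (hρ.ren _).symm
  refine safe_iff.2 ⟨ht', fun s₁ s₂ h₁ h₂ hs ω γ hc => ?_⟩
  refine OrdAt.of_tapp (hc.closed_sub (allVar κ a σ)) fun ψ hψ => ?_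
  let ω' : TySub := fun κ' b => TySub.cons ψ ω κ' (TyRen.close κ a κ' b)
  have hω' : ∀ ρ : Typ, ¬ ρ.Free κ a → ∀ κ' b, ρ.Free κ' b → ω κ' b = ω' κ' b := by
    intro ρ hρ κ' b hb
    by_cases e : κ' = κ
    · subst e
      simp [ω', TyRen.close, show b ≠ a from fun e => hρ (e ▸ hb)]
    · simp [ω', TyRen.close, e]
  have hclosed : ∀ κ' b, (ω' κ' b).Closed := by
    intro κ' b
    by_cases e : κ' = κ
    · subst e
      by_cases e' : b = a
      · simpa [ω', TyRen.close, e'] using hψ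
      · simpa [ω', TyRen.close, e'] using hc.closed κ' b
    · simpa [ω', TyRen.close, e] using hc.closed κ' b
  have hconv : ∀ z, t.Free z → ((Γ z).sub ω).BetaEq ((Γ z).sub ω') := fun z hz => by
    obtain ⟨ρ, hρ, hn⟩ := hfree z hz
    have := hρ.sub_left ω
    rw [Ty.sub_congr ρ (hω' ρ hn)] at this
    exact this.trans (hρ.sub_left ω').symm
  let γ' : ℕ → Tm := fun z => if t.Free z then γ z else .lift ((Γ z).sub ω') (.num 0)
  have hc' : GroundClosure Γ ω' γ' := by
    refine ⟨hclosed, fun z => ?_⟩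
    by_cases hz : t.Free z
    · simp only [γ', if_pos hz]
      exact ⟨(hc.ground z).1, ((hc.ground z).1.hasType (hc.ground z).2 _).conv (hconv z hz)⟩
    · simp only [γ', if_neg hz]
      exact ⟨.lift (Ty.closed_sub _ hclosed) (.sym _), .lift _ (.num _ _)⟩
  have key := h.ordAt_of_closures hΓ h₁ h₂ hs hc hc' fun hx => by
    obtain ⟨ρ, hρ, hn⟩ := hfree x hx
    exact ⟨ρ, hρ, hω' ρ hn⟩
  have hτ : ((σ.ren (TyRen.close κ a)).sub (ω.up κ)).inst ψ = σ.sub ω' := by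
    rw [Ty.sub_up_inst, Ty.sub_of_ren]
  have exp : ∀ q, Exp
      (.tapp (((PolyInterp.tlamVar κ a t).tsub ω).sub (Function.update γ x q)) ψ)
      ((t.tsub ω').sub (Function.update γ' x q)) := fun q => by
    refine (HStep.exp (.root (.tbeta _ ψ))).trans (.of_equiv ?_)
    rw [← tinst_sub, tsub_up_inst, tsub_of_tren, sub_congr]
    · exact .refl _
    · intro y hy
      by_cases e : y = x
      · subst e; simp
      · simp [e, γ', free_tsub.1 hy]
  rw [hτ]
  exact key.exp (hc'.closed_sub σ) (exp _) (exp _)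

theorem Safe.lamVar {Γ : Ctx} (hΓ : ∀ τ : Typ, {y : ℕ | (Γ y).BetaEq τ}.Infinite) {x : ℕ}
    {σ : Typ} {t : Tm} {y : ℕ} (hy : y ≠ x) (h : Safe Γ σ t x) :
    Safe Γ (.arr (Γ y) σ) (lamVar Γ y t) x := by
  have ht' : HasType Γ (PolyInterp.lamVar Γ y t) (.arr (Γ y) σ) := by
    refine .lam (h.1.ren fun z _ => ?_)
    by_cases e : z = y
    · subst e; simp only [if_pos]; exact .rfl
    · simp only [if_neg e]; exact .rfl
  refine safe_iff.2 ⟨ht', fun s₁ s₂ h₁ h₂ hs ω γ hc => ?_⟩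
  refine OrdAt.of_app (hc.closed_sub (.arr (Γ y) σ)) fun q hq hqc => ?_
  have key := h.ordAt_of_closures hΓ h₁ h₂ hs hc (hc.update y hqc (hqc.hasType hq _))
    fun _ => ⟨Γ x, .rfl, fun _ _ _ => rfl⟩
  have exp : ∀ p, Exp (.app (((PolyInterp.lamVar Γ y t).tsub ω).sub (Function.update γ x p)) q)
      ((t.tsub ω).sub (Function.update (Function.update γ y q) x p)) := fun p => by
    refine (HStep.exp (.root (.beta _ _ q))).trans (.of_equiv ?_)
    rw [sub_upSub_inst, tsub_of_ren, sub_of_ren, sub_congr]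
    · exact .refl _
    · intro z _
      by_cases e : z = y
      · subst e; simp [hy, Tm.cons]
      · by_cases e' : z = x
        · subst e'; simp [e, Tm.cons]
        · simp [e, e', Tm.cons]
  exact key.exp (hc.closed_sub σ) (exp _) (exp _)

end PolyInterp

open PolyInterp
theorem mainTheorem7 (Γ : Ctx) (hΓ : ∀ τ : Typ, {y : ℕ | (Γ y).BetaEq τ}.Infinite) (x : ℕ) :
    (∀ (us : List (Tm ⊕ (Σ κ : Kind, Ty κ))) (σ : Typ),
      HasType Γ (spine (Tm.var x) us) σ → Safe Γ σ (spine (Tm.var x) us) x) ∧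
    (∀ (t : Tm), Safe Γ Ty.nat t x → ∀ σ : Typ, Safe Γ σ (Tm.lift σ t) x) ∧
    (∀ (σ : Typ) (t : Tm), Safe Γ σ t x → Safe Γ Ty.nat (Tm.flatten σ t) x) ∧
    (∀ (σ : Typ) (s₁ s₂ : Tm), HasType Γ s₁ σ → HasType Γ s₂ σ →
      (Safe Γ σ s₁ x ∨ Safe Γ σ s₂ x) → Safe Γ σ (Tm.oplus σ s₁ s₂) x) ∧
    (∀ (σ : Typ) (s₁ s₂ : Tm), HasType Γ s₁ σ → HasType Γ s₂ σ →
      ((Safe Γ σ s₁ x ∧ SuccEq Γ σ s₂ (Tm.lift σ (Tm.num 1))) ∨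
        (Safe Γ σ s₂ x ∧ SuccEq Γ σ s₁ (Tm.lift σ (Tm.num 1)))) →
      Safe Γ σ (Tm.otimes σ s₁ s₂) x) ∧
    (∀ (σ : Typ) (t : Tm) (κ : Kind) (a : ℕ),
      (∀ z, t.Free z → ∃ ρ : Typ, (Γ z).BetaEq ρ ∧ ¬ ρ.Free κ a) →
      Safe Γ σ t x → Safe Γ (allVar κ a σ) (tlamVar κ a t) x) ∧
    (∀ (σ : Typ) (t : Tm) (y : ℕ), y ≠ x →
      Safe Γ σ t x → Safe Γ (Ty.arr (Γ y) σ) (lamVar Γ y t) x) := by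
  refine ⟨fun us σ h => (HeadVar.var.spine us).safe h, fun t h σ => h.lift σ,
    fun σ t h => h.flatten, ?_, ?_, fun σ t κ a hf h => h.tlamVar hΓ hf,
    fun σ t y hy h => h.lamVar hΓ hy⟩
  · rintro σ s₁ s₂ h₁ h₂ (h | h)
    · exact h.oplus_left h₂
    · exact h.oplus_right h₁
  · rintro σ s₁ s₂ h₁ h₂ (⟨h, h'⟩ | ⟨h, h'⟩)
    · exact h.otimes_left h₂ h'
    · exact h.otimes_right h₁ h'
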